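/- All objects are finite. A hypergraph consists of vertices, edges and incidences, each incidence containing one vertex and one edge; parallel incidences are allowed. The degree of a vertex (size of an edge) is its number of incidences; a $k$-edge is an edge of size $k$. An oriented hypergraph carries in addition a sign $\sigma(i)\in\{+1,-1\}$ on each incidence $i$. Its incidence matrix has as $(v,e)$-entry the sum of $\sigma(i)$ over the incidences $i$ containing $v$ and $e$. It is minimally dependent if the family of columns of this matrix is linearly dependent over $\mathbb{R}$ and every proper subfamily is independent. A circle of length $k\ge 1$ is a closed alternating sequence of $k$ vertices and $k$ edges, joined by $2k$ incidences, without repetitions; its sign is $(-1)^k$ times the product of the signs of its incidences. An oriented hypergraph is balanced if all its circles are positive; a balanced minimal dependency is a balanced, minimally dependent oriented hypergraph. A path is an alternating sequence of vertices and edges, consecutive ones joined by incidences, without repetitions; a hypergraph is connected if any two of its vertices and edges are joined by a path. A subhypergraph is given by sets of vertices, edges and incidences containing the ends of each chosen incidence; two are disjoint if they have nothing in common, and nearly-disjoint if they are disjoint or have exactly a single vertex in common. Weak deletion removes vertices or edges together with the incidences containing them. The subhypergraph induced by a set of edges consists of these edges, all incidences containing them, and the vertices of those incidences. A hypergraph is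 circle-covered if any two of its incidences lie in a common circle and it either contains a circle or is a single $0$-edge (with no vertices). A flower is a circle-covered hypergraph none of whose proper edge-induced subhypergraphs is circle-covered. A thorn is a vertex of degree $1$ whose edge lies in a circle or is a $1$-edge. A pseudo-flower is a hypergraph with at least one thorn such that weak deletion of all its thorns leaves a flower (so a single $1$-edge with its vertex is a pseudo-flower). An artery is a connected hypergraph without circles and $1$-edges all of whose vertices have degree $1$ or $2$, or a single vertex; its external vertices are those of degree $\neq 2$ in it. A floral thorn-connection is a connected hypergraph without vertices of degree $1$ that is the union of a non-empty collection $\mathcal P$ of pairwise nearly-disjoint pseudo-flowers and a collection $\mathcal A$ of pairwise disjoint arteries such that: if $P\in\mathcal P$ meets $A\in\mathcal A$, then $P\cap A$ is a single vertex, which is a thorn of $P$ and an external vertex of $A$; if distinct $P,Q\in\mathcal P$ meet, then $P\cap Q$ is a single vertex $w$, the one-vertex artery $w$ belongs to $\mathcal A$, and no further member of $\mathcal P$ contains $w$; and weak deletion of any one edge or vertex of an artery in $\mathcal A$ disconnects the hypergraph. Contraction of a vertex of degree $2$ removes it and combines its two edges into one. A hypercircle is a single $0$-edge, a flower, or the result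 of contracting all vertices that lie in arteries of a floral thorn-connection. A subdivision of an oriented hypergraph splits one edge $e$ into two edges $e_1,e_2$ along a bipartition of the incidences of $e$ (a part may be empty), keeping their signs, and adds one new vertex $u$ with one new incidence to each of $e_1,e_2$, with arbitrary signs. It is balanced if the two new signs are opposite, or if they are equal and $u$ lies in no circle of the subdivided hypergraph. A balanced subdivision of $H$ is, up to isomorphism, the result of finitely many (possibly no) successive such balanced steps starting from $H$. Theorem. Let $G$ be an oriented hypergraph without isolated vertices (vertices of degree $0$). Then $G$ is a balanced minimal dependency if and only if $G$ is a balanced subdivision of a balanced hypercircle (an oriented hypergraph that is balanced and whose underlying hypergraph is a hypercircle). If parallel incidences of $G$ have equal signs, the same equivalence holds with hypercircles restricted to those whose parallel incidences have equal signs. -/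

import Mathlib

universe u

/-- A finite hypergraph, presented by its set `I` of incidences: `i : I` is an incidence containing
the vertex `vert i` and the edge `edge i`. The multiplicity of `(v, e)` is the number of
`i` with `vert i = v` and `edge i = e`; it may be any natural number. Edges of size `0` or `1`
and vertices of degree `0` are allowed. -/
structure IncHypergraph where
  V : Type u
  E : Type u
  I : Type u
  vert : I → V
  edge : I → E
  finite_V : Finite V
  finite_E : Finite E
  finite_I : Finite I

attribute [instance] IncHypergraph.finite_V IncHypergraph.finite_E IncHypergraph.finite_I

namespace IncHypergraph

/-- The number of incidences containing `v`. -/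
noncomputable def degree (G : IncHypergraph.{u}) (v : G.V) : ℕ := Nat.card {i : G.I // G.vert i = v}

/-- The number of incidences containing `e`. -/
noncomputable def size (G : IncHypergraph.{u}) (e : G.E) : ℕ := Nat.card {i : G.I // G.edge i = e}

/-- The incidence graph (with parallel edges merged), used for connectivity only. -/
def incidenceGraph (G : IncHypergraph.{u}) : SimpleGraph (G.V ⊕ G.E) :=
  SimpleGraph.fromRel fun x y => ∃ i : G.I, x = Sum.inl (G.vert i) ∧ y = Sum.inr (G.edge i)

/-- Any two elements of `V ∪ E` are joined by a path. The empty hypergraph is connected. -/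
def IsConnected (G : IncHypergraph.{u}) : Prop := G.incidenceGraph.Preconnected

/-- A circle of length `n + 1`, written as a closed sequence
`v 0, out 0, e 0, ret 0, v 1, out 1, e 1, ret 1, …, v n, out n, e n, ret n, v 0`
without repetition of a vertex, an edge or an incidence.
Addition in `Fin (n + 1)` is cyclic. -/
structure Circle (G : IncHypergraph.{u}) where
  n : ℕ
  v : Fin (n + 1) → G.V
  e : Fin (n + 1) → G.E
  out : Fin (n + 1) → G.I
  ret : Fin (n + 1) → G.I
  vert_out : ∀ t, G.vert (out t) = v t
  edge_out : ∀ t, G.edge (out t) = e t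
  edge_ret : ∀ t, G.edge (ret t) = e t
  vert_ret : ∀ t, G.vert (ret t) = v (t + 1)
  v_injective : Function.Injective v
  e_injective : Function.Injective e
  out_injective : Function.Injective out
  ret_injective : Function.Injective ret
  out_ne_ret : ∀ s t, out s ≠ ret t

/-- The vertices of a circle. -/
def Circle.verts {G : IncHypergraph.{u}} (C : G.Circle) : Set G.V := Set.range C.v

/-- The edges of a circle. -/
def Circle.edges {G : IncHypergraph.{u}} (C : G.Circle) : Set G.E := Set.range C.e

/-- The incidences of a circle. -/
def Circle.incs {G : IncHypergraph.{u}} (C : G.Circle) : Set G.I :=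
  Set.range C.out ∪ Set.range C.ret

/-- An isomorphism of hypergraphs. -/
structure Iso (G H : IncHypergraph.{u}) where
  onV : G.V ≃ H.V
  onE : G.E ≃ H.E
  onI : G.I ≃ H.I
  vert_onI : ∀ i, H.vert (onI i) = onV (G.vert i)
  edge_onI : ∀ i, H.edge (onI i) = onE (G.edge i)

/-! ### Subhypergraphs -/

/-- A subhypergraph: sets of vertices, edges and incidences such that every chosen incidence
has both of its ends chosen. Parts of edges may be missing. -/
@[ext]
structure Sub (G : IncHypergraph.{u}) where
  verts : Set G.V
  edges : Set G.E
  incs : Set G.I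
  vert_mem : ∀ i ∈ incs, G.vert i ∈ verts
  edge_mem : ∀ i ∈ incs, G.edge i ∈ edges

namespace Sub

variable {G : IncHypergraph.{u}}

/-- A subhypergraph as a hypergraph of its own. -/
def toHypergraph (H : G.Sub) : IncHypergraph.{u} where
  V := H.verts
  E := H.edges
  I := H.incs
  vert i := ⟨G.vert i, H.vert_mem i i.2⟩
  edge i := ⟨G.edge i, H.edge_mem i i.2⟩
  finite_V := inferInstance
  finite_E := inferInstance
  finite_I := inferInstance

/-- The whole hypergraph. -/
def whole (G : IncHypergraph.{u}) : G.Sub :=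
  ⟨Set.univ, Set.univ, Set.univ, fun _ _ => trivial, fun _ _ => trivial⟩

/-- The empty subhypergraph `(∅, ∅, ∅)`. -/
def empty (G : IncHypergraph.{u}) : G.Sub := ⟨∅, ∅, ∅, fun _ h => h.elim, fun _ h => h.elim⟩

/-- The subhypergraph `(v, ∅, ∅)`. -/
def single (v : G.V) : G.Sub := ⟨{v}, ∅, ∅, fun _ h => h.elim, fun _ h => h.elim⟩

/-- The componentwise intersection. -/
def inter (H K : G.Sub) : G.Sub where
  verts := H.verts ∩ K.verts
  edges := H.edges ∩ K.edges
  incs := H.incs ∩ K.incs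
  vert_mem i h := ⟨H.vert_mem i h.1, K.vert_mem i h.2⟩
  edge_mem i h := ⟨H.edge_mem i h.1, K.edge_mem i h.2⟩

end Sub

/-- The edge-induced subhypergraph `G : F`: the edges in `F`, the vertices incident to them, and
all incidences between them. -/
def edgeInduced (G : IncHypergraph.{u}) (F : Set G.E) : G.Sub where
  verts := {v | ∃ i, G.vert i = v ∧ G.edge i ∈ F}
  edges := F
  incs := {i | G.edge i ∈ F}
  vert_mem i h := ⟨i, rfl, h⟩
  edge_mem _ h := h

/-- Weak deletion of a set of vertices, together with the incidences containing them. -/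
def deleteVerts (G : IncHypergraph.{u}) (S : Set G.V) : G.Sub where
  verts := Sᶜ
  edges := Set.univ
  incs := {i | G.vert i ∉ S}
  vert_mem _ h := h
  edge_mem _ _ := trivial

/-- Weak deletion of an edge, together with the incidences containing it. -/
def deleteEdge (G : IncHypergraph.{u}) (e : G.E) : G.Sub where
  verts := Set.univ
  edges := {e}ᶜ
  incs := {i | G.edge i ≠ e}
  vert_mem _ _ := trivial
  edge_mem _ h := h

/-! ### Flowers and pseudo-flowers -/

/-- A hypergraph that consists of one edge of size `0` and nothing else. -/
def IsZeroEdge (G : IncHypergraph.{u}) : Prop := IsEmpty G.V ∧ ∃! _e : G.E, True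

/-- Every pair of incidences is contained in a circle. -/
def IsInseparable (G : IncHypergraph.{u}) : Prop :=
  ∀ i j : G.I, i ≠ j → ∃ C : G.Circle, i ∈ C.incs ∧ j ∈ C.incs

/-- Inseparable, and either containing a circle or being a single `0`-edge. -/
def IsCircleCovered (G : IncHypergraph.{u}) : Prop :=
  G.IsInseparable ∧ (Nonempty G.Circle ∨ G.IsZeroEdge)

/-- A circle-covered hypergraph that is minimal among its edge-induced subhypergraphs. -/
def IsFlower (G : IncHypergraph.{u}) : Prop :=
  G.IsCircleCovered ∧
    ∀ F : Set G.E, (G.edgeInduced F).toHypergraph.IsCircleCovered →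
      G.edgeInduced F = Sub.whole G

/-- A thorn is a monovalent vertex whose edge lies in a circle. The vertex of a `1`-edge counts as
a thorn as well, so that a single `1`-edge is a pseudo-flower whose flower-part is a `0`-edge. -/
def IsThorn (G : IncHypergraph.{u}) (v : G.V) : Prop :=
  G.degree v = 1 ∧
    ∃ i, G.vert i = v ∧ ((∃ C : G.Circle, G.edge i ∈ C.edges) ∨ G.size (G.edge i) = 1)

/-- At least one thorn, and the weak deletion of all thorns leaves a flower. -/
def IsPseudoFlower (G : IncHypergraph.{u}) : Prop :=
  (∃ v, G.IsThorn v) ∧ (G.deleteVerts {v | G.IsThorn v}).toHypergraph.IsFlower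

/-! ### Arteries and hypercircles -/

/-- Either connected, circle-free and without `1`-edges, all vertices having degree `1` or `2`,
or a single vertex. -/
def IsArtery (G : IncHypergraph.{u}) : Prop :=
  (G.IsConnected ∧ IsEmpty G.Circle ∧ (∀ e, G.size e ≠ 1) ∧ ∀ v, G.degree v = 1 ∨ G.degree v = 2) ∨
    ((∃! _v : G.V, True) ∧ IsEmpty G.E)

/-- `G` is the union of the collection `Hs` of pairwise nearly-disjoint hypergraphs and of the
collection `As` of pairwise disjoint arteries, and it is an arterial connection of them. -/
structure IsArterialConnection (G : IncHypergraph.{u}) (Hs As : Set G.Sub) : Prop where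
  cover_V : ∀ v, ∃ K ∈ Hs ∪ As, v ∈ K.verts
  cover_E : ∀ e, ∃ K ∈ Hs ∪ As, e ∈ K.edges
  cover_I : ∀ i, ∃ K ∈ Hs ∪ As, i ∈ K.incs
  artery : ∀ A ∈ As, A.toHypergraph.IsArtery
  arteries_disjoint : ∀ A ∈ As, ∀ B ∈ As, A ≠ B → A.inter B = Sub.empty G
  nearly_disjoint : ∀ H ∈ Hs, ∀ K ∈ Hs, H ≠ K →
    H.inter K = Sub.empty G ∨ ∃ w, H.inter K = Sub.single w
  connected : G.IsConnected
  meet_artery : ∀ H ∈ Hs, ∀ A ∈ As, H.inter A ≠ Sub.empty G →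
    ∃ v : A.toHypergraph.V, H.inter A = Sub.single v.1 ∧ A.toHypergraph.degree v ≠ 2
  meet_in_artery : ∀ H ∈ Hs, ∀ K ∈ Hs, H ≠ K → H.inter K ≠ Sub.empty G →
    ∃ w, H.inter K = Sub.single w ∧ Sub.single w ∈ As
  only_two : ∀ H ∈ Hs, ∀ K ∈ Hs, H ≠ K → ∀ w, H.inter K = Sub.single w →
    ∀ L ∈ Hs, w ∈ L.verts → L = H ∨ L = K
  edge_disconnects : ∀ A ∈ As, ∀ e ∈ A.edges, ¬ (G.deleteEdge e).toHypergraph.IsConnected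
  vert_disconnects : ∀ A ∈ As, ∀ v ∈ A.verts, ¬ (G.deleteVerts {v}).toHypergraph.IsConnected

/-- A thorn-connection of a (non-empty) collection of pseudo-flowers: an arterial connection in
which arteries meet pseudo-flowers in thorns only. -/
structure IsThornConnection (G : IncHypergraph.{u}) (Ps As : Set G.Sub) : Prop where
  nonempty : Ps.Nonempty
  pseudoFlower : ∀ P ∈ Ps, P.toHypergraph.IsPseudoFlower
  arterial : G.IsArterialConnection Ps As
  meet_thorn : ∀ P ∈ Ps, ∀ A ∈ As, P.inter A ≠ Sub.empty G →
    ∃ t : P.toHypergraph.V, P.inter A = Sub.single t.1 ∧ P.toHypergraph.IsThorn t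

/-- There are no monovalent vertices. -/
def IsFloral (G : IncHypergraph.{u}) : Prop := ∀ v, G.degree v ≠ 1

/-- Contraction of all vertices of `S`, one after the other: contracting a vertex of degree `2`
removes it and combines its two edges into one. -/
def contractVerts (G : IncHypergraph.{u}) (S : Set G.V) : IncHypergraph.{u} where
  V := (Sᶜ : Set G.V)
  E := Quot fun e f : G.E =>
    ∃ i j : G.I, G.vert i ∈ S ∧ G.vert i = G.vert j ∧ G.edge i = e ∧ G.edge j = f
  I := {i : G.I // G.vert i ∉ S}
  vert i := ⟨G.vert i.1, i.2⟩
  edge i := Quot.mk _ (G.edge i.1)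
  finite_V := inferInstance
  finite_E := inferInstance
  finite_I := inferInstance

/-- A hypercircle: a `0`-edge, a flower, or the result of contracting all vertices that belong to
the arteries of a floral thorn-connection. -/
def IsHypercircle (G : IncHypergraph.{u}) : Prop :=
  G.IsZeroEdge ∨ G.IsFlower ∨
    ∃ (T : IncHypergraph.{u}) (Ps As : Set T.Sub), T.IsThornConnection Ps As ∧ T.IsFloral ∧
      Nonempty (Iso (T.contractVerts {v | ∃ A ∈ As, v ∈ A.verts}) G)

end IncHypergraph

/-- An oriented hypergraph: a hypergraph with a sign on every incidence. -/
structure OrientedHypergraph extends IncHypergraph.{u} where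
  σ : I → ℤˣ

namespace OrientedHypergraph

/-- Parallel incidences carry the same orientation. -/
def ParallelAgree (G : OrientedHypergraph.{u}) : Prop :=
  ∀ i j : G.I, G.vert i = G.vert j → G.edge i = G.edge j → G.σ i = G.σ j

/-- The sign of a circle of length `k`: `(-1) ^ k` times the product of its `2 * k` incidences. -/
def circleSign (G : OrientedHypergraph.{u}) (C : G.toIncHypergraph.Circle) : ℤˣ :=
  (-1) ^ (C.n + 1) * ∏ t, G.σ (C.out t) * G.σ (C.ret t)

/-- All circles are positive. -/
def IsBalanced (G : OrientedHypergraph.{u}) : Prop :=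
  ∀ C : G.toIncHypergraph.Circle, G.circleSign C = 1

/-- The incidence matrix; the sum is finite. -/
noncomputable def incidenceMatrix (G : OrientedHypergraph.{u}) : Matrix G.V G.E ℝ :=
  fun v e => ∑ᶠ i : {i : G.I // G.vert i = v ∧ G.edge i = e}, (((G.σ i.1 : ℤˣ) : ℤ) : ℝ)

/-- The family of columns of the incidence matrix is linearly dependent, and every
proper subfamily is linearly independent. -/
def IsMinimallyDependent (G : OrientedHypergraph.{u}) : Prop :=
  ¬ LinearIndependent ℝ G.incidenceMatrix.col ∧
    ∀ F : Set G.E, F ≠ Set.univ → LinearIndepOn ℝ G.incidenceMatrix.col F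

/-- An isomorphism that preserves the orientation. -/
structure Iso (G H : OrientedHypergraph.{u}) extends
    IncHypergraph.Iso G.toIncHypergraph H.toIncHypergraph where
  σ_onI : ∀ i, H.σ (onI i) = G.σ i

open Classical in
/-- Subdivision of the edge `e`: the incidences of `e` that lie in `B` are moved to a new edge
`none`, the others stay at `some e`, and a new vertex `none` is put between the two, with
an incidence of sign `s` at `some e` and one of sign `t` at `none`.
Either part of the bipartition may be empty. -/
noncomputable def subdivide (G : OrientedHypergraph.{u}) (e : G.E) (B : Set G.I) (s t : ℤˣ) :
    OrientedHypergraph.{u} where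
  V := Option G.V
  E := Option G.E
  I := G.I ⊕ Bool
  vert := Sum.elim (fun i => some (G.vert i)) (fun _ => none)
  edge := Sum.elim (fun i => if G.edge i = e ∧ i ∈ B then none else some (G.edge i))
    (fun b => if b then none else some e)
  σ := Sum.elim G.σ (fun b => if b then t else s)
  finite_V := inferInstance
  finite_E := inferInstance
  finite_I := inferInstance

/-- `H` arises from `G` by one balanced subdivision: the two new incidences have
opposite signs (compatible), or they have equal signs (incompatible) and the new vertex lies in
no circle of the subdivision. -/
def IsBalancedSubdivisionStep (G H : OrientedHypergraph.{u}) : Prop :=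
  ∃ (e : G.E) (B : Set G.I) (s t : ℤˣ), Nonempty (Iso (G.subdivide e B s t) H) ∧
    (s * t = -1 ∨ (s * t = 1 ∧
      ∀ C : (G.subdivide e B s t).toIncHypergraph.Circle, (none : Option G.V) ∉ C.verts))

/-- `H` arises from `G` by finitely many (possibly no) successive balanced subdivisions. -/
def IsBalancedSubdivision (G H : OrientedHypergraph.{u}) : Prop :=
  Relation.ReflTransGen IsBalancedSubdivisionStep G H

/-- A hypercircle all of whose circles are positive. -/
def IsBalancedHypercircle (G : OrientedHypergraph.{u}) : Prop :=
  G.toIncHypergraph.IsHypercircle ∧ G.IsBalanced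

end OrientedHypergraph

/-! Both sides are compared with one condition, `IsGood`: there is an edge, the hypergraph is
connected, and every vertex has degree two. A balanced hypergraph without isolated vertices is a
minimal dependency exactly when it is good, and the balanced good hypergraphs are exactly the
balanced subdivisions of balanced hypercircles.

Circles are handled through the cycle space mod 2 of the incidence graph. Even sets of incidences
decompose into circles, and a circle is positive if and only if its signs sum to a multiple of 4.
Hence balance means that this divisibility holds on every even set (`EvenBalanced`), a condition
that restricts to subhypergraphs and is easily followed through contractions and subdivisions.

Linear algebra. `IsMinKernel.supportLeTwo` shows that a minimal kernel vector of a balanced matrix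
meets each row in at most two incidences. Rows are added one at a time; a minimal vector for the
earlier rows has constant absolute value and connected support, so balance makes any two of its
incidences at a new vertex cancel. Thus a balanced minimal dependency has degree two. Conversely, a
balanced good hypergraph can be switched to have opposite signs at each vertex
(`IsGood.exists_switch`). The switching function is then a kernel vector, and connectivity forbids a
nonzero kernel vector with a zero entry.

From hypercircles to good hypergraphs. In a balanced flower, a maximal inseparable set of incidences
of degree at most two contains every incidence of its edges, since otherwise three disjoint walks
between an edge and a vertex appear or the set can be enlarged (`IsThinCore.mem_of_edge_eq`). Flower
minimality makes this set everything. The property passes through thorn-connections, contraction and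
balanced subdivision.

From good hypergraphs to hypercircles. Vertices in no circle are contracted one by one
(`exists_hypercircle`). If every vertex lies in a circle, sharing a circle is an equivalence
relation. With one class the hypergraph is a flower; with several, cutting the edges between classes
displays it as a contracted floral thorn-connection (`explode_isThornConnection`,
`explode_contract_iso`). -/

namespace IncHypergraph

variable {G : IncHypergraph.{u}}

noncomputable instance : Fintype G.V := Fintype.ofFinite _
noncomputable instance : Fintype G.E := Fintype.ofFinite _
noncomputable instance : Fintype G.I := Fintype.ofFinite _
noncomputable instance : DecidableEq G.V := Classical.decEq _
noncomputable instance : DecidableEq G.E := Classical.decEq _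
noncomputable instance : DecidableEq G.I := Classical.decEq _

/-! ### Connectivity through a set of incidences -/

/-- The nodes `a` and `b` are joined by a walk that uses incidences in `T` only. -/
def Conn (T : Set G.I) (a b : G.V ⊕ G.E) : Prop :=
  -- Connectedness is stated as the absence of a separating predicate. Connectivity arguments then
  -- amount to choosing `p`, without manipulating walks.
  ∀ p : G.V ⊕ G.E → Prop,
    (∀ i ∈ T, p (Sum.inl (G.vert i)) ↔ p (Sum.inr (G.edge i))) → p a → p b

namespace Conn

variable {T U : Set G.I} {a b c : G.V ⊕ G.E}

theorem refl (T : Set G.I) (a : G.V ⊕ G.E) : Conn T a a := fun _ _ h => h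

theorem trans (h : Conn T a b) (k : Conn T b c) : Conn T a c :=
  fun p hp ha => k p hp (h p hp ha)

/-- The complement of a closed predicate is closed. -/
theorem symm (h : Conn T a b) : Conn T b a := fun p hp hb => by
  by_contra ha
  exact h (fun x => ¬ p x) (fun i hi => not_congr (hp i hi)) ha hb

theorem mono (hTU : T ⊆ U) (h : Conn T a b) : Conn U a b :=
  fun p hp ha => h p (fun i hi => hp i (hTU hi)) ha

theorem of_mem {i : G.I} (hi : i ∈ T) : Conn T (Sum.inl (G.vert i)) (Sum.inr (G.edge i)) :=
  fun _ hp ha => (hp i hi).1 ha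

theorem vert_iff_edge {i : G.I} (hi : i ∈ T) :
    Conn T a (Sum.inl (G.vert i)) ↔ Conn T a (Sum.inr (G.edge i)) :=
  ⟨fun h => h.trans (of_mem hi), fun h => h.trans (of_mem hi).symm⟩

end Conn

/-- The graph formed by the incidences in `T`. -/
def partGraph (T : Set G.I) : SimpleGraph (G.V ⊕ G.E) :=
  SimpleGraph.fromRel fun x y => ∃ i ∈ T, x = Sum.inl (G.vert i) ∧ y = Sum.inr (G.edge i)

theorem partGraph_adj_of_mem {T : Set G.I} {i : G.I} (hi : i ∈ T) :
    (partGraph T).Adj (Sum.inl (G.vert i)) (Sum.inr (G.edge i)) := by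
  rw [partGraph, SimpleGraph.fromRel_adj]
  exact ⟨Sum.inl_ne_inr, Or.inl ⟨i, hi, rfl, rfl⟩⟩

theorem Conn.reachable {T : Set G.I} {a b : G.V ⊕ G.E} (h : Conn T a b) :
    (partGraph T).Reachable a b :=
  h (fun x => (partGraph T).Reachable a x)
    (fun _ hi => ⟨fun k => k.trans (partGraph_adj_of_mem hi).reachable,
      fun k => k.trans (partGraph_adj_of_mem hi).symm.reachable⟩) (SimpleGraph.Reachable.refl _)

theorem conn_of_adj {T : Set G.I} {a b : G.V ⊕ G.E} (h : (partGraph T).Adj a b) : Conn T a b := by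
  rw [partGraph, SimpleGraph.fromRel_adj] at h
  obtain ⟨-, ⟨i, hi, rfl, rfl⟩ | ⟨i, hi, rfl, rfl⟩⟩ := h
  · exact Conn.of_mem hi
  · exact (Conn.of_mem hi).symm

theorem conn_of_reachable {T : Set G.I} {a b : G.V ⊕ G.E} (h : (partGraph T).Reachable a b) :
    Conn T a b := by
  obtain ⟨w⟩ := h
  induction w with
  | nil => exact Conn.refl _ _
  | cons h _ ih => exact (conn_of_adj h).trans ih

theorem isConnected_iff : G.IsConnected ↔ ∀ a b, Conn (Set.univ : Set G.I) a b := by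
  have : G.incidenceGraph = partGraph (Set.univ : Set G.I) := by
    simp [incidenceGraph, partGraph]
  rw [IsConnected, this]
  exact ⟨fun h a b => conn_of_reachable (h a b), fun h a b => (h a b).reachable⟩

theorem adj_inl {T : Set G.I} {v : G.V} {y : G.V ⊕ G.E} (h : (partGraph T).Adj (Sum.inl v) y) :
    ∃ i ∈ T, G.vert i = v ∧ y = Sum.inr (G.edge i) := by
  rw [partGraph, SimpleGraph.fromRel_adj] at h
  obtain ⟨-, ⟨i, hi, h1, h2⟩ | ⟨i, hi, h1, h2⟩⟩ := h
  · exact ⟨i, hi, (Sum.inl_injective h1).symm, h2⟩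
  · exact absurd h2 Sum.inl_ne_inr

theorem adj_inr {T : Set G.I} {e : G.E} {y : G.V ⊕ G.E} (h : (partGraph T).Adj (Sum.inr e) y) :
    ∃ i ∈ T, G.edge i = e ∧ y = Sum.inl (G.vert i) := by
  rw [partGraph, SimpleGraph.fromRel_adj] at h
  obtain ⟨-, ⟨i, hi, h1, h2⟩ | ⟨i, hi, h1, h2⟩⟩ := h
  · exact absurd h1 Sum.inr_ne_inl
  · exact ⟨i, hi, (Sum.inr_injective h2).symm, h1⟩

/-- If the two ends of an incidence are joined by a walk that avoids it, then the incidence lies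
in a circle whose other incidences come from that walk. -/
theorem exists_circle_of_conn {T : Set G.I} {i : G.I} (hi : i ∉ T)
    (h : Conn T (Sum.inl (G.vert i)) (Sum.inr (G.edge i))) :
    ∃ C : G.Circle, i ∈ C.incs ∧ C.incs ⊆ insert i T := by
  obtain ⟨w, hw⟩ := h.reachable.exists_isPath
  -- The path starts at a vertex, so its nodes at even positions are vertices and those at odd
  -- positions are edges. As it ends at an edge, its length is odd.
  have key : ∀ k, (2 * k ≤ w.length → ∃ v, w.getVert (2 * k) = Sum.inl v) ∧
      (2 * k + 1 ≤ w.length → ∃ e, w.getVert (2 * k + 1) = Sum.inr e) := by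
    have step : ∀ k, (2 * k ≤ w.length → ∃ v, w.getVert (2 * k) = Sum.inl v) →
        (2 * k + 1 ≤ w.length → ∃ e, w.getVert (2 * k + 1) = Sum.inr e) := by
      intro k hk hl
      obtain ⟨v, hv⟩ := hk (by omega)
      have := w.adj_getVert_succ (i := 2 * k) (by omega)
      rw [hv] at this
      obtain ⟨j, -, -, hj⟩ := adj_inl this
      exact ⟨_, hj⟩
    intro k
    induction k with
    | zero =>
      have h0 : 2 * 0 ≤ w.length → ∃ v, w.getVert (2 * 0) = Sum.inl v :=
        fun _ => ⟨G.vert i, w.getVert_zero⟩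
      exact ⟨h0, step 0 h0⟩
    | succ k ih =>
      have h0 : 2 * (k + 1) ≤ w.length → ∃ v, w.getVert (2 * (k + 1)) = Sum.inl v := by
        intro hl
        obtain ⟨e, he⟩ := ih.2 (by omega)
        have := w.adj_getVert_succ (i := 2 * k + 1) (by omega)
        rw [he] at this
        obtain ⟨j, -, -, hj⟩ := adj_inr this
        exact ⟨_, hj⟩
      exact ⟨h0, step (k + 1) h0⟩
  obtain ⟨n, hn⟩ : ∃ n, w.length = 2 * n + 1 := by
    rcases Nat.even_or_odd' w.length with ⟨n, hn | hn⟩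
    · obtain ⟨v, hv⟩ := (key n).1 (by omega)
      rw [← hn, w.getVert_length] at hv
      exact absurd hv Sum.inr_ne_inl
    · exact ⟨n, hn⟩
  have hv : ∀ t : Fin (n + 1), ∃ v, w.getVert (2 * t) = Sum.inl v :=
    fun t => (key t).1 (by omega)
  have he : ∀ t : Fin (n + 1), ∃ e, w.getVert (2 * t + 1) = Sum.inr e :=
    fun t => (key t).2 (by omega)
  choose v hv using hv
  choose e he using he
  have hout : ∀ t, ∃ j ∈ T, G.vert j = v t ∧ G.edge j = e t := by
    intro t
    have := w.adj_getVert_succ (i := 2 * t) (by omega)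
    rw [hv, he] at this
    obtain ⟨j, hjT, h1, h2⟩ := adj_inl this
    exact ⟨j, hjT, h1, (Sum.inr_injective h2).symm⟩
  -- The last return incidence is `i` itself, closing up the path; all the others come from `T`.
  have hret : ∀ t : Fin (n + 1), ∃ j, (j = i ∧ t = Fin.last n ∨ j ∈ T ∧ t ≠ Fin.last n) ∧
      G.vert j = v (t + 1) ∧ G.edge j = e t := by
    intro t
    by_cases ht : t = Fin.last n
    · refine ⟨i, Or.inl ⟨rfl, ht⟩, ?_, ?_⟩
      · subst ht
        have := hv (Fin.last n + 1)
        simp only [Fin.last_add_one, Fin.val_zero, mul_zero, w.getVert_zero] at this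
        simpa using Sum.inl_injective this
      · subst ht
        have := he (Fin.last n)
        simp only [Fin.val_last, ← hn, w.getVert_length] at this
        exact Sum.inr_injective this
    · have htn : (t : ℕ) < n := Fin.val_lt_last ht
      have := w.adj_getVert_succ (i := 2 * t + 1) (by omega)
      have h1 : ((t + 1 : Fin (n + 1)) : ℕ) = t + 1 :=
        Fin.val_add_one_of_lt (Fin.lt_last_iff_ne_last.2 ht)
      have h2 := hv (t + 1)
      rw [h1, show 2 * ((t : ℕ) + 1) = 2 * t + 1 + 1 by ring] at h2
      rw [he, h2] at this
      obtain ⟨j, hjT, h1, h2⟩ := adj_inr this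
      exact ⟨j, Or.inr ⟨hjT, ht⟩, (Sum.inl_injective h2).symm, h1⟩
  choose out houtT hout1 hout2 using hout
  choose ret hretT hret1 hret2 using hret
  have hinj := hw.getVert_injOn
  have vinj : Function.Injective v := by
    intro s t hst
    have := hinj (x₁ := 2 * s) (x₂ := 2 * t) (by simp; omega) (by simp; omega)
      (by rw [hv, hv, hst])
    exact Fin.ext (by omega)
  have einj : Function.Injective e := by
    intro s t hst
    have := hinj (x₁ := 2 * s + 1) (x₂ := 2 * t + 1) (by simp; omega) (by simp; omega)
      (by rw [he, he, hst])
    exact Fin.ext (by omega)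
  refine ⟨⟨n, v, e, out, ret, hout1, hout2, hret2, hret1, vinj, einj, ?_, ?_, ?_⟩, ?_, ?_⟩
  · intro s t hst
    exact vinj (by rw [← hout1, ← hout1, hst])
  · intro s t hst
    exact einj (by rw [← hret2, ← hret2, hst])
  · intro s t hst
    have h1 : s = t := einj (by rw [← hout2, ← hret2, hst])
    subst h1
    rcases hretT s with ⟨h2, -⟩ | ⟨-, h2⟩
    · exact hi (h2 ▸ hst ▸ houtT s)
    · have h3 : s = s + 1 := vinj (by rw [← hout1, ← hret1, hst])
      have h4 := congrArg Fin.val h3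
      rw [Fin.val_add_one_of_lt (Fin.lt_last_iff_ne_last.2 h2)] at h4
      omega
  · rcases hretT (Fin.last n) with ⟨h2, -⟩ | ⟨-, h2⟩
    · exact Or.inr ⟨Fin.last n, h2⟩
    · exact absurd rfl h2
  · rintro j (⟨t, rfl⟩ | ⟨t, rfl⟩)
    · exact Or.inr (houtT t)
    · rcases hretT t with ⟨h2, -⟩ | ⟨h2, -⟩
      · exact Or.inl h2
      · exact Or.inr h2

end IncHypergraph

namespace IncHypergraph

variable {G : IncHypergraph.{u}}

/-! ### Even sets of incidences -/

/-- The sum of the values of a test function over all ends of the incidences in `S`. -/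
noncomputable def endSum (S : Finset G.I) (h : G.V ⊕ G.E → ZMod 2) : ZMod 2 :=
  ∑ i ∈ S, (h (Sum.inl (G.vert i)) + h (Sum.inr (G.edge i)))

/-- Every vertex and every edge meets `S` in an even number of incidences, in dual form. -/
def IsEven (S : Finset G.I) : Prop := ∀ h, endSum S h = 0

/-- Exactly `a` and `b` meet `S` in an odd number of incidences, in dual form. -/
def IsJoin (S : Finset G.I) (a b : G.V ⊕ G.E) : Prop := ∀ h, endSum S h = h a + h b

open scoped symmDiff

theorem sum_symmDiff_zmod {α : Type*} [DecidableEq α] (S T : Finset α) (f : α → ZMod 2) :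
    ∑ i ∈ S ∆ T, f i = ∑ i ∈ S, f i + ∑ i ∈ T, f i := by
  rw [← Finset.sum_inter_add_sum_sdiff S T, ← Finset.sum_inter_add_sum_sdiff T S,
    Finset.inter_comm T S, symmDiff_def, Finset.sup_eq_union,
    Finset.sum_union disjoint_sdiff_sdiff]
  have := CharTwo.add_self_eq_zero (∑ i ∈ S ∩ T, f i)
  linear_combination -this

theorem endSum_symmDiff (S T : Finset G.I) (h) :
    endSum (S ∆ T) h = endSum S h + endSum T h := sum_symmDiff_zmod _ _ _

theorem endSum_sdiff {S T : Finset G.I} (hTS : T ⊆ S) (h) :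
    endSum (S \ T) h = endSum S h + endSum T h := by
  rw [← endSum_symmDiff, symmDiff_of_ge hTS]

theorem endSum_singleton (i : G.I) (h) :
    endSum {i} h = h (Sum.inl (G.vert i)) + h (Sum.inr (G.edge i)) := Finset.sum_singleton _ _

theorem IsEven.symmDiff {S T : Finset G.I} (hS : IsEven S) (hT : IsEven T) : IsEven (S ∆ T) :=
  fun h => by rw [endSum_symmDiff, hS, hT, add_zero]

theorem IsEven.sdiff {S T : Finset G.I} (hS : IsEven S) (hT : IsEven T) (h : T ⊆ S) :
    IsEven (S \ T) := fun k => by rw [endSum_sdiff h, hS, hT, add_zero]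

theorem IsJoin.symmDiff {S T : Finset G.I} {a b c : G.V ⊕ G.E} (hS : IsJoin S a b)
    (hT : IsJoin T b c) : IsJoin (S ∆ T) a c := fun h => by
  rw [endSum_symmDiff, hS, hT]
  linear_combination CharTwo.add_self_eq_zero (h b)

theorem IsJoin.symm {S : Finset G.I} {a b : G.V ⊕ G.E} (hS : IsJoin S a b) : IsJoin S b a :=
  fun h => (hS h).trans (add_comm _ _)

theorem isJoin_singleton (i : G.I) :
    IsJoin {i} (Sum.inl (G.vert i)) (Sum.inr (G.edge i)) := endSum_singleton i

theorem isJoin_empty (a : G.V ⊕ G.E) : IsJoin (∅ : Finset G.I) a a := fun h => by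
  rw [CharTwo.add_self_eq_zero]; exact Finset.sum_empty

theorem IsJoin.isEven {S : Finset G.I} {a : G.V ⊕ G.E} (hS : IsJoin S a a) : IsEven S :=
  fun h => by rw [hS, CharTwo.add_self_eq_zero]

theorem IsEven.sdiff_join {S T : Finset G.I} {a b : G.V ⊕ G.E} (hS : IsEven S)
    (hT : IsJoin T a b) (h : T ⊆ S) : IsJoin (S \ T) a b :=
  fun k => by rw [endSum_sdiff h, hS, hT, zero_add]

/-- The nodes reachable from `a` by a join inside `T` form a closed predicate: taking the symmetric
difference with `{i}` moves the far end across `i`. -/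
theorem Conn.exists_join {T : Set G.I} {a b : G.V ⊕ G.E} (h : Conn T a b) :
    ∃ P : Finset G.I, ↑P ⊆ T ∧ IsJoin P a b := by
  have sub : ∀ {P : Finset G.I} {i : G.I}, i ∈ T → ↑P ⊆ T → ↑(P ∆ {i}) ⊆ T := by
    intro P i hi hP j hj
    rw [Finset.mem_coe, Finset.mem_symmDiff, Finset.mem_singleton] at hj
    rcases hj with ⟨hj, -⟩ | ⟨rfl, -⟩
    · exact hP hj
    · exact hi
  refine h (fun x => ∃ P : Finset G.I, ↑P ⊆ T ∧ IsJoin P a x) (fun i hi => ⟨?_, ?_⟩)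
    ⟨∅, by simp, isJoin_empty a⟩
  · rintro ⟨P, hP, hj⟩
    exact ⟨P ∆ {i}, sub hi hP, hj.symmDiff (isJoin_singleton i)⟩
  · rintro ⟨P, hP, hj⟩
    exact ⟨P ∆ {i}, sub hi hP, hj.symmDiff (isJoin_singleton i).symm⟩

/-- Tested against the indicator of a closed predicate, every incidence contributes 0, so the
predicate cannot separate the two ends. -/
theorem IsJoin.conn {T : Set G.I} {P : Finset G.I} {a b : G.V ⊕ G.E} (hP : ↑P ⊆ T)
    (hj : IsJoin P a b) : Conn T a b := by
  classical
  intro p hp ha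
  by_contra hb
  have := hj (fun x => if p x then 1 else 0)
  rw [endSum, Finset.sum_eq_zero] at this
  · simp [ha, hb] at this
  · intro i hi
    have := hp i (hP hi)
    by_cases h : p (Sum.inl (G.vert i))
    · simp [h, this.1 h, CharTwo.add_self_eq_zero]
    · simp [h, mt this.2 h]

theorem IsEven.card_vert {S : Finset G.I} (hS : IsEven S) (v : G.V) :
    Even (S.filter fun i => G.vert i = v).card := by
  classical
  have := hS (fun x => if x = Sum.inl v then 1 else 0)
  simp only [endSum, Sum.inl.injEq, reduceCtorEq, if_false, add_zero, Finset.sum_boole] at this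
  exact (ZMod.natCast_eq_zero_iff_even).1 this

theorem IsEven.card_edge {S : Finset G.I} (hS : IsEven S) (e : G.E) :
    Even (S.filter fun i => G.edge i = e).card := by
  classical
  have := hS (fun x => if x = Sum.inr e then 1 else 0)
  simp only [endSum, Sum.inr.injEq, reduceCtorEq, if_false, zero_add, Finset.sum_boole] at this
  exact (ZMod.natCast_eq_zero_iff_even).1 this

theorem exists_ne_of_even_filter {α : Type*} [DecidableEq α] {S : Finset α} {P : α → Prop}
    [DecidablePred P] (h : Even (S.filter P).card) {i : α} (hi : i ∈ S) (hP : P i) :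
    ∃ j ∈ S, j ≠ i ∧ P j := by
  have h1 : 1 < (S.filter P).card := by
    have : 0 < (S.filter P).card := Finset.card_pos.2 ⟨i, by simp [hi, hP]⟩
    rcases h with ⟨k, hk⟩
    omega
  obtain ⟨j, hj, hji⟩ := Finset.exists_mem_ne h1 i
  rw [Finset.mem_filter] at hj
  exact ⟨j, hj.1, hji, hj.2⟩

theorem IsEven.exists_vert {S : Finset G.I} (hS : IsEven S) {i : G.I} (hi : i ∈ S) :
    ∃ j ∈ S, j ≠ i ∧ G.vert j = G.vert i := exists_ne_of_even_filter (hS.card_vert _) hi rfl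

theorem IsEven.exists_edge {S : Finset G.I} (hS : IsEven S) {i : G.I} (hi : i ∈ S) :
    ∃ j ∈ S, j ≠ i ∧ G.edge j = G.edge i := exists_ne_of_even_filter (hS.card_edge _) hi rfl

/-! ### Circles as even sets -/

/-- The incidences of a circle as a finset. -/
noncomputable def Circle.supp (C : G.Circle) : Finset G.I := by
  classical exact Finset.univ.filter (· ∈ C.incs)

@[simp] theorem Circle.mem_supp {C : G.Circle} {i : G.I} : i ∈ C.supp ↔ i ∈ C.incs := by
  simp [Circle.supp]

theorem Circle.out_mem (C : G.Circle) (t) : C.out t ∈ C.supp :=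
  Circle.mem_supp.2 (Or.inl ⟨t, rfl⟩)

theorem Circle.ret_mem (C : G.Circle) (t) : C.ret t ∈ C.supp :=
  Circle.mem_supp.2 (Or.inr ⟨t, rfl⟩)

theorem Circle.sum_supp {M : Type*} [AddCommMonoid M] (C : G.Circle) (f : G.I → M) :
    ∑ i ∈ C.supp, f i = ∑ t, (f (C.out t) + f (C.ret t)) := by
  have : C.supp = Finset.univ.image C.out ∪ Finset.univ.image C.ret := by
    ext i; simp [Circle.incs]
  rw [this, Finset.sum_union, Finset.sum_image C.out_injective.injOn,
    Finset.sum_image C.ret_injective.injOn, Finset.sum_add_distrib]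
  rw [Finset.disjoint_left]
  intro i h1 h2
  simp only [Finset.mem_image, Finset.mem_univ, true_and] at h1 h2
  obtain ⟨s, rfl⟩ := h1
  obtain ⟨t, ht⟩ := h2
  exact C.out_ne_ret s t ht.symm

/-- Going around a circle visits each of its vertices and edges by two incidences; the cyclic shift
of the index matches the two contributions of each vertex. -/
theorem Circle.isEven_supp (C : G.Circle) : IsEven C.supp := by
  intro h
  rw [endSum, C.sum_supp]
  simp only [C.vert_out, C.edge_out, C.edge_ret, C.vert_ret, Finset.sum_add_distrib]
  have h1 : ∑ t, h (Sum.inl (C.v (t + 1))) = ∑ t, h (Sum.inl (C.v t)) :=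
    Equiv.sum_comp (Equiv.addRight (1 : Fin (C.n + 1))) (fun t => h (Sum.inl (C.v t)))
  rw [h1]
  linear_combination CharTwo.add_self_eq_zero (∑ t, h (Sum.inl (C.v t))) +
    CharTwo.add_self_eq_zero (∑ t, h (Sum.inr (C.e t)))

theorem Circle.eq_of_vert_eq_out (C : G.Circle) {i : G.I} (hi : i ∈ C.supp) {t}
    (h : G.vert i = C.v t) : i = C.out t ∨ i = C.ret (t - 1) := by
  rcases Circle.mem_supp.1 hi with ⟨s, rfl⟩ | ⟨s, rfl⟩
  · rw [C.vert_out] at h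
    exact Or.inl (by rw [C.v_injective h])
  · rw [C.vert_ret] at h
    exact Or.inr (by rw [← C.v_injective h, add_sub_cancel_right])

theorem Circle.eq_of_edge_eq (C : G.Circle) {i : G.I} (hi : i ∈ C.supp) {t}
    (h : G.edge i = C.e t) : i = C.out t ∨ i = C.ret t := by
  rcases Circle.mem_supp.1 hi with ⟨s, rfl⟩ | ⟨s, rfl⟩
  · rw [C.edge_out] at h
    exact Or.inl (by rw [C.e_injective h])
  · rw [C.edge_ret] at h
    exact Or.inr (by rw [C.e_injective h])

theorem Circle.vert_eq_v (C : G.Circle) {i : G.I} (hi : i ∈ C.supp) : ∃ t, G.vert i = C.v t := by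
  rcases Circle.mem_supp.1 hi with ⟨s, rfl⟩ | ⟨s, rfl⟩
  · exact ⟨s, C.vert_out s⟩
  · exact ⟨s + 1, C.vert_ret s⟩

theorem Circle.edge_eq_e (C : G.Circle) {i : G.I} (hi : i ∈ C.supp) : ∃ t, G.edge i = C.e t := by
  rcases Circle.mem_supp.1 hi with ⟨s, rfl⟩ | ⟨s, rfl⟩
  · exact ⟨s, C.edge_out s⟩
  · exact ⟨s, C.edge_ret s⟩

theorem Circle.mem_verts_iff (C : G.Circle) {v : G.V} :
    v ∈ C.verts ↔ ∃ i ∈ C.supp, G.vert i = v := by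
  constructor
  · rintro ⟨t, rfl⟩
    exact ⟨_, C.out_mem t, C.vert_out t⟩
  · rintro ⟨i, hi, rfl⟩
    obtain ⟨t, ht⟩ := C.vert_eq_v hi
    exact ⟨t, ht.symm⟩

/-- At most two incidences of a circle contain a given vertex. -/
theorem Circle.vert_le_two (C : G.Circle) {i j k : G.I} (hi : i ∈ C.supp) (hj : j ∈ C.supp)
    (hk : k ∈ C.supp) (hij : G.vert i = G.vert j) (hik : G.vert i = G.vert k) :
    i = j ∨ i = k ∨ j = k := by
  obtain ⟨t, ht⟩ := C.vert_eq_v hi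
  rcases C.eq_of_vert_eq_out hi ht with h1 | h1 <;>
  rcases C.eq_of_vert_eq_out hj (hij ▸ ht) with h2 | h2 <;>
  rcases C.eq_of_vert_eq_out hk (hik ▸ ht) with h3 | h3 <;> simp [h1, h2, h3]

open Fin.NatCast Fin.CommRing in
/-- A circle has no proper non-empty even subset. -/
theorem Circle.eq_of_isEven (C : G.Circle) {S : Finset G.I} (hS : IsEven S) (hSC : S ⊆ C.supp)
    (hne : S.Nonempty) : S = C.supp := by
  -- Evenness at an edge, and likewise at a vertex, forces the other circle incidence there into
  -- `S`. So `S` propagates around the whole circle.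
  have hor : ∀ t, C.out t ∈ S → C.ret t ∈ S := by
    intro t ht
    obtain ⟨j, hj, hji, h⟩ := hS.exists_edge ht
    rcases C.eq_of_edge_eq (hSC hj) (h.trans (C.edge_out t)) with rfl | rfl
    · exact absurd rfl hji
    · exact hj
  have hro : ∀ t, C.ret t ∈ S → C.out (t + 1) ∈ S := by
    intro t ht
    obtain ⟨j, hj, hji, h⟩ := hS.exists_vert ht
    rcases C.eq_of_vert_eq_out (hSC hj) (h.trans (C.vert_ret t)) with rfl | rfl
    · exact hj
    · rw [add_sub_cancel_right] at hji
      exact absurd rfl hji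
  have h0 : ∃ t, C.out t ∈ S := by
    obtain ⟨i, hi⟩ := hne
    rcases Circle.mem_supp.1 (hSC hi) with ⟨s, rfl⟩ | ⟨s, rfl⟩
    · exact ⟨s, hi⟩
    · exact ⟨s + 1, hro s hi⟩
  obtain ⟨t0, ht0⟩ := h0
  have hk : ∀ k : ℕ, C.out (t0 + (k : Fin (C.n + 1))) ∈ S := by
    intro k
    induction k with
    | zero => simpa using ht0
    | succ k ih =>
      have := hro _ (hor _ ih)
      rwa [add_assoc, ← Nat.cast_succ] at this
  have hall : ∀ t, C.out t ∈ S := by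
    intro t
    have := hk (t - t0 : Fin (C.n + 1)).val
    rwa [Fin.cast_val_eq_self, add_sub_cancel] at this
  refine hSC.antisymm fun i hi => ?_
  rcases Circle.mem_supp.1 hi with ⟨s, rfl⟩ | ⟨s, rfl⟩
  · exact hall s
  · exact hor s (hall s)

theorem Circle.eq_of_subset (C D : G.Circle) (h : C.supp ⊆ D.supp) : C.supp = D.supp :=
  D.eq_of_isEven C.isEven_supp h ⟨_, C.out_mem 0⟩

/-- Every element of an even set lies in a circle contained in this set. -/
theorem IsEven.exists_circle {S : Finset G.I} (hS : IsEven S) {i : G.I} (hi : i ∈ S) :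
    ∃ C : G.Circle, i ∈ C.supp ∧ C.supp ⊆ S := by
  have hj : IsJoin (S \ {i}) (Sum.inl (G.vert i)) (Sum.inr (G.edge i)) :=
    hS.sdiff_join (isJoin_singleton i) (by simpa using hi)
  obtain ⟨C, hiC, hC⟩ := exists_circle_of_conn (T := ↑(S \ {i})) (by simp)
    (IsJoin.conn le_rfl hj)
  refine ⟨C, Circle.mem_supp.2 hiC, fun j hj => ?_⟩
  rcases hC (Circle.mem_supp.1 hj) with rfl | h
  · exact hi
  · exact (Finset.mem_sdiff.1 (Finset.mem_coe.1 h)).1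

/-- A closed predicate would cut out an even subset of the circle, which is empty or everything. -/
theorem Circle.conn_supp (C : G.Circle) {i j : G.I} (hi : i ∈ C.supp) (hj : j ∈ C.supp) :
    Conn (C.supp : Set G.I) (Sum.inl (G.vert i)) (Sum.inl (G.vert j)) := by
  classical
  intro p hp hpi
  set S := C.supp.filter fun k => p (Sum.inl (G.vert k)) with hSdef
  have hS : IsEven S := by
    intro h
    have := C.isEven_supp (fun x => if p x then h x else 0)
    rw [← this, endSum, endSum, Finset.sum_filter]
    refine Finset.sum_congr rfl fun k hk => ?_
    have := hp k hk
    by_cases hpk : p (Sum.inl (G.vert k))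
    · simp [hpk, this.1 hpk]
    · simp [hpk, mt this.2 hpk]
  have := C.eq_of_isEven hS (Finset.filter_subset _ _) 
    ⟨i, Finset.mem_filter.2 ⟨hi, hpi⟩⟩
  rw [← this] at hj
  exact (Finset.mem_filter.1 hj).2

/-- Lying in a common circle is transitive. -/
theorem exists_circle_trans {C D : G.Circle} {i k : G.I} (hi : i ∈ C.supp) (hk : k ∈ D.supp)
    (hCD : (C.supp ∩ D.supp).Nonempty) :
    ∃ B : G.Circle, i ∈ B.supp ∧ k ∈ B.supp ∧ B.supp ⊆ C.supp ∪ D.supp := by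
  -- The induction replaces `C` by a circle `A` through `i` inside the symmetric difference that
  -- still meets `D`, while the union shrinks.
  induction hn : (C.supp ∪ D.supp).card using Nat.strong_induction_on generalizing C D with
  | _ n ih =>
    by_cases hiD : i ∈ D.supp
    · exact ⟨D, hiD, hk, Finset.subset_union_right⟩
    by_cases hkC : k ∈ C.supp
    · exact ⟨C, hi, hkC, Finset.subset_union_left⟩
    have hE : IsEven (C.supp ∆ D.supp) := C.isEven_supp.symmDiff D.isEven_supp
    have hEU : C.supp ∆ D.supp ⊆ C.supp ∪ D.supp := by
      intro x hx
      rw [Finset.mem_symmDiff] at hx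
      rw [Finset.mem_union]
      tauto
    obtain ⟨m, hm⟩ := hCD
    rw [Finset.mem_inter] at hm
    have hmE : m ∉ C.supp ∆ D.supp := by
      rw [Finset.mem_symmDiff]; tauto
    obtain ⟨A, hiA, hAE⟩ := hE.exists_circle (i := i)
      (by rw [Finset.mem_symmDiff]; exact Or.inl ⟨hi, hiD⟩)
    by_cases hkA : k ∈ A.supp
    · exact ⟨A, hiA, hkA, hAE.trans hEU⟩
    obtain ⟨B, hkB, hBE⟩ := (hE.sdiff A.isEven_supp hAE).exists_circle (i := k)
      (by rw [Finset.mem_sdiff, Finset.mem_symmDiff]; exact ⟨Or.inr ⟨hk, hkC⟩, hkA⟩)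
    have hBE' : B.supp ⊆ C.supp ∆ D.supp := hBE.trans Finset.sdiff_subset
    -- If `A` lay inside `C` it would equal `C` and contain `m`, which the symmetric difference
    -- omits. The same argument with `B` and `D` gives `y`.
    obtain ⟨x, hxA, hxC⟩ : ∃ x ∈ A.supp, x ∉ C.supp := by
      by_contra! h
      exact hmE (hAE (A.eq_of_subset C h ▸ hm.1))
    obtain ⟨y, hyB, hyD⟩ : ∃ y ∈ B.supp, y ∉ D.supp := by
      by_contra! h
      exact hmE (hBE' (B.eq_of_subset D h ▸ hm.2))
    have hxD : x ∈ D.supp := by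
      have := hAE hxA
      rw [Finset.mem_symmDiff] at this; tauto
    have hyA : y ∉ A.supp := (Finset.mem_sdiff.1 (hBE hyB)).2
    have hyC : y ∈ C.supp := by
      have := hBE' hyB
      rw [Finset.mem_symmDiff] at this; tauto
    have hsub : A.supp ∪ D.supp ⊆ C.supp ∪ D.supp :=
      Finset.union_subset (hAE.trans hEU) Finset.subset_union_right
    -- The element `y` belongs to `C`, but neither to `A` nor to `D`.
    have hlt : (A.supp ∪ D.supp).card < n := by
      rw [← hn]
      refine Finset.card_lt_card (Finset.ssubset_iff_subset_ne.2 ⟨hsub, fun h => ?_⟩)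
      have : y ∈ A.supp ∪ D.supp := h ▸ Finset.mem_union_left _ hyC
      rw [Finset.mem_union] at this
      tauto
    obtain ⟨F, h1, h2, h3⟩ := ih _ hlt hiA hk ⟨x, Finset.mem_inter.2 ⟨hxA, hxD⟩⟩ rfl
    exact ⟨F, h1, h2, h3.trans hsub⟩

/-! ### Transport of even sets and circles -/

/-- Even sets are preserved by maps that are injective on incidences. -/
theorem IsEven.map {X Y : IncHypergraph.{u}} {S : Finset X.I} (hS : IsEven S)
    (fV : X.V → Y.V) (fE : X.E → Y.E) (fI : X.I → Y.I) (hI : Function.Injective fI)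
    (hV : ∀ i, Y.vert (fI i) = fV (X.vert i)) (hE : ∀ i, Y.edge (fI i) = fE (X.edge i)) :
    IsEven (S.map ⟨fI, hI⟩) := by
  intro h
  rw [← hS (fun x => h (Sum.map fV fE x)), endSum, endSum, Finset.sum_map]
  simp [hV, hE]

theorem Sub.exists_circle (K : G.Sub) (C : G.Circle) (hC : C.incs ⊆ K.incs) :
    ∃ D : K.toHypergraph.Circle, D.n = C.n ∧ ∀ i : K.toHypergraph.I, i ∈ D.incs ↔ i.1 ∈ C.incs := by
  have ho : ∀ t, C.out t ∈ K.incs := fun t => hC (Or.inl ⟨t, rfl⟩)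
  have hr : ∀ t, C.ret t ∈ K.incs := fun t => hC (Or.inr ⟨t, rfl⟩)
  refine ⟨⟨C.n, fun t => ⟨C.v t, C.vert_out t ▸ K.vert_mem _ (ho t)⟩,
    fun t => ⟨C.e t, C.edge_out t ▸ K.edge_mem _ (ho t)⟩, fun t => ⟨C.out t, ho t⟩,
    fun t => ⟨C.ret t, hr t⟩, fun t => Subtype.ext (C.vert_out t),
    fun t => Subtype.ext (C.edge_out t), fun t => Subtype.ext (C.edge_ret t),
    fun t => Subtype.ext (C.vert_ret t), fun s t h => C.v_injective (Subtype.ext_iff.1 h),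
    fun s t h => C.e_injective (Subtype.ext_iff.1 h),
    fun s t h => C.out_injective (Subtype.ext_iff.1 h),
    fun s t h => C.ret_injective (Subtype.ext_iff.1 h),
    fun s t h => C.out_ne_ret s t (Subtype.ext_iff.1 h)⟩, rfl, fun i => ?_⟩
  exact or_congr (exists_congr fun _ => Subtype.ext_iff) (exists_congr fun _ => Subtype.ext_iff)

end IncHypergraph

/-! ### Balance in terms of even sets -/

theorem Int.units_eq_one_or_neg_one_cast (s : ℤˣ) : (s : ℤ) = 1 ∨ (s : ℤ) = -1 := by
  rcases Int.units_eq_one_or s with rfl | rfl <;> simp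

theorem two_dvd_sum_units {α : Type*} {S : Finset α} (hS : Even S.card) (u : α → ℤˣ) :
    (2 : ℤ) ∣ ∑ i ∈ S, (u i : ℤ) := by
  have h : ∑ i ∈ S, (u i : ℤ) = ∑ i ∈ S, ((u i : ℤ) - 1) + S.card := by simp
  rw [h]
  refine dvd_add (Finset.dvd_sum fun i _ => ?_) (by exact_mod_cast hS.two_dvd)
  rcases Int.units_eq_one_or_neg_one_cast (u i) with h | h <;> rw [h] <;> norm_num

/-- A factor is -1 exactly when the two signs agree, and then they add up to 2 modulo 4; otherwise
they add up to 0. -/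
theorem prod_neg_mul_units_eq_one_iff {α : Type*} (S : Finset α) (a b : α → ℤˣ) :
    ∏ t ∈ S, -(a t * b t) = 1 ↔ (4 : ℤ) ∣ ∑ t ∈ S, ((a t : ℤ) + b t) := by
  classical
  have key : (∏ t ∈ S, -(a t * b t) = 1 ∧ (∑ t ∈ S, ((a t : ℤ) + b t)) % 4 = 0) ∨
      (∏ t ∈ S, -(a t * b t) = -1 ∧ (∑ t ∈ S, ((a t : ℤ) + b t)) % 4 = 2) := by
    induction S using Finset.induction_on with
    | empty => simp
    | insert t S ht ih =>
      rw [Finset.prod_insert ht, Finset.sum_insert ht]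
      rcases ih with ⟨h1, h2⟩ | ⟨h1, h2⟩ <;> rw [h1] <;>
      rcases Int.units_eq_one_or (a t) with h3 | h3 <;>
      rcases Int.units_eq_one_or (b t) with h4 | h4 <;> rw [h3, h4] <;> simp <;> omega
  rcases key with ⟨h1, h2⟩ | ⟨h1, h2⟩
  · simp only [h1, true_iff]; omega
  · rw [h1]
    have : ¬ ((-1 : ℤˣ) = 1) := by decide
    simp only [this, false_iff]; omega

namespace IncHypergraph

variable {G : IncHypergraph.{u}}

/-- The sum of the signs over every even set of incidences is divisible by `4`. -/
def EvenBalanced (σ : G.I → ℤˣ) : Prop :=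
  ∀ S : Finset G.I, IsEven S → (4 : ℤ) ∣ ∑ i ∈ S, (σ i : ℤ)

/-- Removing a circle from an even set leaves an even set, so every even set is a disjoint union of
circles. -/
theorem evenBalanced_of_circles {σ : G.I → ℤˣ}
    (h : ∀ C : G.Circle, (4 : ℤ) ∣ ∑ i ∈ C.supp, (σ i : ℤ)) : EvenBalanced σ := by
  intro S
  induction S using Finset.strongInduction with
  | H S ih =>
    intro hS
    rcases S.eq_empty_or_nonempty with rfl | ⟨i, hi⟩
    · simp
    · obtain ⟨C, hiC, hCS⟩ := hS.exists_circle hi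
      rw [← Finset.sum_sdiff hCS]
      refine dvd_add (ih _ (Finset.sdiff_ssubset hCS ⟨i, hiC⟩) ?_) (h C)
      exact hS.sdiff C.isEven_supp hCS

/-- Three disjoint walks between a vertex and an edge cannot exist in a balanced hypergraph. -/
theorem EvenBalanced.no_three_joins {σ : G.I → ℤˣ} (hσ : EvenBalanced σ) {e : G.E} {w : G.V}
    {P Q R : Finset G.I} (hP : IsJoin P (Sum.inr e) (Sum.inl w))
    (hQ : IsJoin Q (Sum.inr e) (Sum.inl w)) (hR : IsJoin R (Sum.inr e) (Sum.inl w))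
    (hPQ : Disjoint P Q) (hPR : Disjoint P R) (hQR : Disjoint Q R) : False := by
  have hd : ∀ {S T : Finset G.I}, IsJoin S (Sum.inr e) (Sum.inl w) →
      IsJoin T (Sum.inr e) (Sum.inl w) → Disjoint S T →
      (4 : ℤ) ∣ ∑ i ∈ S, (σ i : ℤ) + ∑ i ∈ T, (σ i : ℤ) := by
    intro S T hS hT hST
    rw [← Finset.sum_union hST]
    refine hσ _ fun h => ?_
    have : endSum (S ∪ T) h = endSum S h + endSum T h := Finset.sum_union hST
    rw [this, hS, hT, CharTwo.add_self_eq_zero]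
  -- Testing with the indicator of the vertices counts the incidences of `S`: a join between a
  -- vertex and an edge has odd size, hence an odd sign sum.
  have hodd : ∀ {S : Finset G.I}, IsJoin S (Sum.inr e) (Sum.inl w) →
      ¬ (2 : ℤ) ∣ ∑ i ∈ S, (σ i : ℤ) := by
    intro S hS hdvd
    have h1 := hS (fun x => if x.isLeft then 1 else 0)
    simp only [endSum, Sum.isLeft_inl, Sum.isLeft_inr, if_true, Bool.false_eq_true, if_false,
      add_zero, zero_add, Finset.sum_const, nsmul_eq_mul, mul_one] at h1
    have h2 : Odd S.card := by
      rw [← ZMod.natCast_eq_one_iff_odd]; exact h1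
    have h3 : ∑ i ∈ S, (σ i : ℤ) = ∑ i ∈ S, ((σ i : ℤ) - 1) + S.card := by simp
    have h4 : (2 : ℤ) ∣ ∑ i ∈ S, ((σ i : ℤ) - 1) := by
      refine Finset.dvd_sum fun i _ => ?_
      rcases Int.units_eq_one_or_neg_one_cast (σ i) with h | h <;> rw [h] <;> norm_num
    obtain ⟨k, hk⟩ := h2
    omega
  -- Adding the first two relations and subtracting the third makes twice the sign sum of `P`
  -- divisible by 4, against its oddness.
  have h1 := hd hP hQ hPQ
  have h2 := hd hP hR hPR
  have h3 := hd hQ hR hQR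
  have h4 := hodd hP
  have h5 := hodd hQ
  have h6 := hodd hR
  omega

/-- Exactly two incidences contain `v`. -/
def IsBivalent (G : IncHypergraph.{u}) (v : G.V) : Prop :=
  ∃ i j : G.I, i ≠ j ∧ ∀ k, G.vert k = v ↔ k = i ∨ k = j

theorem degree_eq_two_iff {v : G.V} : G.degree v = 2 ↔ G.IsBivalent v := by
  rw [degree, Nat.card_eq_two_iff]
  constructor
  · rintro ⟨⟨i, hi⟩, ⟨j, hj⟩, hij, h⟩
    refine ⟨i, j, fun h => hij (Subtype.ext h), fun k => ⟨fun hk => ?_, ?_⟩⟩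
    · have : (⟨k, hk⟩ : {i : G.I // G.vert i = v}) ∈ (Set.univ : Set _) := trivial
      rw [← h] at this
      simpa using this
    · rintro (rfl | rfl) <;> assumption
  · rintro ⟨i, j, hij, h⟩
    refine ⟨⟨i, (h i).2 (Or.inl rfl)⟩, ⟨j, (h j).2 (Or.inr rfl)⟩, by simpa using hij, ?_⟩
    ext ⟨k, hk⟩
    simpa using (h k).1 hk

theorem degree_eq_one_iff {v : G.V} :
    G.degree v = 1 ↔ ∃ i, ∀ k, G.vert k = v ↔ k = i := by
  rw [degree, Nat.card_eq_one_iff_exists]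
  constructor
  · rintro ⟨⟨i, hi⟩, h⟩
    refine ⟨i, fun k => ⟨fun hk => congrArg Subtype.val (h ⟨k, hk⟩), ?_⟩⟩
    rintro rfl; exact hi
  · rintro ⟨i, h⟩
    exact ⟨⟨i, (h i).2 rfl⟩, fun k => Subtype.ext ((h k.1).1 k.2)⟩

theorem IsBivalent.exists_pair {v : G.V} (h : G.IsBivalent v) {i : G.I} (hi : G.vert i = v) :
    ∃ j, i ≠ j ∧ ∀ k, G.vert k = v ↔ k = i ∨ k = j := by
  obtain ⟨a, b, hab, h⟩ := h
  rcases (h i).1 hi with rfl | rfl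
  · exact ⟨b, hab, h⟩
  · exact ⟨a, hab.symm, fun k => (h k).trans or_comm⟩

theorem IsBivalent.exists_inc {v : G.V} (h : G.IsBivalent v) : ∃ i, G.vert i = v := by
  obtain ⟨i, j, -, h⟩ := h
  exact ⟨i, (h i).2 (Or.inl rfl)⟩

/-- An even set contains both or none of the incidences at a vertex of degree two. -/
theorem mem_iff_mem_of_even {S : Finset G.I} {v : G.V} {i j : G.I} (hij : i ≠ j)
    (h : ∀ k, G.vert k = v ↔ k = i ∨ k = j) (hS : Even (S.filter fun k => G.vert k = v).card) :
    i ∈ S ↔ j ∈ S := by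
  constructor
  · intro hi
    obtain ⟨k, hk, hki, hkv⟩ := exists_ne_of_even_filter hS hi ((h i).2 (Or.inl rfl))
    rcases (h k).1 hkv with rfl | rfl
    · exact absurd rfl hki
    · exact hk
  · intro hj
    obtain ⟨k, hk, hki, hkv⟩ := exists_ne_of_even_filter hS hj ((h j).2 (Or.inr rfl))
    rcases (h k).1 hkv with rfl | rfl
    · exact hk
    · exact absurd rfl hki

theorem IsJoin.card_vert {S : Finset G.I} {e f : G.E} (hS : IsJoin S (Sum.inr e) (Sum.inr f))
    (v : G.V) : Even (S.filter fun i => G.vert i = v).card := by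
  classical
  have := hS (fun x => if x = Sum.inl v then 1 else 0)
  simp only [endSum, Sum.inl.injEq, reduceCtorEq, if_false, add_zero, Finset.sum_boole] at this
  exact (ZMod.natCast_eq_zero_iff_even).1 this

/-- Negating the signs at one edge changes the sum by -2 times the sign sum there. That sum is even
because an even set meets the edge an even number of times. -/
theorem dvd_sum_switch_iff {S : Finset G.I} (hS : IsEven S) (σ : G.I → ℤˣ) (f : G.E → ℤˣ) :
    (4 : ℤ) ∣ ∑ i ∈ S, ((f (G.edge i) * σ i : ℤˣ) : ℤ) ↔ (4 : ℤ) ∣ ∑ i ∈ S, (σ i : ℤ) := by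
  have h : (4 : ℤ) ∣ ∑ i ∈ S, (((f (G.edge i) * σ i : ℤˣ) : ℤ) - σ i) := by
    rw [← Finset.sum_fiberwise S G.edge]
    refine Finset.dvd_sum fun e _ => ?_
    obtain ⟨m, hm⟩ := two_dvd_sum_units (hS.card_edge e) σ
    rcases Int.units_eq_one_or (f e) with he | he
    · rw [Finset.sum_eq_zero]
      · exact dvd_zero _
      · intro i hi
        rw [(Finset.mem_filter.1 hi).2, he]; simp
    · refine ⟨-m, ?_⟩
      have : ∑ i ∈ S with G.edge i = e, (((f (G.edge i) * σ i : ℤˣ) : ℤ) - σ i) =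
          ∑ i ∈ S with G.edge i = e, (-2) * (σ i : ℤ) := by
        refine Finset.sum_congr rfl fun i hi => ?_
        rw [(Finset.mem_filter.1 hi).2, he]
        push_cast; ring
      rw [this, ← Finset.mul_sum, hm]; ring
  rw [Finset.sum_sub_distrib] at h
  exact (dvd_iff_dvd_of_dvd_sub h)

end IncHypergraph

namespace OrientedHypergraph

open IncHypergraph

variable {G : OrientedHypergraph.{u}}

theorem circleSign_eq_one_iff (C : G.toIncHypergraph.Circle) :
    G.circleSign C = 1 ↔ (4 : ℤ) ∣ ∑ i ∈ C.supp, (G.σ i : ℤ) := by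
  rw [C.sum_supp, ← prod_neg_mul_units_eq_one_iff, circleSign, Finset.prod_neg]
  simp

theorem isBalanced_iff : G.IsBalanced ↔ EvenBalanced G.σ :=
  ⟨fun h => evenBalanced_of_circles fun C => (circleSign_eq_one_iff C).1 (h C),
    fun h C => (circleSign_eq_one_iff C).2 (h _ C.isEven_supp)⟩

end OrientedHypergraph

namespace IncHypergraph

variable {G : IncHypergraph.{u}}

/-! ### Minimal dependencies -/

/-- The row of the vertex `v` of the incidence matrix, applied to `x`. -/
noncomputable def rowSum (σ : G.I → ℤˣ) (x : G.E → ℝ) (v : G.V) : ℝ :=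
  ∑ i with G.vert i = v, x (G.edge i) * ((σ i : ℤ) : ℝ)

theorem rowSum_sub_smul (σ : G.I → ℤˣ) (x y : G.E → ℝ) (c : ℝ) (v : G.V) :
    rowSum σ (x - c • y) v = rowSum σ x v - c * rowSum σ y v := by
  simp only [rowSum, Finset.mul_sum, ← Finset.sum_sub_distrib]
  exact Finset.sum_congr rfl fun i _ => by simp; ring

/-- A vector of minimal support among the non-zero vectors that are annihilated by all rows
with index in `S`. -/
structure IsMinKernel (σ : G.I → ℤˣ) (S : Finset G.V) (x : G.E → ℝ) : Prop where
  ne_zero : x ≠ 0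
  ker : ∀ v ∈ S, rowSum σ x v = 0
  min : ∀ y : G.E → ℝ, (∀ v ∈ S, rowSum σ y v = 0) → (∀ e, x e = 0 → y e = 0) → ∃ c : ℝ, y = c • x

/-- At most two incidences at `v` lie in edges of the support of `x`. -/
def SupportLeTwo (x : G.E → ℝ) (v : G.V) : Prop :=
  ∀ i j k, G.vert i = v → G.vert j = v → G.vert k = v →
    x (G.edge i) ≠ 0 → x (G.edge j) ≠ 0 → x (G.edge k) ≠ 0 → i = j ∨ i = k ∨ j = k

theorem unit_cast_ne_zero (s : ℤˣ) : ((s : ℤ) : ℝ) ≠ 0 := by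
  rcases Int.units_eq_one_or s with rfl | rfl <;> simp

theorem exists_ne_of_rowSum_eq_zero {σ : G.I → ℤˣ} {x : G.E → ℝ} {v : G.V}
    (h : rowSum σ x v = 0) {i : G.I} (hi : G.vert i = v) (hx : x (G.edge i) ≠ 0) :
    ∃ j, j ≠ i ∧ G.vert j = v ∧ x (G.edge j) ≠ 0 := by
  by_contra! hj
  rw [rowSum, Finset.sum_eq_single_of_mem i (by simpa using hi)] at h
  · exact (mul_ne_zero hx (unit_cast_ne_zero _)) h
  · intro j hjm hji
    rw [hj j hji (by simpa using hjm), zero_mul]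

theorem SupportLeTwo.pair_sum {σ : G.I → ℤˣ} {x : G.E → ℝ} {v : G.V} (h2 : SupportLeTwo x v)
    (h : rowSum σ x v = 0) {i j : G.I} (hij : i ≠ j) (hi : G.vert i = v) (hj : G.vert j = v)
    (hxi : x (G.edge i) ≠ 0) (hxj : x (G.edge j) ≠ 0) :
    x (G.edge i) * ((σ i : ℤ) : ℝ) + x (G.edge j) * ((σ j : ℤ) : ℝ) = 0 := by
  rw [rowSum, ← Finset.sum_subset (s₁ := {i, j})] at h
  · rwa [Finset.sum_pair hij] at h
  · intro k hk
    rcases Finset.mem_insert.1 hk with rfl | hk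
    · simpa using hi
    · rw [Finset.mem_singleton.1 hk]; simpa using hj
  · intro k hk hk'
    have hkv : G.vert k = v := by simpa using hk
    by_cases hxk : x (G.edge k) = 0
    · rw [hxk, zero_mul]
    · have := h2 i j k hi hj hkv hxi hxj hxk
      simp only [Finset.mem_insert, Finset.mem_singleton, not_or] at hk'
      rcases this with h | h | h
      · exact absurd h hij
      · exact absurd h.symm hk'.1
      · exact absurd h.symm hk'.2

theorem abs_eq_of_pair_sum {a b : ℝ} {s t : ℤˣ}
    (h : a * ((s : ℤ) : ℝ) + b * ((t : ℤ) : ℝ) = 0) : |a| = |b| := by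
  have h1 : |a * ((s : ℤ) : ℝ)| = |b * ((t : ℤ) : ℝ)| := by
    rw [eq_neg_of_add_eq_zero_left h, abs_neg]
  have h2 : ∀ u : ℤˣ, |((u : ℤ) : ℝ)| = 1 := by
    intro u
    rcases Int.units_eq_one_or u with rfl | rfl <;> simp
  rwa [abs_mul, abs_mul, h2, h2, mul_one, mul_one] at h1

/-- The support of a vector is connected, through incidences at vertices of `S`, if the vector
has minimal support. -/
theorem IsMinKernel.conn {σ : G.I → ℤˣ} {S : Finset G.V} {x : G.E → ℝ} (hx : IsMinKernel σ S x)
    {e f : G.E} (he : x e ≠ 0) (hf : x f ≠ 0) :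
    Conn {i | G.vert i ∈ S ∧ x (G.edge i) ≠ 0} (Sum.inr e) (Sum.inr f) := by
  classical
  intro p hp hpe
  by_contra hpf
  -- The part of `x` selected by a closed predicate is again in the kernel: each row sees either all
  -- of `x` or nothing. By minimality this part is a multiple of `x`.
  have hker : ∀ v ∈ S, rowSum σ (fun e => if p (Sum.inr e) then x e else 0) v = 0 := by
    intro v hv
    by_cases hpv : p (Sum.inl v)
    · refine Eq.trans ?_ (hx.ker v hv)
      refine Finset.sum_congr rfl fun i hi => ?_
      have hiv : G.vert i = v := by simpa using hi
      by_cases h0 : x (G.edge i) = 0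
      · simp [h0]
      · simp [(hp i ⟨hiv ▸ hv, h0⟩).1 (hiv.symm ▸ hpv)]
    · refine Finset.sum_eq_zero fun i hi => ?_
      have hiv : G.vert i = v := by simpa using hi
      by_cases h0 : x (G.edge i) = 0
      · simp [h0]
      · have : ¬ p (Sum.inr (G.edge i)) := fun h => hpv (hiv ▸ (hp i ⟨hiv ▸ hv, h0⟩).2 h)
        simp [this]
  obtain ⟨c, hc⟩ := hx.min _ hker (fun e h => by simp [h])
  have h1 := congrFun hc e
  have h2 := congrFun hc f
  simp only [hpe, if_true, hpf, if_false, Pi.smul_apply, smul_eq_mul] at h1 h2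
  rcases mul_eq_zero.1 h2.symm with h | h
  · rw [h, zero_mul] at h1; exact he h1
  · exact hf h

/-- At a vertex of `S`, two distinct incidences of the support carry the whole row, so their entries
have equal absolute values; connectivity of the support spreads this. -/
theorem IsMinKernel.abs_eq {σ : G.I → ℤˣ} {S : Finset G.V} {x : G.E → ℝ}
    (hx : IsMinKernel σ S x) (h2 : ∀ v ∈ S, SupportLeTwo x v)
    {e f : G.E} (he : x e ≠ 0) (hf : x f ≠ 0) : |x e| = |x f| := by
  have habs : ∀ {i j : G.I}, G.vert i ∈ S → G.vert j = G.vert i → x (G.edge i) ≠ 0 →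
      x (G.edge j) ≠ 0 → |x (G.edge i)| = |x (G.edge j)| := by
    intro i j hi hj hxi hxj
    by_cases hij : i = j
    · rw [hij]
    · exact abs_eq_of_pair_sum ((h2 _ hi).pair_sum (hx.ker _ hi) hij rfl hj hxi hxj)
  have := hx.conn he hf (fun a => Sum.elim
    (fun v => ∃ i, G.vert i = v ∧ x (G.edge i) ≠ 0 ∧ |x e| = |x (G.edge i)|)
    (fun f => |x e| = |x f|) a) (fun i hi => ⟨?_, ?_⟩) rfl
  · exact this
  · rintro ⟨j, hj, hxj, h⟩
    exact h.trans (habs (hj ▸ hi.1) hj.symm hxj hi.2)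
  · intro h
    exact ⟨i, rfl, hi.2, h⟩

/-- Two incidences at a further vertex `w` with edges in the support of a minimal vector
cancel each other if the hypergraph is balanced. -/
theorem IsMinKernel.pair_sum {σ : G.I → ℤˣ} (hσ : EvenBalanced σ) {S : Finset G.V}
    {x : G.E → ℝ} (hx : IsMinKernel σ S x) (h2 : ∀ v ∈ S, SupportLeTwo x v) {w : G.V}
    (hw : w ∉ S) {i j : G.I} (hij : i ≠ j) (hi : G.vert i = w) (hj : G.vert j = w)
    (hxi : x (G.edge i) ≠ 0) (hxj : x (G.edge j) ≠ 0) :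
    x (G.edge i) * ((σ i : ℤ) : ℝ) + x (G.edge j) * ((σ j : ℤ) : ℝ) = 0 := by
  classical
  -- Switching by the sign of `x` turns real cancellation in a row into cancellation of integer
  -- signs.
  set f : G.E → ℤˣ := fun e => if x e < 0 then -1 else 1 with hf
  have hxf : ∀ k, x (G.edge k) ≠ 0 → x (G.edge k) * ((σ k : ℤ) : ℝ) =
      |x (G.edge i)| * (((f (G.edge k) * σ k : ℤˣ) : ℤ) : ℝ) := by
    intro k hk
    rw [hx.abs_eq h2 hxi hk]
    have : x (G.edge k) = |x (G.edge k)| * ((f (G.edge k) : ℤ) : ℝ) := by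
      by_cases h : x (G.edge k) < 0
      · simp [hf, h, abs_of_neg h]
      · simp [hf, h, abs_of_nonneg (not_lt.1 h)]
    conv_lhs => rw [this]
    push_cast; ring
  obtain ⟨P, hPT, hP⟩ := (hx.conn hxi hxj).exists_join
  have hiP : i ∉ P := fun h => hw (hi ▸ (hPT h).1)
  have hjP : j ∉ P := fun h => hw (hj ▸ (hPT h).1)
  -- At each vertex that it meets, `P` contains exactly the two support incidences, whose switched
  -- signs are opposite.
  have hPsum : ∑ k ∈ P, ((f (G.edge k) * σ k : ℤˣ) : ℤ) = 0 := by
    rw [← Finset.sum_fiberwise P G.vert]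
    refine Finset.sum_eq_zero fun v _ => ?_
    by_cases hv : ∃ k ∈ P, G.vert k = v
    · obtain ⟨k, hk, hkv⟩ := hv
      obtain ⟨l, hl, hlk, hlv⟩ := exists_ne_of_even_filter (hP.card_vert v) hk hkv
      have hkS : v ∈ S := hkv ▸ (hPT hk).1
      have hpair := (h2 v hkS).pair_sum (hx.ker v hkS) hlk.symm hkv hlv (hPT hk).2 (hPT hl).2
      rw [hxf k (hPT hk).2, hxf l (hPT hl).2, ← mul_add] at hpair
      have hpair' := (mul_eq_zero.1 hpair).resolve_left (abs_ne_zero.2 hxi)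
      have hfil : (P.filter fun k => G.vert k = v) = {k, l} := by
        ext m
        simp only [Finset.mem_filter, Finset.mem_insert, Finset.mem_singleton]
        constructor
        · rintro ⟨hm, hmv⟩
          rcases h2 v hkS k l m hkv hlv hmv (hPT hk).2 (hPT hl).2 (hPT hm).2 with h | h | h
          · exact absurd h.symm hlk
          · exact Or.inl h.symm
          · exact Or.inr h.symm
        · rintro (rfl | rfl) <;> exact ⟨by assumption, by assumption⟩
      rw [hfil, Finset.sum_pair hlk.symm]
      exact_mod_cast hpair'
    · rw [Finset.filter_false_of_mem fun k hk hkv => hv ⟨k, hk, hkv⟩, Finset.sum_empty]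
  have heven : IsEven (insert i (insert j P)) := by
    have hiP' : i ∉ insert j P := by simp [hij, hiP]
    intro h
    have h1 := hP h
    rw [endSum] at h1 ⊢
    rw [Finset.sum_insert hiP', Finset.sum_insert hjP, h1, hi, hj]
    linear_combination CharTwo.add_self_eq_zero (h (Sum.inl w)) +
      CharTwo.add_self_eq_zero (h (Sum.inr (G.edge i))) +
      CharTwo.add_self_eq_zero (h (Sum.inr (G.edge j)))
  -- `P` with `i` and `j` closes up to an even set. As `P` contributes 0, the two remaining signs
  -- have a sum divisible by 4, and so cancel.
  have hdvd := (dvd_sum_switch_iff heven σ f).2 (hσ _ heven)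
  rw [Finset.sum_insert (by simp [hij, hiP]), Finset.sum_insert hjP, hPsum, add_zero] at hdvd
  have hzero : ((f (G.edge i) * σ i : ℤˣ) : ℤ) + ((f (G.edge j) * σ j : ℤˣ) : ℤ) = 0 := by
    rcases Int.units_eq_one_or_neg_one_cast (f (G.edge i) * σ i) with h1 | h1 <;>
    rcases Int.units_eq_one_or_neg_one_cast (f (G.edge j) * σ j) with h2 | h2 <;>
    rw [h1, h2] at hdvd ⊢ <;> omega
  rw [hxf i hxi, hxf j hxj, ← mul_add, ← Int.cast_add, hzero, Int.cast_zero, mul_zero]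

/-- Three nonzero numbers cannot cancel pairwise. -/
theorem IsMinKernel.supportLeTwo_of_notMem {σ : G.I → ℤˣ} (hσ : EvenBalanced σ)
    {S : Finset G.V} {x : G.E → ℝ} (hx : IsMinKernel σ S x) (h2 : ∀ v ∈ S, SupportLeTwo x v)
    {w : G.V} (hw : w ∉ S) : SupportLeTwo x w := by
  intro i j k hi hj hk hxi hxj hxk
  by_contra! h
  have h1 := hx.pair_sum hσ h2 hw h.1 hi hj hxi hxj
  have h3 := hx.pair_sum hσ h2 hw h.2.1 hi hk hxi hxk
  have h4 := hx.pair_sum hσ h2 hw h.2.2 hj hk hxj hxk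
  have : x (G.edge i) * ((σ i : ℤ) : ℝ) = 0 := by linarith
  exact mul_ne_zero hxi (unit_cast_ne_zero _) this

/-- Two distinct incidences of the support at `w` would cancel, and there is no third one to make
the row nonzero. -/
theorem IsMinKernel.eq_of_rowSum_ne_zero {σ : G.I → ℤˣ} (hσ : EvenBalanced σ)
    {S : Finset G.V} {x : G.E → ℝ} (hx : IsMinKernel σ S x) (h2 : ∀ v ∈ S, SupportLeTwo x v)
    {w : G.V} (hw : w ∉ S) (hr : rowSum σ x w ≠ 0) {i j : G.I} (hi : G.vert i = w)
    (hj : G.vert j = w) (hxi : x (G.edge i) ≠ 0) (hxj : x (G.edge j) ≠ 0) : i = j := by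
  by_contra hij
  have h := hx.pair_sum hσ h2 hw hij hi hj hxi hxj
  refine hr ?_
  have hle := hx.supportLeTwo_of_notMem hσ h2 hw
  rw [rowSum, ← Finset.sum_subset (s₁ := {i, j}), Finset.sum_pair hij, h]
  · intro k hk
    rcases Finset.mem_insert.1 hk with rfl | hk
    · simpa using hi
    · rw [Finset.mem_singleton.1 hk]; simpa using hj
  · intro k hk hk'
    by_cases hxk : x (G.edge k) = 0
    · rw [hxk, zero_mul]
    · simp only [Finset.mem_insert, Finset.mem_singleton, not_or] at hk'
      rcases hle i j k hi hj (by simpa using hk) hxi hxj hxk with h | h | h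
      · exact absurd h hij
      · exact absurd h.symm hk'.1
      · exact absurd h.symm hk'.2

theorem exists_of_rowSum_ne_zero {σ : G.I → ℤˣ} {x : G.E → ℝ} {w : G.V}
    (hr : rowSum σ x w ≠ 0) : ∃ i, G.vert i = w ∧ x (G.edge i) ≠ 0 := by
  by_contra! h
  refine hr (Finset.sum_eq_zero fun i hi => ?_)
  rw [h i (by simpa using hi), zero_mul]

/-- In a balanced hypergraph every vertex of `S` lies in at most two incidences of the support
of a minimal vector. -/
theorem IsMinKernel.supportLeTwo {σ : G.I → ℤˣ} (hσ : EvenBalanced σ) (S : Finset G.V) :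
    ∀ x : G.E → ℝ, IsMinKernel σ S x → ∀ v ∈ S, SupportLeTwo x v := by
  induction S using Finset.strongInduction with
  | H S ih =>
    intro x hx w hw
    have hwS : w ∉ S.erase w := Finset.notMem_erase w S
    have ih' := ih _ (Finset.erase_ssubset hw)
    have hker : ∀ y : G.E → ℝ, rowSum σ y w = 0 → (∀ v ∈ S.erase w, rowSum σ y v = 0) →
        ∀ v ∈ S, rowSum σ y v = 0 := by
      intro y h1 h2 v hv
      by_cases h : v = w
      · rw [h, h1]
      · exact h2 v (Finset.mem_erase.2 ⟨h, hv⟩)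
    have hvanish : ∀ y : G.E → ℝ, (∀ v ∈ S, rowSum σ y v = 0) → (∀ e, x e = 0 → y e = 0) →
        ∀ e, x e ≠ 0 → y e = 0 → y = 0 := by
      intro y h1 h2 e he hy
      obtain ⟨c, rfl⟩ := hx.min y h1 h2
      rcases mul_eq_zero.1 hy with h | h
      · rw [h, zero_smul]
      · exact absurd h he
    have hxker : ∀ v ∈ S.erase w, rowSum σ x v = 0 :=
      fun v hv => hx.ker v (Finset.mem_of_mem_erase hv)
    -- The question is whether `x` stays minimal after the row `w` is dropped. If not, `x` splits
    -- into two vectors that are minimal for the remaining rows.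
    by_cases hz : ∃ z : G.E → ℝ, z ≠ 0 ∧ (∀ v ∈ S.erase w, rowSum σ z v = 0) ∧
        (∀ e, x e = 0 → z e = 0) ∧ ∃ e, x e ≠ 0 ∧ z e = 0
    · have hr : ∀ z : G.E → ℝ, z ≠ 0 → (∀ v ∈ S.erase w, rowSum σ z v = 0) →
          (∀ e, x e = 0 → z e = 0) → ∀ e, x e ≠ 0 → z e = 0 → rowSum σ z w ≠ 0 :=
        fun z h1 h2 h3 e h4 h5 h6 => h1 (hvanish z (hker z h6 h2) h3 e h4 h5)
      -- Row `w` does not vanish on such a `z`, so a multiple of `z` corrects any competitor to a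
      -- vector of the old kernel. That vector vanishes at `e`, hence is zero.
      have hmin : ∀ z : G.E → ℝ, z ≠ 0 → (∀ v ∈ S.erase w, rowSum σ z v = 0) →
          (∀ e, x e = 0 → z e = 0) → ∀ e, x e ≠ 0 → z e = 0 → IsMinKernel σ (S.erase w) z := by
        intro z h1 h2 h3 e h4 h5
        have hrz := hr z h1 h2 h3 e h4 h5
        refine ⟨h1, h2, fun y hy hyz => ⟨rowSum σ y w / rowSum σ z w, ?_⟩⟩
        refine sub_eq_zero.1 (hvanish _ (hker _ ?_ fun v hv => ?_) (fun e he => ?_) e h4 ?_)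
        · rw [rowSum_sub_smul, div_mul_cancel₀ _ hrz, sub_self]
        · rw [rowSum_sub_smul, hy v hv, h2 v hv, mul_zero, sub_self]
        · simp [h3 e he, hyz e (h3 e he)]
        · simp [h5, hyz e h5]
      obtain ⟨z, hz0, hzk, hzx, e, hxe, hze⟩ := hz
      have hzm := hmin z hz0 hzk hzx e hxe hze
      have hzr := hr z hz0 hzk hzx e hxe hze
      obtain ⟨a, haw, hza⟩ := exists_of_rowSum_ne_zero hzr
      have hxa : x (G.edge a) ≠ 0 := fun h => hza (hzx _ h)
      -- The scalar is chosen to cancel the entry at the edge of `a`, so that `y` is also a vector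
      -- with strictly smaller support.
      set y : G.E → ℝ := x - (x (G.edge a) / z (G.edge a)) • z with hy
      have hye : y e ≠ 0 := by simpa [hy, hze] using hxe
      have hya : y (G.edge a) = 0 := by simp [hy, hza]
      have hyk : ∀ v ∈ S.erase w, rowSum σ y v = 0 := fun v hv => by
        rw [hy, rowSum_sub_smul, hxker v hv, hzk v hv, mul_zero, sub_self]
      have hyx : ∀ e, x e = 0 → y e = 0 := fun e he => by simp [hy, he, hzx e he]
      have hy0 : y ≠ 0 := fun h => hye (by rw [h]; rfl)
      have hym := hmin y hy0 hyk hyx _ hxa hya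
      have hyr := hr y hy0 hyk hyx _ hxa hya
      -- Each of `z` and `y` has at most one support incidence at `w`. Their supports cover that of
      -- `x`, which leaves room for two.
      have huz := fun {i j : G.I} =>
        hzm.eq_of_rowSum_ne_zero hσ (ih' z hzm) hwS hzr (i := i) (j := j)
      have huy := fun {i j : G.I} =>
        hym.eq_of_rowSum_ne_zero hσ (ih' y hym) hwS hyr (i := i) (j := j)
      have hor : ∀ i, x (G.edge i) ≠ 0 → z (G.edge i) ≠ 0 ∨ y (G.edge i) ≠ 0 := by
        intro i hi
        by_cases h : z (G.edge i) = 0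
        · exact Or.inr (by simpa [hy, h] using hi)
        · exact Or.inl h
      intro i j k hi hj hk hxi hxj hxk
      rcases hor i hxi with h1 | h1 <;> rcases hor j hxj with h2 | h2 <;>
        rcases hor k hxk with h3 | h3
      · exact Or.inl (huz hi hj h1 h2)
      · exact Or.inl (huz hi hj h1 h2)
      · exact Or.inr (Or.inl (huz hi hk h1 h3))
      · exact Or.inr (Or.inr (huy hj hk h2 h3))
      · exact Or.inr (Or.inr (huz hj hk h2 h3))
      · exact Or.inr (Or.inl (huy hi hk h1 h3))
      · exact Or.inl (huy hi hj h1 h2)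
      · exact Or.inl (huy hi hj h1 h2)
    · push Not at hz
      have hm : IsMinKernel σ (S.erase w) x := by
        refine ⟨hx.ne_zero, hxker, fun y hy hyx => ?_⟩
        obtain ⟨e, he⟩ := Function.ne_iff.1 hx.ne_zero
        refine ⟨y e / x e, ?_⟩
        by_contra hne
        refine hz (y - (y e / x e) • x) (sub_ne_zero.2 hne) (fun v hv => ?_)
          (fun f hf => ?_) e he ?_
        · rw [rowSum_sub_smul, hy v hv, hxker v hv, mul_zero, sub_self]
        · simp [hf, hyx f hf]
        · have : x e ≠ 0 := he
          simp [this]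
      exact hm.supportLeTwo_of_notMem hσ (ih' x hm) hwS

/-- A connected hypergraph with an edge, all of whose vertices have degree two. -/
structure IsGood (G : IncHypergraph.{u}) : Prop where
  nonempty : Nonempty G.E
  conn : ∀ a b, Conn (Set.univ : Set G.I) a b
  bivalent : ∀ v, G.IsBivalent v

/-- A balanced connected hypergraph of degree two can be switched so that the signs at every
vertex are opposite. -/
theorem IsGood.exists_switch (hG : G.IsGood) {σ : G.I → ℤˣ} (hσ : EvenBalanced σ) :
    ∃ f : G.E → ℤˣ, ∀ i j, i ≠ j → G.vert i = G.vert j →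
      f (G.edge i) * σ i = -(f (G.edge j) * σ j) := by
  classical
  obtain ⟨e₀⟩ := hG.nonempty
  have hP : ∀ e, ∃ P : Finset G.I, IsJoin P (Sum.inr e₀) (Sum.inr e) := by
    intro e
    obtain ⟨P, -, h⟩ := (hG.conn (Sum.inr e₀) (Sum.inr e)).exists_join
    exact ⟨P, h⟩
  choose P hP using hP
  have hcard : ∀ e, Even (P e).card := by
    intro e
    have h := hP e (fun x => if x.isLeft then 1 else 0)
    simp only [endSum, Sum.isLeft_inl, Sum.isLeft_inr, if_true, Bool.false_eq_true, if_false,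
      add_zero, Finset.sum_const, nsmul_eq_mul, mul_one] at h
    exact (ZMod.natCast_eq_zero_iff_even).1 h
  have hmod := fun e => two_dvd_sum_units (hcard e) σ
  -- The switch at `e` records whether the sign sum along a chosen join from `e₀` to `e` is 0 or 2
  -- modulo 4. These are the only cases, since the join has even size.
  refine ⟨fun e => if (4 : ℤ) ∣ ∑ k ∈ P e, (σ k : ℤ) then 1 else -1, fun i j hij hv => ?_⟩
  obtain ⟨j', hij', h⟩ := (hG.bivalent (G.vert j)).exists_pair hv
  obtain rfl : j = j' := ((h j).1 rfl).resolve_left (Ne.symm hij)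
  have hpairmem : ∀ e, i ∈ P e ↔ j ∈ P e :=
    fun e => mem_iff_mem_of_even hij h ((hP e).card_vert _)
  set A := P (G.edge i)
  set B := P (G.edge j)
  -- The error is twice the sign sum over the intersection, which is even as soon as the
  -- intersection is even at every vertex.
  have hsum : ∀ S T : Finset G.I, (∀ v, Even ((S ∩ T).filter fun k => G.vert k = v).card) →
      (4 : ℤ) ∣ ∑ k ∈ symmDiff S T, (σ k : ℤ) - (∑ k ∈ S, (σ k : ℤ) + ∑ k ∈ T, (σ k : ℤ)) := by
    intro S T hST
    have h2 : (2 : ℤ) ∣ ∑ k ∈ S ∩ T, (σ k : ℤ) := by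
      rw [← Finset.sum_fiberwise (S ∩ T) G.vert]
      exact Finset.dvd_sum fun v _ => two_dvd_sum_units (hST v) σ
    have h3 : ∑ k ∈ symmDiff S T, (σ k : ℤ) = ∑ k ∈ S \ T, (σ k : ℤ) + ∑ k ∈ T \ S, (σ k : ℤ) := by
      rw [symmDiff_def, Finset.sup_eq_union, Finset.sum_union disjoint_sdiff_sdiff]
    have h4 := Finset.sum_inter_add_sum_sdiff S T (fun k => (σ k : ℤ))
    have h5 := Finset.sum_inter_add_sum_sdiff T S (fun k => (σ k : ℤ))
    rw [Finset.inter_comm T S] at h5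
    omega
  have hAB : ∀ v, Even ((A ∩ B).filter fun k => G.vert k = v).card := by
    intro v
    obtain ⟨a, b, hab, h⟩ := hG.bivalent v
    have h1 := mem_iff_mem_of_even hab h ((hP (G.edge i)).card_vert v)
    have h2 := mem_iff_mem_of_even hab h ((hP (G.edge j)).card_vert v)
    by_cases ha : a ∈ A ∩ B
    · have hb : b ∈ A ∩ B := by
        rw [Finset.mem_inter] at ha ⊢
        exact ⟨h1.1 ha.1, h2.1 ha.2⟩
      have : (A ∩ B).filter (fun k => G.vert k = v) = {a, b} := by
        ext k
        rw [Finset.mem_filter, h, Finset.mem_insert, Finset.mem_singleton]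
        constructor
        · exact fun h => h.2
        · rintro (rfl | rfl)
          · exact ⟨ha, Or.inl rfl⟩
          · exact ⟨hb, Or.inr rfl⟩
      rw [this, Finset.card_pair hab]
      exact even_two
    · have hb : b ∉ A ∩ B := by
        rw [Finset.mem_inter] at ha ⊢
        rwa [← h1, ← h2]
      rw [Finset.filter_false_of_mem]
      · simp
      · intro k hk hkv
        rcases (h k).1 hkv with rfl | rfl
        · exact ha hk
        · exact hb hk
  have hjoin : IsJoin (symmDiff A B) (Sum.inr (G.edge i)) (Sum.inr (G.edge j)) :=
    (hP _).symm.symmDiff (hP _)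
  have hpair : IsJoin ({i, j} : Finset G.I) (Sum.inr (G.edge i)) (Sum.inr (G.edge j)) := by
    intro k
    rw [endSum, Finset.sum_pair hij, hv]
    linear_combination CharTwo.add_self_eq_zero (k (Sum.inl (G.vert j)))
  have hev : IsEven (symmDiff (symmDiff A B) {i, j}) := (hjoin.symm.symmDiff hpair).isEven
  have hmem : i ∈ symmDiff A B ↔ j ∈ symmDiff A B := by
    have h1 := hpairmem (G.edge i)
    have h2 := hpairmem (G.edge j)
    rw [Finset.mem_symmDiff, Finset.mem_symmDiff]
    tauto
  have hAB2 : ∀ v, Even ((symmDiff A B ∩ {i, j}).filter fun k => G.vert k = v).card := by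
    intro v
    by_cases hi : i ∈ symmDiff A B
    · have : symmDiff A B ∩ {i, j} = {i, j} := by
        refine Finset.inter_eq_right.2 fun k hk => ?_
        rcases Finset.mem_insert.1 hk with rfl | hk
        · exact hi
        · rw [Finset.mem_singleton.1 hk]; exact hmem.1 hi
      rw [this]
      by_cases hv' : G.vert j = v
      · rw [Finset.filter_true_of_mem, Finset.card_pair hij]
        · exact even_two
        · intro k hk
          rcases Finset.mem_insert.1 hk with rfl | hk
          · rw [hv, hv']
          · rw [Finset.mem_singleton.1 hk, hv']
      · rw [Finset.filter_false_of_mem]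
        · simp
        · intro k hk
          rcases Finset.mem_insert.1 hk with rfl | hk
          · rwa [hv]
          · rwa [Finset.mem_singleton.1 hk]
    · have : symmDiff A B ∩ {i, j} = ∅ := by
        ext k
        simp only [Finset.mem_inter, Finset.mem_insert, Finset.mem_singleton, Finset.notMem_empty,
          iff_false, not_and]
        rintro hk (rfl | rfl)
        · exact hi hk
        · exact hi (hmem.2 hk)
      rw [this]; simp
  -- Together these say that the sums over `A` and `B` plus the signs of `i` and `j` vanish modulo
  -- 4, which fixes the relation between the two switched signs.
  have h1 := hsum A B hAB
  have h2 := hsum (symmDiff A B) {i, j} hAB2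
  have h3 := hσ _ hev
  rw [Finset.sum_pair hij] at h2
  have h4 := hmod (G.edge i)
  have h5 := hmod (G.edge j)
  change (2 : ℤ) ∣ ∑ k ∈ A, (σ k : ℤ) at h4
  change (2 : ℤ) ∣ ∑ k ∈ B, (σ k : ℤ) at h5
  change (if (4 : ℤ) ∣ ∑ k ∈ A, (σ k : ℤ) then (1 : ℤˣ) else -1) * σ i =
    -((if (4 : ℤ) ∣ ∑ k ∈ B, (σ k : ℤ) then (1 : ℤˣ) else -1) * σ j)
  rw [← Units.val_inj]
  by_cases hA : (4 : ℤ) ∣ ∑ k ∈ A, (σ k : ℤ) <;> by_cases hB : (4 : ℤ) ∣ ∑ k ∈ B, (σ k : ℤ) <;>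
    simp only [hA, hB, if_true, if_false, Units.val_neg, neg_mul, one_mul, neg_neg] <;>
    rcases Int.units_eq_one_or_neg_one_cast (σ i) with h6 | h6 <;>
    rcases Int.units_eq_one_or_neg_one_cast (σ j) with h7 | h7 <;> rw [h6, h7] at h2 <;>
    rw [h6, h7] <;> omega

end IncHypergraph

/-! ### The incidence matrix and degree two -/

namespace OrientedHypergraph

open IncHypergraph

variable {G : OrientedHypergraph.{u}}

theorem sum_mul_incidenceMatrix (x : G.E → ℝ) (v : G.V) :
    ∑ e, x e * G.incidenceMatrix v e = rowSum G.σ x v := by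
  rw [rowSum, ← Finset.sum_fiberwise _ G.edge]
  refine Finset.sum_congr rfl fun e _ => ?_
  have : G.incidenceMatrix v e =
      ∑ i with G.vert i = v ∧ G.edge i = e, ((G.σ i : ℤ) : ℝ) := by
    classical
    rw [incidenceMatrix, finsum_eq_sum_of_fintype]
    exact (Finset.sum_subtype _ (by simp) (fun i => ((G.σ i : ℤ) : ℝ))).symm
  rw [this, Finset.mul_sum, Finset.filter_filter]
  refine Finset.sum_congr rfl fun i hi => ?_
  rw [(Finset.mem_filter.1 hi).2.2]

theorem sum_smul_col_eq_zero_iff (x : G.E → ℝ) :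
    ∑ e, x e • G.incidenceMatrix.col e = 0 ↔ ∀ v, rowSum G.σ x v = 0 := by
  rw [funext_iff]
  refine forall_congr' fun v => ?_
  rw [← sum_mul_incidenceMatrix]
  simp [Finset.sum_apply, Matrix.col]

theorem linearIndepOn_col_iff (F : Set G.E) :
    LinearIndepOn ℝ G.incidenceMatrix.col F ↔
      ∀ x : G.E → ℝ, (∀ v, rowSum G.σ x v = 0) → (∀ e, e ∉ F → x e = 0) → x = 0 := by
  classical
  rw [linearIndepOn_iff]
  constructor
  · intro h x hx hF
    have := h (Finsupp.equivFunOnFinite.symm x) ?_ ?_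
    · exact funext fun e => DFunLike.congr_fun this e
    · intro e he
      by_contra hne
      exact (Finsupp.mem_support_iff.1 he) (hF e hne)
    · rw [Finsupp.linearCombination_apply, Finsupp.sum_fintype _ _ (by simp)]
      exact (sum_smul_col_eq_zero_iff x).2 hx
  · intro h l hl hl0
    have := h l ?_ ?_
    · exact DFunLike.coe_injective this
    · rw [← sum_smul_col_eq_zero_iff, ← hl0, Finsupp.linearCombination_apply,
        Finsupp.sum_fintype _ _ (by simp)]
    · intro e he
      by_contra hne
      exact he (hl (Finsupp.mem_support_iff.2 hne))

/-- A proper subfamily omits a column, so only kernel vectors with a zero entry have to be excluded.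
-/
theorem isMinimallyDependent_iff : G.IsMinimallyDependent ↔
    (∃ x : G.E → ℝ, x ≠ 0 ∧ ∀ v, rowSum G.σ x v = 0) ∧
      ∀ x : G.E → ℝ, (∀ v, rowSum G.σ x v = 0) → ∀ e, x e = 0 → x = 0 := by
  rw [IsMinimallyDependent, ← linearIndepOn_univ_iff, linearIndepOn_col_iff]
  refine and_congr ?_ ?_
  · push Not
    exact ⟨fun ⟨x, h1, _, h2⟩ => ⟨x, h2, h1⟩,
      fun ⟨x, h2, h1⟩ => ⟨x, h1, fun e h => absurd trivial h, h2⟩⟩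
  · constructor
    · intro h x hx e he
      refine (linearIndepOn_col_iff {e}ᶜ).1 (h _ ?_) x hx ?_
      · intro heq
        exact (heq ▸ Set.mem_univ e : e ∈ ({e}ᶜ : Set G.E)) rfl
      · intro f hf
        rw [not_not.1 hf, he]
    · intro h F hF
      rw [linearIndepOn_col_iff]
      intro x hx hxF
      obtain ⟨e, he⟩ := (Set.ne_univ_iff_exists_notMem F).1 hF
      exact h x hx e (hxF e he)

/-- A balanced minimal dependency without isolated vertices is connected and all its vertices have
degree two. -/
theorem IsMinimallyDependent.isGood (h : G.IsMinimallyDependent) (hb : G.IsBalanced)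
    (hG : ∀ v, G.degree v ≠ 0) : G.toIncHypergraph.IsGood := by
  rw [isBalanced_iff] at hb
  obtain ⟨⟨x, hx0, hx⟩, hmin⟩ := isMinimallyDependent_iff.1 h
  have hxe : ∀ e, x e ≠ 0 := fun e he => hx0 (hmin x hx e he)
  obtain ⟨e₀, -⟩ := Function.ne_iff.1 hx0
  -- From a competitor, the multiple of `x` that agrees with it at `e₀` is subtracted; the
  -- difference has a zero entry and therefore vanishes.
  have hk : IsMinKernel G.σ Finset.univ x := by
    refine ⟨hx0, fun v _ => hx v, fun y hy _ => ⟨y e₀ / x e₀, ?_⟩⟩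
    refine sub_eq_zero.1 (hmin _ (fun v => ?_) e₀ ?_)
    · rw [rowSum_sub_smul, hy v (Finset.mem_univ v), hx, mul_zero, sub_self]
    · simp [hxe]
  have hle := IsMinKernel.supportLeTwo hb _ x hk
  have hinc : ∀ v, ∃ i, G.vert i = v := by
    intro v
    by_contra! hv
    refine hG v ?_
    have : IsEmpty {i : G.I // G.vert i = v} := ⟨fun i => hv i.1 i.2⟩
    exact Nat.card_of_isEmpty
  have hconn : ∀ e f, Conn (Set.univ : Set G.I) (Sum.inr e) (Sum.inr f) :=
    fun e f => (hk.conn (hxe e) (hxe f)).mono (Set.subset_univ _)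
  have hto : ∀ a, Conn (Set.univ : Set G.I) (Sum.inr e₀) a := by
    rintro (v | e)
    · obtain ⟨i, rfl⟩ := hinc v
      exact (hconn e₀ (G.edge i)).trans (Conn.of_mem (Set.mem_univ i)).symm
    · exact hconn e₀ e
  refine ⟨⟨e₀⟩, fun a b => (hto a).symm.trans (hto b), fun v => ?_⟩
  obtain ⟨i, hi⟩ := hinc v
  -- All entries of `x` are nonzero: a single incidence could not give row sum 0, so there is a
  -- second, and `hle` rules out a third.
  obtain ⟨j, hji, hj, -⟩ := exists_ne_of_rowSum_eq_zero (hx v) hi (hxe _)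
  refine ⟨i, j, hji.symm, fun k => ⟨fun hk' => ?_, ?_⟩⟩
  · rcases hle v (Finset.mem_univ v) i j k hi hj hk' (hxe _) (hxe _) (hxe _) with h | h | h
    · exact absurd h.symm hji
    · exact Or.inl h.symm
    · exact Or.inr h.symm
  · rintro (rfl | rfl) <;> assumption

/-- A balanced connected hypergraph of degree two is minimally dependent. -/
theorem IsBalanced.isMinimallyDependent (hb : G.IsBalanced) (hG : G.toIncHypergraph.IsGood) :
    G.IsMinimallyDependent := by
  rw [isBalanced_iff] at hb
  obtain ⟨f, hf⟩ := hG.exists_switch hb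
  have hrow : ∀ (y : G.E → ℝ) {v : G.V} {i j : G.I}, i ≠ j →
      (∀ k, G.vert k = v ↔ k = i ∨ k = j) →
      rowSum G.σ y v = y (G.edge i) * ((G.σ i : ℤ) : ℝ) + y (G.edge j) * ((G.σ j : ℤ) : ℝ) := by
    intro y v i j hij h
    have : (Finset.univ.filter fun k => G.vert k = v) = {i, j} := by
      ext k; simp [h]
    rw [rowSum, this, Finset.sum_pair hij]
  have hfR : ∀ i j, i ≠ j → G.vert i = G.vert j →
      ((f (G.edge i) : ℤ) : ℝ) * ((G.σ i : ℤ) : ℝ) =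
        -(((f (G.edge j) : ℤ) : ℝ) * ((G.σ j : ℤ) : ℝ)) := by
    intro i j hij hv
    have := hf i j hij hv
    rw [← Units.val_inj] at this
    push_cast at this
    exact_mod_cast this
  refine isMinimallyDependent_iff.2 ⟨⟨fun e => ((f e : ℤ) : ℝ), ?_, fun v => ?_⟩, ?_⟩
  · obtain ⟨e⟩ := hG.nonempty
    exact fun h => unit_cast_ne_zero (f e) (congrFun h e)
  · obtain ⟨i, j, hij, h⟩ := hG.bivalent v
    rw [hrow _ hij h, hfR i j hij (by rw [(h i).2 (Or.inl rfl), (h j).2 (Or.inr rfl)]),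
      neg_add_cancel]
  · intro x hx e he
    -- With two incidences per row, a zero entry passes from one edge to the other across the
    -- vertex.
    have hs : ∀ i j, i ≠ j → G.vert i = G.vert j → x (G.edge i) = 0 → x (G.edge j) = 0 := by
      intro i j hij hv hi
      obtain ⟨j', hij', h⟩ := (hG.bivalent _).exists_pair hv
      obtain rfl : j = j' := ((h j).1 rfl).resolve_left (Ne.symm hij)
      have := hx (G.vert j)
      rw [hrow _ hij h, hi, zero_mul, zero_add] at this
      exact (mul_eq_zero.1 this).resolve_right (unit_cast_ne_zero _)
    funext e'
    have := hG.conn (Sum.inr e) (Sum.inr e')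
      (Sum.elim (fun v => ∀ i, G.vert i = v → x (G.edge i) = 0) (fun e => x e = 0))
      (fun i _ => ⟨fun h => h i rfl, fun h j hj => ?_⟩) he
    · exact this
    · by_cases hij : i = j
      · exact hij ▸ h
      · exact hs i j hij hj.symm h

end OrientedHypergraph

namespace IncHypergraph

variable {G : IncHypergraph.{u}}

/-! ### Flowers -/

theorem edgeInduced_isCircleCovered {F : Set G.E}
    (h : ∀ i j, G.edge i ∈ F → G.edge j ∈ F → i ≠ j →
      ∃ C : G.Circle, i ∈ C.supp ∧ j ∈ C.supp ∧ ∀ k ∈ C.supp, G.edge k ∈ F)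
    (hC : ∃ C : G.Circle, ∀ k ∈ C.supp, G.edge k ∈ F) :
    (G.edgeInduced F).toHypergraph.IsCircleCovered := by
  refine ⟨fun i j hij => ?_, Or.inl ?_⟩
  · obtain ⟨C, hi, hj, hCF⟩ := h i.1 j.1 i.2 j.2 (fun h => hij (Subtype.ext h))
    obtain ⟨D, -, hD⟩ := (G.edgeInduced F).exists_circle C
      (fun k hk => hCF k (Circle.mem_supp.2 hk))
    exact ⟨D, (hD i).2 (Circle.mem_supp.1 hi), (hD j).2 (Circle.mem_supp.1 hj)⟩
  · obtain ⟨C, hCF⟩ := hC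
    obtain ⟨D, -⟩ := (G.edgeInduced F).exists_circle C (fun k hk => hCF k (Circle.mem_supp.2 hk))
    exact ⟨D⟩

theorem Circle.exists_ne (C : G.Circle) (i : G.I) : ∃ j ∈ C.supp, j ≠ i := by
  by_cases h : C.out 0 = i
  · exact ⟨C.ret 0, C.ret_mem 0, fun h' => C.out_ne_ret 0 0 (h.trans h'.symm)⟩
  · exact ⟨C.out 0, C.out_mem 0, h⟩

theorem IsInseparable.exists_circle (h : G.IsInseparable) (C : G.Circle) (i j : G.I) :
    ∃ D : G.Circle, i ∈ D.supp ∧ j ∈ D.supp := by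
  by_cases hij : i = j
  · obtain ⟨k, -, hk⟩ := C.exists_ne i
    obtain ⟨D, h1, h2⟩ := h i k hk.symm
    exact ⟨D, by simpa using h1, by simpa [← hij] using h1⟩
  · obtain ⟨D, h1, h2⟩ := h i j hij
    exact ⟨D, by simpa using h1, by simpa using h2⟩

/-- The edges that have incidences already induce a circle-covered part, so minimality leaves no
empty edge. -/
theorem IsFlower.exists_inc_edge (hG : G.IsFlower) (C : G.Circle) (e : G.E) :
    ∃ i, G.edge i = e := by
  have := hG.2 {e | ∃ i, G.edge i = e} (edgeInduced_isCircleCovered (fun i j _ _ hij => ?_) ?_)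
  · have h : e ∈ (Sub.whole G).edges := trivial
    rw [← this] at h
    exact h
  · obtain ⟨D, h1, h2⟩ := hG.1.1.exists_circle C i j
    exact ⟨D, h1, h2, fun k _ => ⟨k, rfl⟩⟩
  · exact ⟨C, fun k _ => ⟨k, rfl⟩⟩

/-- The part induced by all edges lacks exactly the isolated vertices, and minimality makes it the
whole. -/
theorem IsFlower.exists_inc_vert (hG : G.IsFlower) (C : G.Circle) (v : G.V) :
    ∃ i, G.vert i = v := by
  have := hG.2 Set.univ (edgeInduced_isCircleCovered (fun i j _ _ hij => ?_) ?_)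
  · have h : v ∈ (Sub.whole G).verts := trivial
    rw [← this] at h
    obtain ⟨i, hi, -⟩ := h
    exact ⟨i, hi⟩
  · obtain ⟨D, h1, h2⟩ := hG.1.1.exists_circle C i j
    exact ⟨D, h1, h2, fun k _ => trivial⟩
  · exact ⟨C, fun k _ => trivial⟩

theorem IsInseparable.conn (hG : G.IsInseparable) (C : G.Circle) (hV : ∀ v, ∃ i, G.vert i = v)
    (hE : ∀ e, ∃ i, G.edge i = e) (a b : G.V ⊕ G.E) : Conn (Set.univ : Set G.I) a b := by
  have h1 : ∀ i j, Conn (Set.univ : Set G.I) (Sum.inl (G.vert i)) (Sum.inl (G.vert j)) := by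
    intro i j
    obtain ⟨D, h1, h2⟩ := hG.exists_circle C i j
    exact (D.conn_supp h1 h2).mono (Set.subset_univ _)
  have h2 : ∀ a, ∃ i, Conn (Set.univ : Set G.I) a (Sum.inl (G.vert i)) := by
    rintro (v | e)
    · obtain ⟨i, rfl⟩ := hV v
      exact ⟨i, Conn.refl _ _⟩
    · obtain ⟨i, rfl⟩ := hE e
      exact ⟨i, (Conn.of_mem (Set.mem_univ i)).symm⟩
  obtain ⟨i, hi⟩ := h2 a
  obtain ⟨j, hj⟩ := h2 b
  exact (hi.trans (h1 i j)).trans hj.symm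

/-- A non-empty set of incidences, any two of which lie in a common circle of the set, that
meets every vertex in at most two incidences. -/
structure IsThinCore (K : Finset G.I) : Prop where
  nonempty : K.Nonempty
  circle : ∀ i ∈ K, ∀ j ∈ K, ∃ C : G.Circle, i ∈ C.supp ∧ j ∈ C.supp ∧ C.supp ⊆ K
  vert_le_two : ∀ i ∈ K, ∀ j ∈ K, ∀ k ∈ K, G.vert i = G.vert j → G.vert i = G.vert k →
    i = j ∨ i = k ∨ j = k

theorem Circle.isThinCore (C : G.Circle) : IsThinCore C.supp :=
  ⟨⟨_, C.out_mem 0⟩, fun _ hi _ hj => ⟨C, hi, hj, subset_rfl⟩,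
    fun _ hi _ hj _ hk => C.vert_le_two hi hj hk⟩

theorem Circle.conn_of_mem (C : G.Circle) {T : Set G.I} (hT : (C.supp : Set G.I) ⊆ T) {i j : G.I}
    (hi : i ∈ C.supp) (hj : j ∈ C.supp) :
    Conn T (Sum.inr (G.edge i)) (Sum.inl (G.vert j)) :=
  (Conn.of_mem (hT hi)).symm.trans ((C.conn_supp hi hj).mono hT)

/-- In a balanced inseparable hypergraph, a maximal thin core contains all incidences of its
edges. -/
theorem IsThinCore.mem_of_edge_eq {σ : G.I → ℤˣ} (hσ : EvenBalanced σ) (hG : G.IsInseparable)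
    {K : Finset G.I} (hK : IsThinCore K) (hmax : ∀ L : Finset G.I, IsThinCore L → K ⊆ L → L = K)
    {i k : G.I} (hk : k ∈ K) (hik : G.edge i = G.edge k) : i ∈ K := by
  classical
  by_contra hi
  obtain ⟨D, hiD', hkD'⟩ := hG i k (fun h => hi (h ▸ hk))
  have hiD : i ∈ D.supp := Circle.mem_supp.2 hiD'
  have hkD : k ∈ D.supp := Circle.mem_supp.2 hkD'
  set R : Finset G.I := D.supp \ K with hR
  have hiR : i ∈ R := Finset.mem_sdiff.2 ⟨hiD, hi⟩
  -- A walk outside `K` from the edge of `i` to a vertex of `K`, with the two arcs of a circle in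
  -- `K` through that edge and vertex, would give three disjoint joins.
  have hno : ∀ a ∈ K, ¬ Conn (R : Set G.I) (Sum.inr (G.edge i)) (Sum.inl (G.vert a)) := by
    intro a ha hconn
    obtain ⟨C, hkC, haC, hCK⟩ := hK.circle k hk a ha
    obtain ⟨Q, hQR, hQ⟩ := hconn.exists_join
    obtain ⟨P, hPC, hP⟩ := (C.conn_of_mem subset_rfl hkC haC).exists_join
    have hPC' : P ⊆ C.supp := by exact_mod_cast hPC
    have hQR' : Q ⊆ R := by exact_mod_cast hQR
    rw [← hik] at hP
    have hRK : Disjoint R K := Finset.sdiff_disjoint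
    exact hσ.no_three_joins hP (C.isEven_supp.sdiff_join hP hPC') hQ Finset.disjoint_sdiff
      (hRK.mono hQR' (hPC'.trans hCK)).symm
      (hRK.mono hQR' (Finset.sdiff_subset.trans hCK)).symm
  set T : Finset G.I := R.filter fun q =>
    Conn (R : Set G.I) (Sum.inr (G.edge i)) (Sum.inr (G.edge q)) with hT
  have hTR : T ⊆ R := Finset.filter_subset _ _
  have hvT : ∀ q ∈ T, ∀ a ∈ K, G.vert q ≠ G.vert a := by
    intro q hq a ha hqa
    rw [hT, Finset.mem_filter] at hq
    exact hno a ha (hqa ▸ (Conn.vert_iff_edge (by exact_mod_cast hq.1)).2 hq.2)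
  -- The part `T` of `D` beyond `i` can return to `K` only through edges. A predicate separating the
  -- ends of `i` would leave `i` as the only odd contribution of `D`.
  have hconn : Conn (↑((T \ {i}) ∪ K) : Set G.I) (Sum.inl (G.vert i)) (Sum.inr (G.edge i)) := by
    intro p hp hpi
    by_contra hpe
    have hKp : ∀ a ∈ K, ¬ p (Sum.inr (G.edge a)) := by
      intro a ha hpa
      obtain ⟨C, hkC, haC, hCK⟩ := hK.circle k hk a ha
      have hsub : (C.supp : Set G.I) ⊆ ↑((T \ {i}) ∪ K) := by
        exact_mod_cast hCK.trans Finset.subset_union_right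
      have := (C.conn_of_mem hsub hkC haC).trans (Conn.of_mem (hsub haC))
      exact hpe (hik ▸ this.symm p hp hpa)
    have hsum := D.isEven_supp (fun x =>
      if p x ∧ Conn (R : Set G.I) (Sum.inr (G.edge i)) x then 1 else 0)
    rw [endSum, Finset.sum_eq_single_of_mem i hiD] at hsum
    · have h1 : Conn (R : Set G.I) (Sum.inr (G.edge i)) (Sum.inl (G.vert i)) :=
        (Conn.of_mem (by exact_mod_cast hiR)).symm
      simp [hpi, hpe, h1] at hsum
    · intro q hq hqi
      by_cases hqK : q ∈ K
      · simp [hno q hqK, hKp q hqK]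
      · have hqR : q ∈ R := Finset.mem_sdiff.2 ⟨hq, hqK⟩
        have hiff := Conn.vert_iff_edge (a := Sum.inr (G.edge i)) (T := (R : Set G.I)) (i := q)
          (by exact_mod_cast hqR)
        by_cases hc : Conn (R : Set G.I) (Sum.inr (G.edge i)) (Sum.inr (G.edge q))
        · have hpq := hp q (by
            simp only [Finset.coe_union, Set.mem_union, Finset.mem_coe]
            exact Or.inl (Finset.mem_sdiff.2 ⟨Finset.mem_filter.2 ⟨hqR, hc⟩, by simpa using hqi⟩))
          by_cases hpv : p (Sum.inl (G.vert q))
          · simp [hc, hiff.2 hc, hpv, hpq.1 hpv, CharTwo.add_self_eq_zero]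
          · simp [hpv, mt hpq.2 hpv]
        · simp [hc, mt hiff.1 hc]
  obtain ⟨B, hiB, hB⟩ := exists_circle_of_conn (by simp [hi]) hconn
  have hBsub : ∀ b ∈ B.supp, b ∈ T ∨ b ∈ K := by
    intro b hb
    rcases hB (Circle.mem_supp.1 hb) with rfl | hb'
    · exact Or.inl (Finset.mem_filter.2 ⟨hiR, Conn.refl _ _⟩)
    · rcases Finset.mem_union.1 (Finset.mem_coe.1 hb') with h | h
      · exact Or.inl (Finset.mem_sdiff.1 h).1
      · exact Or.inr h
  -- A circle `B` missing `K` would lie inside `D`, hence equal `D`, which contains `k`.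
  obtain ⟨m, hmB, hmK⟩ : ∃ m ∈ B.supp, m ∈ K := by
    by_contra! h
    have hBD : B.supp ⊆ D.supp := fun b hb =>
      (Finset.mem_sdiff.1 (hTR ((hBsub b hb).resolve_right (h b hb)))).1
    exact h k (B.eq_of_subset D hBD ▸ hkD) hk
  have hcross : ∀ a ∈ K, ∀ b ∈ B.supp, ∃ C : G.Circle, a ∈ C.supp ∧ b ∈ C.supp ∧
      C.supp ⊆ K ∪ B.supp := by
    intro a ha b hb
    obtain ⟨C, haC, hmC, hCK⟩ := hK.circle a ha m hmK
    obtain ⟨F, h1, h2, h3⟩ := exists_circle_trans haC hb ⟨m, Finset.mem_inter.2 ⟨hmC, hmB⟩⟩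
    exact ⟨F, h1, h2, h3.trans (Finset.union_subset_union_left hCK)⟩
  -- The new incidences of `B` use no vertex of `K`, so adding them creates no vertex of degree
  -- above two.
  have hvert : ∀ a ∈ K ∪ B.supp, ∀ b ∈ K ∪ B.supp, G.vert a = G.vert b → a ∈ K → b ∈ K := by
    intro a _ b hb hab ha
    rcases Finset.mem_union.1 hb with hb | hb
    · exact hb
    · exact (hBsub b hb).resolve_left fun hbT => hvT b hbT a ha hab.symm
  have hcore : IsThinCore (K ∪ B.supp) := by
    refine ⟨⟨k, Finset.mem_union_left _ hk⟩, fun a ha b hb => ?_, ?_⟩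
    · rcases Finset.mem_union.1 ha with ha | ha <;> rcases Finset.mem_union.1 hb with hb | hb
      · obtain ⟨C, h1, h2, h3⟩ := hK.circle a ha b hb
        exact ⟨C, h1, h2, h3.trans Finset.subset_union_left⟩
      · exact hcross a ha b hb
      · obtain ⟨C, h1, h2, h3⟩ := hcross b hb a ha
        exact ⟨C, h2, h1, h3⟩
      · exact ⟨B, ha, hb, Finset.subset_union_right⟩
    · intro a ha b hb c hc hab hac
      by_cases haK : a ∈ K
      · exact hK.vert_le_two a haK b (hvert a ha b hb hab haK) c (hvert a ha c hc hac haK) hab hac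
      · have hbK : b ∉ K := fun h => haK (hvert b hb a ha hab.symm h)
        have hcK : c ∉ K := fun h => haK (hvert c hc a ha hac.symm h)
        rw [Finset.mem_union] at ha hb hc
        exact B.vert_le_two (ha.resolve_left haK) (hb.resolve_left hbK) (hc.resolve_left hcK)
          hab hac
  have := hmax _ hcore Finset.subset_union_left
  exact hi (this ▸ Finset.mem_union_right _ (Circle.mem_supp.2 hiB))

theorem IsZeroEdge.isGood (hG : G.IsZeroEdge) : G.IsGood := by
  obtain ⟨hV, e, -, he⟩ := hG
  refine ⟨⟨e⟩, ?_, fun v => hV.elim v⟩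
  rintro (v | a) (w | b)
  · exact hV.elim v
  · exact hV.elim v
  · exact hV.elim w
  · rw [he a trivial, he b trivial]
    exact Conn.refl _ _

/-- A balanced flower is connected and all its vertices have degree two. -/
theorem IsFlower.isGood (hG : G.IsFlower) {σ : G.I → ℤˣ} (hσ : EvenBalanced σ) : G.IsGood := by
  classical
  obtain ⟨⟨C⟩⟩ | hzero := hG.1.2
  · obtain ⟨K, hK, hmax⟩ : ∃ K : Finset G.I, IsThinCore K ∧
        ∀ L : Finset G.I, IsThinCore L → K ⊆ L → L = K := by
      obtain ⟨K, hK⟩ := (Set.toFinite {K : Finset G.I | IsThinCore K}).exists_maximal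
        ⟨_, C.isThinCore⟩
      exact ⟨K, hK.prop, fun L hL hKL => (hK.eq_of_le hL hKL).symm⟩
    obtain ⟨k₀, hk₀⟩ := hK.nonempty
    have hin : ∀ i, G.edge i ∈ {e | ∃ k ∈ K, G.edge k = e} → i ∈ K := by
      rintro i ⟨k, hk, hki⟩
      exact hK.mem_of_edge_eq hσ hG.1.1 hmax hk hki.symm
    -- The edges met by `K` have all their incidences in `K`, so they induce a circle-covered part,
    -- which is everything by flower minimality.
    have hall : ∀ i, i ∈ K := by
      have := hG.2 {e | ∃ k ∈ K, G.edge k = e}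
        (edgeInduced_isCircleCovered (fun i j hi hj _ => ?_) ?_)
      · intro i
        have h : i ∈ (Sub.whole G).incs := trivial
        rw [← this] at h
        exact hin i h
      · obtain ⟨D, h1, h2, h3⟩ := hK.circle i (hin i hi) j (hin j hj)
        exact ⟨D, h1, h2, fun k hk => ⟨k, h3 hk, rfl⟩⟩
      · obtain ⟨D, -, -, h3⟩ := hK.circle k₀ hk₀ k₀ hk₀
        exact ⟨D, fun k hk => ⟨k, h3 hk, rfl⟩⟩
    refine ⟨⟨C.e 0⟩, hG.1.1.conn C (hG.exists_inc_vert C) (hG.exists_inc_edge C), fun v => ?_⟩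
    obtain ⟨i, hi⟩ := hG.exists_inc_vert C v
    obtain ⟨D, hiD, -⟩ := hG.1.1.exists_circle C i i
    obtain ⟨j, -, hji, hj⟩ := D.isEven_supp.exists_vert hiD
    refine ⟨i, j, hji.symm, fun k => ⟨fun hk => ?_, ?_⟩⟩
    · rcases hK.vert_le_two i (hall i) j (hall j) k (hall k) hj.symm (hi.trans hk.symm)
        with h | h | h
      · exact absurd h.symm hji
      · exact Or.inl h.symm
      · exact Or.inr h.symm
    · rintro (rfl | rfl)
      · exact hi
      · exact hj.trans hi
  · exact hzero.isGood

end IncHypergraph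

namespace IncHypergraph

variable {G : IncHypergraph.{u}}

/-! ### Balanced hypercircles are connected and have degree two -/

theorem IsGood.of_iso {H : IncHypergraph.{u}} (hG : G.IsGood) (φ : Iso G H) : H.IsGood := by
  refine ⟨hG.nonempty.map φ.onE, fun a b p hp hpa => ?_, fun v => ?_⟩
  · have h : ∀ x : H.V ⊕ H.E, Sum.map φ.onV φ.onE (Sum.map φ.onV.symm φ.onE.symm x) = x := by
      rintro (v | e) <;> simp
    rw [← h a] at hpa
    rw [← h b]
    refine hG.conn _ _ (fun x => p (Sum.map φ.onV φ.onE x)) (fun i _ => ?_) hpa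
    have := hp (φ.onI i) trivial
    rwa [φ.vert_onI, φ.edge_onI] at this
  · obtain ⟨i, j, hij, h⟩ := hG.bivalent (φ.onV.symm v)
    refine ⟨φ.onI i, φ.onI j, fun h' => hij (φ.onI.injective h'), fun k => ?_⟩
    have h1 := φ.vert_onI (φ.onI.symm k)
    rw [Equiv.apply_symm_apply] at h1
    rw [h1, ← Equiv.eq_symm_apply, h, Equiv.symm_apply_eq, Equiv.symm_apply_eq]

theorem EvenBalanced.of_iso {H : IncHypergraph.{u}} {σ : H.I → ℤˣ} (hσ : EvenBalanced σ)
    (φ : Iso G H) : EvenBalanced (fun i => σ (φ.onI i)) := by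
  intro S hS
  have := hσ _ (hS.map φ.onV φ.onE φ.onI φ.onI.injective φ.vert_onI φ.edge_onI)
  rwa [Finset.sum_map] at this

/-! ### Degree two in contracted thorn-connections -/

section ThornConnection

variable {Ps As : Set G.Sub}

theorem Sub.verts_of_inter_eq_single {H K : G.Sub} {w v : G.V} (h : H.inter K = Sub.single w)
    (hH : v ∈ H.verts) (hK : v ∈ K.verts) : v = w := by
  have : v ∈ (H.inter K).verts := ⟨hH, hK⟩
  rw [h] at this
  exact this

theorem Sub.inter_ne_empty {H K : G.Sub} {v : G.V} (hH : v ∈ H.verts) (hK : v ∈ K.verts) :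
    H.inter K ≠ Sub.empty G := by
  intro h
  have : v ∈ (H.inter K).verts := ⟨hH, hK⟩
  rw [h] at this
  exact this

/-- Distinct pseudo-flowers meet only in vertices of arteries. Off the arteries, a vertex of `P`
therefore has all its incidences in `P`. -/
theorem IsThornConnection.mem_incs (hG : G.IsThornConnection Ps As) {P : G.Sub} (hP : P ∈ Ps)
    {i : G.I} (hiP : G.vert i ∈ P.verts) (hiA : ¬ ∃ A ∈ As, G.vert i ∈ A.verts) : i ∈ P.incs := by
  obtain ⟨K, hK | hK, hiK⟩ := hG.arterial.cover_I i
  · by_contra hi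
    have hne : P ≠ K := fun h => hi (h ▸ hiK)
    have hiK' := K.vert_mem i hiK
    obtain ⟨w, hw, hwA⟩ := hG.arterial.meet_in_artery P hP K hK hne (Sub.inter_ne_empty hiP hiK')
    exact hiA ⟨_, hwA, Sub.verts_of_inter_eq_single hw hiP hiK'⟩
  · exact absurd ⟨K, hK, K.vert_mem i hiK⟩ hiA

theorem IsThornConnection.isThorn (hG : G.IsThornConnection Ps As) {P : G.Sub} (hP : P ∈ Ps)
    (v : P.toHypergraph.V) (hv : ∃ A ∈ As, v.1 ∈ A.verts) : P.toHypergraph.IsThorn v := by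
  obtain ⟨A, hA, hvA⟩ := hv
  obtain ⟨t, ht, hthorn⟩ := hG.meet_thorn P hP A hA (Sub.inter_ne_empty v.2 hvA)
  have : v = t := Subtype.ext (Sub.verts_of_inter_eq_single ht v.2 hvA)
  rwa [this]

/-- Every surviving vertex belongs to the flower of a single pseudo-flower with all its incidences,
so its degree can be read off in that balanced flower. -/
theorem IsThornConnection.contract_isGood (hG : G.IsThornConnection Ps As) (hfl : G.IsFloral)
    {S : Set G.V} (hS : ∀ v, v ∈ S ↔ ∃ A ∈ As, v ∈ A.verts)
    {σ : (G.contractVerts S).I → ℤˣ} (hσ : EvenBalanced σ) : (G.contractVerts S).IsGood := by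
  refine ⟨?_, ?_, ?_⟩
  · obtain ⟨P, hP⟩ := hG.nonempty
    obtain ⟨⟨v, -, i, -⟩, -⟩ := hG.pseudoFlower P hP
    exact ⟨Quot.mk _ (G.edge i.1)⟩
  · intro a b p hp hpa
    -- A contracted vertex takes its value from any edge at it, since all these edges become one
    -- class.
    set q : G.V ⊕ G.E → Prop := Sum.elim
      (fun v => (∃ h : v ∈ Sᶜ, p (Sum.inl ⟨v, h⟩)) ∨
        (v ∈ S ∧ ∃ i, G.vert i = v ∧ p (Sum.inr (Quot.mk _ (G.edge i)))))
      (fun e => p (Sum.inr (Quot.mk _ e))) with hq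
    have hclosed : ∀ i ∈ (Set.univ : Set G.I), q (Sum.inl (G.vert i)) ↔ q (Sum.inr (G.edge i)) := by
      intro i _
      simp only [hq, Sum.elim_inl, Sum.elim_inr]
      by_cases hi : G.vert i ∈ S
      · constructor
        · rintro (⟨h, -⟩ | ⟨-, j, hj, hpj⟩)
          · exact absurd hi h
          · rwa [Quot.sound ⟨i, j, hi, hj.symm, rfl, rfl⟩]
        · exact fun h => Or.inr ⟨hi, i, rfl, h⟩
      · have := hp ⟨i, hi⟩ trivial
        constructor
        · rintro (⟨h, hpv⟩ | ⟨h, -⟩)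
          · exact this.1 hpv
          · exact absurd h hi
        · exact fun h => Or.inl ⟨hi, this.2 h⟩
    have hlift : ∀ x, ∃ y, p x ↔ q y := by
      rintro (⟨v, hv⟩ | e)
      · refine ⟨Sum.inl v, fun h => Or.inl ⟨hv, h⟩, ?_⟩
        rintro (⟨h, hpv⟩ | ⟨h, -⟩)
        · exact hpv
        · exact absurd h hv
      · obtain ⟨e, rfl⟩ := Quot.exists_rep e
        exact ⟨Sum.inr e, Iff.rfl⟩
    obtain ⟨y, hy⟩ := hlift a
    obtain ⟨z, hz⟩ := hlift b
    exact hz.2 (isConnected_iff.1 hG.arterial.connected y z q hclosed (hy.1 hpa))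
  · rintro ⟨v, hv⟩
    obtain ⟨P, hP | hP, hvP⟩ := hG.arterial.cover_V v
    swap
    · exact absurd ((hS v).2 ⟨P, hP, hvP⟩) hv
    have hnt : ∀ w : P.toHypergraph.V, ¬ P.toHypergraph.IsThorn w → w.1 ∉ S :=
      fun w hw hwS => hw (hG.isThorn hP w ((hS _).1 hwS))
    -- A thorn outside the arteries would have degree one in the whole hypergraph, contrary to the
    -- floral condition.
    have hthorn : ¬ P.toHypergraph.IsThorn ⟨v, hvP⟩ := by
      rintro ⟨hdeg, -⟩
      obtain ⟨i, hi⟩ := degree_eq_one_iff.1 hdeg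
      refine hfl v (degree_eq_one_iff.2 ⟨i.1, fun k => ⟨fun hk => ?_, ?_⟩⟩)
      · have hkP : k ∈ P.incs := hG.mem_incs hP (hk ▸ hvP) (fun h => hv (hk ▸ (hS _).2 h))
        exact congrArg Subtype.val ((hi ⟨k, hkP⟩).1 (Subtype.ext hk))
      · rintro rfl
        exact congrArg Subtype.val ((hi i).2 rfl)
    have hflower := (hG.pseudoFlower P hP).2
    set F := (P.toHypergraph.deleteVerts {v | P.toHypergraph.IsThorn v}).toHypergraph
    let fI : F.I → (G.contractVerts S).I := fun i => ⟨i.1.1, hnt _ i.2⟩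
    let fV : F.V → (G.contractVerts S).V := fun v => ⟨v.1.1, hnt _ v.2⟩
    have hfI : Function.Injective fI := fun i j h =>
      have h' : i.1.1 = j.1.1 := congrArg (fun x : {i : G.I // G.vert i ∉ S} => x.1) h
      Subtype.ext (Subtype.ext h')
    -- The flower inherits balance from the contraction: even sets stay even when edges are merged,
    -- as long as incidences stay distinct.
    have hF : F.IsGood := hflower.isGood (σ := fun i => σ (fI i)) <| by
      intro K hK
      have := hσ _ (hK.map fV (fun e => Quot.mk _ e.1.1) fI hfI
        (fun _ => rfl) (fun _ => rfl))
      rwa [Finset.sum_map] at this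
    obtain ⟨i, j, hij, h⟩ := hF.bivalent ⟨⟨v, hvP⟩, hthorn⟩
    refine ⟨fI i, fI j, fun h => hij (hfI h), fun k => ⟨fun hk => ?_, ?_⟩⟩
    · have hkv : G.vert k.1 = v := congrArg Subtype.val hk
      have hkP : k.1 ∈ P.incs := hG.mem_incs hP (hkv ▸ hvP) (fun h => k.2 ((hS _).2 h))
      have hke : P.toHypergraph.vert ⟨k.1, hkP⟩ = ⟨v, hvP⟩ := Subtype.ext hkv
      have hkF : (⟨k.1, hkP⟩ : P.toHypergraph.I) ∈
          (P.toHypergraph.deleteVerts {v | P.toHypergraph.IsThorn v}).incs := by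
        change ¬ P.toHypergraph.IsThorn _
        rwa [hke]
      rcases (h ⟨⟨k.1, hkP⟩, hkF⟩).1 (Subtype.ext hke) with h' | h'
      · exact Or.inl (by rw [← h']; rfl)
      · exact Or.inr (by rw [← h']; rfl)
    · have hval : ∀ m, F.vert m = ⟨⟨v, hvP⟩, hthorn⟩ →
          (G.contractVerts S).vert (fI m) = ⟨v, hv⟩ := by
        intro m hm
        exact Subtype.ext (congrArg (fun x => x.1.1) hm)
      rintro (rfl | rfl)
      · exact hval _ ((h i).2 (Or.inl rfl))
      · exact hval _ ((h j).2 (Or.inr rfl))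

end ThornConnection

theorem IsHypercircle.isGood (hG : G.IsHypercircle) {σ : G.I → ℤˣ} (hσ : EvenBalanced σ) :
    G.IsGood := by
  obtain h | h | ⟨T, Ps, As, hT, hfl, ⟨φ⟩⟩ := hG
  · exact h.isGood
  · exact h.isGood hσ
  · exact (hT.contract_isGood hfl (fun _ => Iff.rfl) (hσ.of_iso φ)).of_iso φ

end IncHypergraph

namespace OrientedHypergraph

open IncHypergraph

variable {G : OrientedHypergraph.{u}}

/-! ### Subdivisions -/

theorem subdivide_isGood (hG : G.toIncHypergraph.IsGood) (e : G.E) (B : Set G.I) (s t : ℤˣ) :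
    (G.subdivide e B s t).toIncHypergraph.IsGood := by
  classical
  set D := (G.subdivide e B s t).toIncHypergraph with hD
  refine ⟨⟨(none : Option G.E)⟩, ?_, ?_⟩
  · have hmain : ∀ a b : D.V ⊕ D.E, ∀ p : D.V ⊕ D.E → Prop,
        (∀ i ∈ (Set.univ : Set D.I), p (Sum.inl (D.vert i)) ↔ p (Sum.inr (D.edge i))) →
          p a → p b := by
      intro a b p hp hpa
      have h0 : p (Sum.inl (none : Option G.V)) ↔ p (Sum.inr (some e : Option G.E)) :=
        hp (Sum.inr false : G.I ⊕ Bool) trivial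
      have h1 : p (Sum.inl (none : Option G.V)) ↔ p (Sum.inr (none : Option G.E)) :=
        hp (Sum.inr true : G.I ⊕ Bool) trivial
      have hclosed : ∀ i ∈ (Set.univ : Set G.I),
          p (Sum.inl (some (G.vert i) : Option G.V)) ↔
            p (Sum.inr (some (G.edge i) : Option G.E)) := by
        intro i _
        have h2 : p (Sum.inl (some (G.vert i) : Option G.V)) ↔
            p (Sum.inr (if G.edge i = e ∧ i ∈ B then none else some (G.edge i) : Option G.E)) :=
          hp (Sum.inl i : G.I ⊕ Bool) trivial
        by_cases h : G.edge i = e ∧ i ∈ B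
        · rw [if_pos h] at h2
          rw [h2, h.1, ← h0, h1]
        · rwa [if_neg h] at h2
      have hlift : ∀ x : D.V ⊕ D.E, ∃ y : G.V ⊕ G.E, p x ↔ p (Sum.map some some y) := by
        rintro ((_ | v) | (_ | f))
        · exact ⟨Sum.inr e, h0⟩
        · exact ⟨Sum.inl v, Iff.rfl⟩
        · exact ⟨Sum.inr e, h1.symm.trans h0⟩
        · exact ⟨Sum.inr f, Iff.rfl⟩
      obtain ⟨y, hy⟩ := hlift a
      obtain ⟨z, hz⟩ := hlift b
      exact hz.2 (hG.conn y z (fun x => p (Sum.map some some x)) hclosed (hy.1 hpa))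
    exact hmain
  · have hmain : ∀ v : Option G.V, ∃ i j : G.I ⊕ Bool, i ≠ j ∧
        ∀ k : G.I ⊕ Bool, Sum.elim (fun i => some (G.vert i)) (fun _ => none) k = v ↔
          k = i ∨ k = j := by
      rintro (_ | v)
      · exact ⟨Sum.inr false, Sum.inr true, by simp, by rintro (k | (_ | _)) <;> simp⟩
      · obtain ⟨i, j, hij, h⟩ := hG.bivalent v
        exact ⟨Sum.inl i, Sum.inl j, by simpa using hij, by rintro (k | k) <;> simp [h]⟩
    exact hmain

/-- A circle uses both new incidences or neither. They contribute 0 if their signs are opposite, and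
are not used at all otherwise; the old incidences of the circle form an even set before the
subdivision. -/
theorem subdivide_isBalanced (hG : G.IsBalanced) {e : G.E} {B : Set G.I} {s t : ℤˣ}
    (hst : s * t = -1 ∨ (s * t = 1 ∧
      ∀ C : (G.subdivide e B s t).toIncHypergraph.Circle, (none : Option G.V) ∉ C.verts)) :
    (G.subdivide e B s t).IsBalanced := by
  classical
  rw [isBalanced_iff] at hG ⊢
  refine evenBalanced_of_circles fun C => ?_
  obtain ⟨S, hS⟩ : ∃ S : Finset (G.I ⊕ Bool), S = C.supp := ⟨_, rfl⟩
  have hsplit : ∀ {M : Type} [AddCommMonoid M] (f : G.I ⊕ Bool → M),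
      ∑ i ∈ S, f i = ∑ i ∈ S.toLeft, f (Sum.inl i) + ∑ b ∈ S.toRight, f (Sum.inr b) := by
    intro M _ f
    conv_lhs => rw [← Finset.toLeft_disjSum_toRight (u := S)]
    rw [Finset.sum_disjSum]
  have hleft : IsEven (G := G.toIncHypergraph) S.toLeft := by
    intro h
    -- The new vertex and both halves receive the value at `e`, so the new incidences drop out of
    -- the end sum.
    let fV : Option G.V → ZMod 2 := fun v => v.elim (h (Sum.inr e)) (fun v => h (Sum.inl v))
    let fE : Option G.E → ZMod 2 := fun f => f.elim (h (Sum.inr e)) (fun f => h (Sum.inr f))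
    have h1 : ∑ k ∈ S,
        (fV (Sum.elim (fun i => some (G.vert i)) (fun _ => none) k) +
          fE (Sum.elim (fun i => if G.edge i = e ∧ i ∈ B then none else some (G.edge i))
            (fun b => if b then none else some e) k)) = 0 := by
      rw [hS]
      exact C.isEven_supp (fun x : Option G.V ⊕ Option G.E => Sum.elim fV fE x)
    rw [hsplit, Finset.sum_eq_zero (s := S.toRight), add_zero] at h1
    · refine Eq.trans (Finset.sum_congr rfl fun i _ => ?_) h1
      by_cases hi : G.edge i = e ∧ i ∈ B
      · simp [fV, fE, hi]
      · simp [fV, fE, hi]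
    · rintro (_ | _) _ <;> simp [fV, fE, CharTwo.add_self_eq_zero]
  have hright : ∑ b ∈ S.toRight, ((if b then t else s : ℤˣ) : ℤ) = 0 := by
    have hiff : false ∈ S.toRight ↔ true ∈ S.toRight := by
      rw [Finset.mem_toRight, Finset.mem_toRight, hS]
      have hne : (Sum.inr false : G.I ⊕ Bool) ≠ Sum.inr true := by simp
      have : ∀ k : G.I ⊕ Bool, Sum.elim (fun i => some (G.vert i)) (fun _ => none) k = none ↔
          k = Sum.inr false ∨ k = Sum.inr true := by
        rintro (k | (_ | _)) <;> simp
      exact mem_iff_mem_of_even (G := (G.subdivide e B s t).toIncHypergraph)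
        (v := (none : Option G.V)) hne this (C.isEven_supp.card_vert _)
    by_cases hf : false ∈ S.toRight
    · have hu : S.toRight = {false, true} := by
        ext b
        cases b
        · simpa using hf
        · simpa using hiff.1 hf
      rcases hst with hst | ⟨-, hst⟩
      · rw [hu, Finset.sum_pair (by simp)]
        rcases Int.units_eq_one_or s with rfl | rfl <;>
          rcases Int.units_eq_one_or t with rfl | rfl <;> simp_all
      · have hmem : (Sum.inr false : G.I ⊕ Bool) ∈ S := Finset.mem_toRight.1 hf
        rw [hS] at hmem
        exact absurd (C.mem_verts_iff.2 ⟨_, hmem, rfl⟩) (hst C)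
    · rw [Finset.sum_eq_zero]
      rintro (_ | _) hb
      · exact absurd hb hf
      · exact absurd (hiff.2 hb) hf
  have hsum := hsplit (fun i => ((Sum.elim G.σ (fun b => if b then t else s) i : ℤˣ) : ℤ))
  simp only [Sum.elim_inl, Sum.elim_inr] at hsum
  rw [hright, add_zero] at hsum
  have h4 := hG _ hleft
  rw [← hsum, hS] at h4
  exact h4

theorem IsBalanced.of_iso {H : OrientedHypergraph.{u}} (hG : G.IsBalanced) (φ : Iso G H) :
    H.IsBalanced := by
  rw [isBalanced_iff] at hG ⊢
  intro S hS
  have hv : ∀ i, G.vert (φ.onI.symm i) = φ.onV.symm (H.vert i) := by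
    intro i
    rw [Equiv.eq_symm_apply, ← φ.vert_onI, Equiv.apply_symm_apply]
  have he : ∀ i, G.edge (φ.onI.symm i) = φ.onE.symm (H.edge i) := by
    intro i
    rw [Equiv.eq_symm_apply, ← φ.edge_onI, Equiv.apply_symm_apply]
  have := hG _ (hS.map φ.onV.symm φ.onE.symm φ.onI.symm φ.onI.symm.injective hv he)
  rw [Finset.sum_map] at this
  convert this using 2 with i
  rw [← φ.σ_onI]
  simp

theorem IsBalancedSubdivision.isGood_and_isBalanced {H : OrientedHypergraph.{u}}
    (h : G.IsBalancedSubdivision H) (hG : G.toIncHypergraph.IsGood) (hb : G.IsBalanced) :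
    H.toIncHypergraph.IsGood ∧ H.IsBalanced := by
  induction h with
  | refl => exact ⟨hG, hb⟩
  | tail _ hstep ih =>
    obtain ⟨e, B, s, t, ⟨φ⟩, hst⟩ := hstep
    exact ⟨(subdivide_isGood ih.1 e B s t).of_iso φ.toIso, (subdivide_isBalanced ih.2 hst).of_iso φ⟩

end OrientedHypergraph

namespace IncHypergraph

variable {G : IncHypergraph.{u}}

/-! ### Connected hypergraphs of degree two whose vertices lie in circles -/

/-- A circle through a vertex of degree two uses both of its incidences. So a circle-covered edge
set crosses every vertex that it meets, and connectivity makes it all of the edges. -/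
theorem IsGood.isFlower (hG : G.IsGood) (h : G.IsInseparable) (C : G.Circle) : G.IsFlower := by
  refine ⟨⟨h, Or.inl ⟨C⟩⟩, fun F hF => ?_⟩
  obtain ⟨f, hf⟩ : ∃ f, f ∈ F := by
    obtain ⟨⟨D⟩⟩ | ⟨-, e, -⟩ := hF.2
    · exact ⟨_, (D.e 0).2⟩
    · exact ⟨_, e.2⟩
  have hall : ∀ e, e ∈ F := by
    intro e
    refine hG.conn (Sum.inr f) (Sum.inr e)
      (Sum.elim (fun v => ∃ i, G.vert i = v ∧ G.edge i ∈ F) (fun e => e ∈ F))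
      (fun i _ => ⟨?_, fun h => ⟨i, rfl, h⟩⟩) hf
    rintro ⟨j, hj, hjF⟩
    by_contra hi
    have hij : i ≠ j := fun h => hi (h ▸ hjF)
    obtain ⟨l, hil, hl⟩ := (hG.bivalent _).exists_pair hj
    obtain rfl : i = l := ((hl i).1 rfl).resolve_left hij
    obtain ⟨⟨D⟩⟩ | ⟨hV, -⟩ := hF.2
    · obtain ⟨D', hD', -⟩ := hF.1.exists_circle D ⟨j, hjF⟩ ⟨j, hjF⟩
      obtain ⟨k, -, hkj, hk⟩ := D'.isEven_supp.exists_vert hD'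
      rcases (hl k.1).1 ((congrArg Subtype.val hk).trans hj) with h' | h'
      · exact hkj (Subtype.ext h')
      · exact hi (h' ▸ k.2)
    · exact hV.elim ⟨G.vert j, j, rfl, hjF⟩
  refine Sub.ext ?_ ?_ ?_
  · refine Set.eq_univ_of_forall fun v => ?_
    obtain ⟨i, hi⟩ := (hG.bivalent v).exists_inc
    exact ⟨i, hi, hall _⟩
  · exact Set.eq_univ_of_forall hall
  · exact Set.eq_univ_of_forall fun i => hall _

theorem Circle.mem_supp_of_vert (C : G.Circle) {v : G.V} (hv : G.IsBivalent v) (hC : v ∈ C.verts)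
    {i : G.I} (hi : G.vert i = v) : i ∈ C.supp := by
  obtain ⟨j, hj, hjv⟩ := C.mem_verts_iff.1 hC
  obtain ⟨k, hik, h⟩ := hv.exists_pair hi
  rcases (h j).1 hjv with rfl | rfl
  · exact hj
  · exact (mem_iff_mem_of_even hik h (C.isEven_supp.card_vert v)).2 hj

theorem IsGood.exists_inc_edge (hG : G.IsGood) (v : G.V) (e : G.E) : ∃ i, G.edge i = e := by
  by_contra! h
  have := hG.conn (Sum.inr e) (Sum.inl v) (fun x => x = Sum.inr e) (fun i _ => by simp [h i]) rfl
  exact Sum.inl_ne_inr this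

/-- Lying in a common circle is an equivalence relation on vertices. -/
def blockSetoid (hG : G.IsGood) (hC : ∀ v, ∃ C : G.Circle, v ∈ C.verts) : Setoid G.V where
  r v w := ∃ C : G.Circle, v ∈ C.verts ∧ w ∈ C.verts
  iseqv := by
    refine ⟨fun v => ?_, ?_, ?_⟩
    · obtain ⟨C, h⟩ := hC v
      exact ⟨C, h, h⟩
    · rintro v w ⟨C, h1, h2⟩
      exact ⟨C, h2, h1⟩
    · rintro v w x ⟨C, h1, h2⟩ ⟨D, h3, h4⟩
      obtain ⟨i, hi, hiv⟩ := C.mem_verts_iff.1 h1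
      obtain ⟨j, hj, hjw⟩ := C.mem_verts_iff.1 h2
      obtain ⟨k, hk, hkx⟩ := D.mem_verts_iff.1 h4
      -- Transitivity needs a common incidence, not just a common vertex; degree two provides it at
      -- `w`.
      obtain ⟨B, hiB, hkB, -⟩ := exists_circle_trans hi hk
        ⟨j, Finset.mem_inter.2 ⟨hj, D.mem_supp_of_vert (hG.bivalent w) h3 hjw⟩⟩
      exact ⟨B, B.mem_verts_iff.2 ⟨i, hiB, hiv⟩, B.mem_verts_iff.2 ⟨k, hkB, hkx⟩⟩

/-- The pairs of an edge and a class of vertices that it meets. -/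
def Attachment (r : Setoid G.V) : Type u :=
  {q : G.E × Quotient r // ∃ i, G.edge i = q.1 ∧ Quotient.mk r (G.vert i) = q.2}

instance (r : Setoid G.V) : Finite (Attachment r) :=
  inferInstanceAs (Finite {_q : G.E × Quotient r // _})

/-- The edge `e` meets at least two classes. -/
def IsCutEdge (r : Setoid G.V) (e : G.E) : Prop :=
  ∃ i j, G.edge i = e ∧ G.edge j = e ∧ Quotient.mk r (G.vert i) ≠ Quotient.mk r (G.vert j)

/-- The attachments at edges that meet at least two classes. -/
def ThornIndex (r : Setoid G.V) : Type u := {q : Attachment r // IsCutEdge r q.1.1}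

instance (r : Setoid G.V) : Finite (ThornIndex r) :=
  inferInstanceAs (Finite {_q : Attachment r // _})

/-- The attachment of an incidence. -/
def attach (r : Setoid G.V) (i : G.I) : Attachment r :=
  ⟨(G.edge i, Quotient.mk r (G.vert i)), i, rfl, rfl⟩

/-- Every edge is split into one edge for each class that it meets. If there are at least two of
them, they are joined, through one new vertex for each class, by a further edge. -/
def explode (G : IncHypergraph.{u}) (r : Setoid G.V) : IncHypergraph.{u} where
  V := G.V ⊕ ThornIndex r
  E := Attachment r ⊕ {e // IsCutEdge r e}
  I := G.I ⊕ (ThornIndex r × Bool)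
  vert := Sum.elim (fun i => Sum.inl (G.vert i)) (fun x => Sum.inr x.1)
  edge := Sum.elim (fun i => Sum.inl (attach r i))
    (fun x => if x.2 then Sum.inl x.1.1 else Sum.inr ⟨x.1.1.1.1, x.1.2⟩)
  finite_V := inferInstance
  finite_E := inferInstance
  finite_I := inferInstance

/-- The part of the exploded hypergraph that belongs to the class `B`. -/
def petal (r : Setoid G.V) (B : Quotient r) : (G.explode r).Sub where
  verts := {x | Sum.elim (fun v => Quotient.mk r v = B) (fun q : ThornIndex r => q.1.1.2 = B) x}
  edges := {x | Sum.elim (fun q : Attachment r => q.1.2 = B) (fun _ => False) x}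
  incs := {x | Sum.elim (fun i => Quotient.mk r (G.vert i) = B)
    (fun x : ThornIndex r × Bool => x.2 = true ∧ x.1.1.1.2 = B) x}
  vert_mem := by
    rintro (i | ⟨q, b⟩) h
    · exact h
    · exact h.2
  edge_mem := by
    rintro (i | ⟨q, b⟩) h
    · exact h
    · obtain ⟨rfl, h⟩ := h
      exact h

/-- The star that joins the pieces of the edge `e` of the exploded hypergraph. -/
def star (r : Setoid G.V) (e : G.E) : (G.explode r).Sub where
  verts := {x | Sum.elim (fun _ => False) (fun q : ThornIndex r => q.1.1.1 = e) x}
  edges := {x | Sum.elim (fun _ => False) (fun f : {e // IsCutEdge r e} => f.1 = e) x}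
  incs := {x | Sum.elim (fun _ => False)
    (fun x : ThornIndex r × Bool => x.2 = false ∧ x.1.1.1.1 = e) x}
  vert_mem := by
    rintro (i | ⟨q, b⟩) h
    · exact h
    · exact h.2
  edge_mem := by
    rintro (i | ⟨q, b⟩) h
    · exact h
    · obtain ⟨rfl, h⟩ := h
      exact h

/-- All vertices of a star are leaves, which excludes circles. Its edge has size at least two
because the original edge meets two classes. -/
theorem star_isArtery (r : Setoid G.V) {e : G.E} (he : IsCutEdge r e) :
    (star r e).toHypergraph.IsArtery := by
  have hone : ∀ v : (star r e).toHypergraph.V,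
      ∃ i, ∀ k, (star r e).toHypergraph.vert k = v ↔ k = i := by
    rintro ⟨v | q, hv⟩
    · exact hv.elim
    · refine ⟨⟨Sum.inr (q, false), rfl, hv⟩, ?_⟩
      rintro ⟨i | ⟨q', _ | _⟩, hk⟩
      · exact hk.elim
      · refine ⟨fun h => ?_, ?_⟩
        · obtain rfl : q' = q := Sum.inr_injective (congrArg Subtype.val h)
          rfl
        · intro h
          have : q' = q := congrArg Prod.fst (Sum.inr_injective (congrArg Subtype.val h))
          subst this
          rfl
      · exact absurd hk.1 Bool.false_ne_true.symm
  have hedge : ∀ f : (star r e).toHypergraph.E, f = ⟨Sum.inr ⟨e, he⟩, rfl⟩ := by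
    rintro ⟨f | ⟨f, hf⟩, hfe⟩
    · exact hfe.elim
    · obtain rfl : f = e := hfe
      rfl
  refine Or.inl ⟨?_, ⟨fun C => ?_⟩, fun f => ?_, fun v => Or.inl (degree_eq_one_iff.2 (hone v))⟩
  · rw [isConnected_iff]
    have hto : ∀ a, Conn (Set.univ : Set (star r e).toHypergraph.I) a
        (Sum.inr ⟨Sum.inr ⟨e, he⟩, rfl⟩) := by
      rintro (v | f)
      · obtain ⟨i, hi⟩ := hone v
        have := Conn.of_mem (T := (Set.univ : Set (star r e).toHypergraph.I)) (Set.mem_univ i)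
        rwa [(hi i).2 rfl, hedge ((star r e).toHypergraph.edge i)] at this
      · rw [hedge f]
        exact Conn.refl _ _
    exact fun a b => (hto a).trans (hto b).symm
  · obtain ⟨j, -, hj, hv⟩ := C.isEven_supp.exists_vert (C.out_mem 0)
    obtain ⟨i, hi⟩ := hone ((star r e).toHypergraph.vert (C.out 0))
    exact hj (((hi _).1 hv).trans ((hi _).1 rfl).symm)
  · intro hf
    obtain ⟨i, j, hi, hj, hij⟩ := he
    rw [size, Nat.card_eq_one_iff_exists] at hf
    obtain ⟨x, hx⟩ := hf
    have hq : ∀ k, (hk : G.edge k = e) →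
        ∃ y : {i : (star r e).toHypergraph.I // (star r e).toHypergraph.edge i = f},
          y.1.1 = Sum.inr (⟨attach r k, ⟨i, j, hi.trans hk.symm, hj.trans hk.symm, hij⟩⟩, false) :=
      fun k hk => ⟨⟨⟨Sum.inr (⟨attach r k, ⟨i, j, hi.trans hk.symm, hj.trans hk.symm, hij⟩⟩, false),
        rfl, hk⟩, (hedge _).trans (hedge f).symm⟩, rfl⟩
    obtain ⟨y, hy⟩ := hq i hi
    obtain ⟨z, hz⟩ := hq j hj
    rw [hx y] at hy
    rw [hx z, hy] at hz
    have h1 := congrArg Prod.fst (Sum.inr_injective hz)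
    have h2 : attach r i = attach r j := congrArg Subtype.val h1
    exact hij (congrArg (fun q => q.1.2) h2)

/-- A circle staying in one class passes through each of its edges within a single piece of that
edge, so cutting edges leaves it intact. -/
theorem petal_exists_circle (r : Setoid G.V) (B : Quotient r) (C : G.Circle)
    (hC : ∀ k ∈ C.supp, Quotient.mk r (G.vert k) = B) :
    ∃ D : (petal r B).toHypergraph.Circle, ∀ x, x ∈ D.supp ↔ ∃ i ∈ C.supp, x.1 = Sum.inl i := by
  have ho : ∀ t, attach r (C.out t) = ⟨(C.e t, B), C.out t, C.edge_out t, hC _ (C.out_mem t)⟩ :=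
    fun t => Subtype.ext (Prod.ext (C.edge_out t) (hC _ (C.out_mem t)))
  have hr : ∀ t, attach r (C.ret t) = ⟨(C.e t, B), C.out t, C.edge_out t, hC _ (C.out_mem t)⟩ :=
    fun t => Subtype.ext (Prod.ext (C.edge_ret t) (hC _ (C.ret_mem t)))
  let D : (G.explode r).Circle := ⟨C.n, fun t => Sum.inl (C.v t),
    fun t => Sum.inl ⟨(C.e t, B), C.out t, C.edge_out t, hC _ (C.out_mem t)⟩,
    fun t => Sum.inl (C.out t), fun t => Sum.inl (C.ret t),
    fun t => congrArg Sum.inl (C.vert_out t), fun t => congrArg Sum.inl (ho t),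
    fun t => congrArg Sum.inl (hr t), fun t => congrArg Sum.inl (C.vert_ret t),
    fun s t h => C.v_injective (Sum.inl_injective h),
    fun s t h => C.e_injective (congrArg (fun q : Attachment r => q.1.1) (Sum.inl_injective h)),
    fun s t h => C.out_injective (Sum.inl_injective h),
    fun s t h => C.ret_injective (Sum.inl_injective h),
    fun s t h => C.out_ne_ret s t (Sum.inl_injective h)⟩
  have hD : ∀ x, x ∈ D.incs ↔ ∃ i ∈ C.supp, x = Sum.inl i := by
    intro x
    constructor
    · rintro (⟨t, rfl⟩ | ⟨t, rfl⟩)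
      · exact ⟨_, C.out_mem t, rfl⟩
      · exact ⟨_, C.ret_mem t, rfl⟩
    · rintro ⟨i, hi, rfl⟩
      rcases Circle.mem_supp.1 hi with ⟨t, rfl⟩ | ⟨t, rfl⟩
      · exact Or.inl ⟨t, rfl⟩
      · exact Or.inr ⟨t, rfl⟩
  obtain ⟨D', -, hD'⟩ := (petal r B).exists_circle D (fun x hx => by
    obtain ⟨i, hi, rfl⟩ := (hD x).1 hx
    exact hC i hi)
  exact ⟨D', fun x => Circle.mem_supp.trans ((hD' x).trans (hD x.1))⟩

/-! ### Petals and stars as a floral thorn-connection -/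

section Block

variable {r : Setoid G.V}

theorem exists_block_circle (hG : G.IsGood)
    (hr : ∀ v w, Quotient.mk r v = Quotient.mk r w ↔ ∃ C : G.Circle, v ∈ C.verts ∧ w ∈ C.verts)
    {i j : G.I} (hij : Quotient.mk r (G.vert i) = Quotient.mk r (G.vert j)) :
    ∃ C : G.Circle, i ∈ C.supp ∧ j ∈ C.supp ∧
      ∀ k ∈ C.supp, Quotient.mk r (G.vert k) = Quotient.mk r (G.vert i) := by
  obtain ⟨C, h1, h2⟩ := (hr _ _).1 hij
  exact ⟨C, C.mem_supp_of_vert (hG.bivalent _) h1 rfl, C.mem_supp_of_vert (hG.bivalent _) h2 rfl,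
    fun k hk => (hr _ _).2 ⟨C, C.mem_verts_iff.2 ⟨k, hk, rfl⟩, h1⟩⟩

theorem petal_bivalent (hG : G.IsGood) {B : Quotient r} (v : G.V) (hv : Quotient.mk r v = B) :
    (petal r B).toHypergraph.IsBivalent ⟨Sum.inl v, hv⟩ := by
  obtain ⟨i, j, hij, h⟩ := hG.bivalent v
  have hi := (h i).2 (Or.inl rfl)
  have hj := (h j).2 (Or.inr rfl)
  refine ⟨⟨Sum.inl i, (congrArg (Quotient.mk r) hi).trans hv⟩,
    ⟨Sum.inl j, (congrArg (Quotient.mk r) hj).trans hv⟩,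
    fun h => hij (Sum.inl_injective (congrArg Subtype.val h)), ?_⟩
  rintro ⟨k | ⟨q, b⟩, hk⟩
  · constructor
    · intro hkv
      rcases (h k).1 (Sum.inl_injective (congrArg Subtype.val hkv)) with rfl | rfl
      · exact Or.inl rfl
      · exact Or.inr rfl
    · rintro (hk' | hk')
      · have : k = i := Sum.inl_injective (congrArg Subtype.val hk')
        exact Subtype.ext (congrArg Sum.inl (this ▸ hi))
      · have : k = j := Sum.inl_injective (congrArg Subtype.val hk')
        exact Subtype.ext (congrArg Sum.inl (this ▸ hj))
  · constructor
    · intro hkv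
      exact absurd (congrArg Subtype.val hkv) Sum.inr_ne_inl
    · rintro (hk' | hk')
      · exact absurd (congrArg Subtype.val hk') Sum.inr_ne_inl
      · exact absurd (congrArg Subtype.val hk') Sum.inr_ne_inl

/-- Each attachment comes from an incidence, which lies in a circle of its block. So the piece of
edge carrying the pendant vertex lies in a circle of the petal. -/
theorem petal_isThorn (hG : G.IsGood)
    (hr : ∀ v w, Quotient.mk r v = Quotient.mk r w ↔ ∃ C : G.Circle, v ∈ C.verts ∧ w ∈ C.verts)
    {B : Quotient r} (q : ThornIndex r) (hq : q.1.1.2 = B) :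
    (petal r B).toHypergraph.IsThorn ⟨Sum.inr q, hq⟩ := by
  refine ⟨degree_eq_one_iff.2 ⟨⟨Sum.inr (q, true), rfl, hq⟩, ?_⟩,
    ⟨⟨Sum.inr (q, true), rfl, hq⟩, rfl, Or.inl ?_⟩⟩
  · rintro ⟨k | ⟨q', _ | _⟩, hk⟩
    · exact ⟨fun h => absurd (congrArg Subtype.val h) Sum.inl_ne_inr,
        fun h => absurd (congrArg Subtype.val h) Sum.inl_ne_inr⟩
    · exact absurd hk.1 Bool.false_ne_true
    · constructor
      · intro h
        obtain rfl : q' = q := Sum.inr_injective (congrArg Subtype.val h)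
        rfl
      · intro h
        have : q' = q := congrArg Prod.fst (Sum.inr_injective (congrArg Subtype.val h))
        subst this
        rfl
  · obtain ⟨i, hie, hiB⟩ := q.1.2
    obtain ⟨C, hiC, -, hC⟩ := exists_block_circle hG hr (rfl : Quotient.mk r (G.vert i) = _)
    have hiB' : Quotient.mk r (G.vert i) = B := hiB.trans hq
    obtain ⟨D, hD⟩ := petal_exists_circle r B C (fun k hk => (hC k hk).trans hiB')
    refine ⟨D, ?_⟩
    obtain ⟨t, ht⟩ := D.edge_eq_e ((hD ⟨Sum.inl i, hiB'⟩).2 ⟨i, hiC, rfl⟩)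
    refine ⟨t, ht.symm.trans (Subtype.ext (congrArg Sum.inl ?_))⟩
    exact Subtype.ext (Prod.ext hie hiB)

theorem petal_isThorn_iff (hG : G.IsGood)
    (hr : ∀ v w, Quotient.mk r v = Quotient.mk r w ↔ ∃ C : G.Circle, v ∈ C.verts ∧ w ∈ C.verts)
    {B : Quotient r} (x : (petal r B).toHypergraph.V) :
    (petal r B).toHypergraph.IsThorn x ↔ ∃ q, x.1 = Sum.inr q := by
  obtain ⟨v | q, hx⟩ := x
  · refine ⟨fun h => ?_, fun ⟨q, h⟩ => absurd h Sum.inl_ne_inr⟩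
    have := h.1.symm.trans (degree_eq_two_iff.2 (petal_bivalent hG v hx))
    omega
  · exact ⟨fun _ => ⟨q, rfl⟩, fun _ => petal_isThorn hG hr q hx⟩

/-- Deleting the pendant vertices leaves the block itself: any two incidences share a circle and all
degrees are two. -/
theorem petal_isFlower (hG : G.IsGood)
    (hr : ∀ v w, Quotient.mk r v = Quotient.mk r w ↔ ∃ C : G.Circle, v ∈ C.verts ∧ w ∈ C.verts)
    (B : Quotient r) :
    ((petal r B).toHypergraph.deleteVerts
      {v | (petal r B).toHypergraph.IsThorn v}).toHypergraph.IsFlower := by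
  set K := (petal r B).toHypergraph.deleteVerts {v | (petal r B).toHypergraph.IsThorn v} with hK
  have hinl : ∀ x : K.toHypergraph.I, ∃ i, x.1.1 = Sum.inl i := by
    rintro ⟨⟨i | ⟨q, b⟩, hk⟩, hx⟩
    · exact ⟨i, rfl⟩
    · exact absurd ((petal_isThorn_iff hG hr _).2 ⟨q, rfl⟩) hx
  have hmem : ∀ i (hi : Quotient.mk r (G.vert i) = B),
      (⟨Sum.inl i, hi⟩ : (petal r B).toHypergraph.I) ∈ K.incs := by
    intro i hi h
    obtain ⟨q, hq⟩ := (petal_isThorn_iff hG hr _).1 h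
    exact Sum.inl_ne_inr hq
  have hcirc : ∀ x y : K.toHypergraph.I, ∃ D : K.toHypergraph.Circle, x ∈ D.incs ∧ y ∈ D.incs := by
    intro x y
    obtain ⟨i, hi⟩ := hinl x
    obtain ⟨j, hj⟩ := hinl y
    have hiB : Quotient.mk r (G.vert i) = B := by
      have := x.1.2
      rw [hi] at this
      exact this
    have hjB : Quotient.mk r (G.vert j) = B := by
      have := y.1.2
      rw [hj] at this
      exact this
    obtain ⟨C, hiC, hjC, hC⟩ := exists_block_circle hG hr (hiB.trans hjB.symm)
    obtain ⟨D, hD⟩ := petal_exists_circle r B C (fun k hk => (hC k hk).trans hiB)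
    obtain ⟨D', -, hD'⟩ := K.exists_circle D (fun z hz => by
      obtain ⟨k, hk, hzk⟩ := (hD z).1 (Circle.mem_supp.2 hz)
      have hz' : z = ⟨Sum.inl k, (hC k hk).trans hiB⟩ := Subtype.ext hzk
      rw [hz']
      exact hmem k _)
    exact ⟨D', (hD' x).2 (Circle.mem_supp.1 ((hD _).2 ⟨i, hiC, hi⟩)),
      (hD' y).2 (Circle.mem_supp.1 ((hD _).2 ⟨j, hjC, hj⟩))⟩
  have hbiv : ∀ v : K.toHypergraph.V, K.toHypergraph.IsBivalent v := by
    rintro ⟨⟨v | q, hv⟩, hx⟩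
    · obtain ⟨i, j, hij, h⟩ := petal_bivalent hG v hv
      have hmem' : ∀ k, (petal r B).toHypergraph.vert k = ⟨Sum.inl v, hv⟩ → k ∈ K.incs := by
        intro k hk
        change ¬ (petal r B).toHypergraph.IsThorn ((petal r B).toHypergraph.vert k)
        rw [hk]
        exact hx
      refine ⟨⟨i, hmem' i ((h i).2 (Or.inl rfl))⟩, ⟨j, hmem' j ((h j).2 (Or.inr rfl))⟩,
        fun h => hij (congrArg Subtype.val h), fun k => ⟨fun hk => ?_, fun hk => ?_⟩⟩
      · exact ((h k.1).1 (congrArg Subtype.val hk)).imp (fun h => Subtype.ext h)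
          (fun h => Subtype.ext h)
      · exact Subtype.ext ((h k.1).2 (hk.imp (fun h => congrArg Subtype.val h)
          (fun h => congrArg Subtype.val h)))
    · exact absurd ((petal_isThorn_iff hG hr _).2 ⟨q, rfl⟩) hx
  have hedge : ∀ e : K.toHypergraph.E, ∃ x, K.toHypergraph.edge x = e := by
    rintro ⟨⟨q | f, hq⟩, hx⟩
    · obtain ⟨i, hie, hiB⟩ := q.2
      refine ⟨⟨⟨Sum.inl i, hiB.trans hq⟩, hmem i (hiB.trans hq)⟩, ?_⟩
      exact Subtype.ext (Subtype.ext (congrArg Sum.inl (Subtype.ext (Prod.ext hie hiB))))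
    · exact hq.elim
  obtain ⟨x₀⟩ : Nonempty K.toHypergraph.I := by
    induction B using Quotient.inductionOn with
    | h v =>
      obtain ⟨i, hi⟩ := (hG.bivalent v).exists_inc
      exact ⟨⟨⟨Sum.inl i, congrArg (Quotient.mk r) hi⟩, hmem i _⟩⟩
  obtain ⟨D, -⟩ := hcirc x₀ x₀
  have hins : K.toHypergraph.IsInseparable := fun x y _ => hcirc x y
  exact IsGood.isFlower ⟨⟨D.e 0⟩, hins.conn D (fun v => (hbiv v).exists_inc) hedge, hbiv⟩ hins D

/-- An edge does not reach a block from outside of this block. -/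
theorem not_conn_of_block
    (hr : ∀ v w, Quotient.mk r v = Quotient.mk r w ↔ ∃ C : G.Circle, v ∈ C.verts ∧ w ∈ C.verts)
    (i : G.I) :
    ¬ Conn {k | ¬ attach r k = attach r i} (Sum.inr (G.edge i)) (Sum.inl (G.vert i)) := by
  intro h
  obtain ⟨C, hiC, hC⟩ := exists_circle_of_conn (by simp) h.symm
  obtain ⟨j, hjC, hji, hj⟩ := C.isEven_supp.exists_edge (Circle.mem_supp.2 hiC)
  rcases hC (Circle.mem_supp.1 hjC) with h' | h'
  · exact hji h'
  · refine h' (Subtype.ext (Prod.ext hj ((hr _ _).2 ⟨C, ?_, ?_⟩)))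
    · exact C.mem_verts_iff.2 ⟨j, hjC, rfl⟩
    · exact C.mem_verts_iff.2 ⟨i, Circle.mem_supp.2 hiC, rfl⟩

/-- The nodes of the exploded hypergraph beyond the attachment `q`, as seen from its edge. -/
def beyond (q : Attachment r) : (G.explode r).V ⊕ (G.explode r).E → Prop :=
  Sum.elim
    (Sum.elim (fun v => ¬ Conn {k | ¬ attach r k = q} (Sum.inr q.1.1) (Sum.inl v))
      (fun x : ThornIndex r =>
        ¬ Conn {k | ¬ attach r k = q} (Sum.inr q.1.1) (Sum.inr x.1.1.1) ∨ x.1 = q))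
    (Sum.elim
      (fun x : Attachment r =>
        ¬ Conn {k | ¬ attach r k = q} (Sum.inr q.1.1) (Sum.inr x.1.1) ∨ x = q)
      (fun e => ¬ Conn {k | ¬ attach r k = q} (Sum.inr q.1.1) (Sum.inr e.1)))

/-- The predicate `beyond q` changes only across the incidence joining the pendant vertex of `q` to
its star. Deleting an end of this incidence therefore disconnects, as thorn-connections require. At
incidences attached by `q` the reason is that an edge cannot return to its block from outside. -/
theorem beyond_iff
    (hr : ∀ v w, Quotient.mk r v = Quotient.mk r w ↔ ∃ C : G.Circle, v ∈ C.verts ∧ w ∈ C.verts)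
    (q : ThornIndex r) (x : (G.explode r).I) (hx : x ≠ Sum.inr (q, false)) :
    beyond q.1 (Sum.inl ((G.explode r).vert x)) ↔ beyond q.1 (Sum.inr ((G.explode r).edge x)) := by
  obtain k | ⟨p, _ | _⟩ := x
  · change ¬ Conn _ _ _ ↔ (¬ Conn _ _ _ ∨ attach r k = q.1)
    by_cases hk : attach r k = q.1
    · simp only [hk, or_true, iff_true]
      have := not_conn_of_block hr k
      rw [hk] at this
      rwa [show G.edge k = q.1.1.1 from congrArg (fun q : Attachment r => q.1.1) hk] at this
    · simp only [hk, or_false]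
      exact not_congr (Conn.vert_iff_edge hk)
  · have hpq : p ≠ q := fun h => hx (h ▸ rfl)
    have hpq' : ¬ p.1 = q.1 := fun h => hpq (Subtype.ext h)
    change (¬ Conn _ _ _ ∨ p.1 = q.1) ↔ ¬ Conn _ _ _
    simp only [hpq', or_false]
  · exact Iff.rfl

theorem not_beyond_center (q : ThornIndex r) :
    ¬ beyond q.1 (Sum.inr (Sum.inr ⟨q.1.1.1, q.2⟩)) := fun h => h (Conn.refl _ _)

theorem explode_connected (hG : G.IsGood) : (G.explode r).IsConnected := by
  rw [isConnected_iff]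
  have hmain : ∀ a b : (G.explode r).V ⊕ (G.explode r).E, ∀ p : _ → Prop,
      (∀ i ∈ (Set.univ : Set (G.explode r).I), p (Sum.inl ((G.explode r).vert i)) ↔
        p (Sum.inr ((G.explode r).edge i))) → p a → p b := by
    intro a b p hp hpa
    have hT : ∀ q : ThornIndex r, (p (Sum.inl (Sum.inr q)) ↔ p (Sum.inr (Sum.inl q.1))) :=
      fun q => hp (Sum.inr (q, true)) trivial
    have hF : ∀ q : ThornIndex r,
        (p (Sum.inl (Sum.inr q)) ↔ p (Sum.inr (Sum.inr ⟨q.1.1.1, q.2⟩))) :=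
      fun q => hp (Sum.inr (q, false)) trivial
    have hI : ∀ i, (p (Sum.inl (Sum.inl (G.vert i))) ↔ p (Sum.inr (Sum.inl (attach r i)))) :=
      fun i => hp (Sum.inl i) trivial
    -- Different pieces of an edge are joined through the centre of its star.
    have hsame : ∀ q q' : Attachment r, q.1.1 = q'.1.1 →
        (p (Sum.inr (Sum.inl q)) ↔ p (Sum.inr (Sum.inl q'))) := by
      intro q q' h
      by_cases hqq : q = q'
      · rw [hqq]
      · have hcut : IsCutEdge r q.1.1 := by
          obtain ⟨i, hi1, hi2⟩ := q.2
          obtain ⟨j, hj1, hj2⟩ := q'.2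
          refine ⟨i, j, hi1, hj1.trans h.symm, fun hij => hqq ?_⟩
          exact Subtype.ext (Prod.ext h (hi2.symm.trans (hij.trans hj2)))
        have h1 := (hT ⟨q, hcut⟩).symm.trans (hF ⟨q, hcut⟩)
        have h2 := (hT ⟨q', h ▸ hcut⟩).symm.trans (hF ⟨q', h ▸ hcut⟩)
        have h3 : (⟨q.1.1, hcut⟩ : {e // IsCutEdge r e}) = ⟨q'.1.1, h ▸ hcut⟩ := Subtype.ext h
        rw [h3] at h1
        exact h1.trans h2.symm
    have hedge : ∀ (q : Attachment r), (∃ q' : Attachment r, q'.1.1 = q.1.1 ∧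
        p (Sum.inr (Sum.inl q'))) ↔ p (Sum.inr (Sum.inl q)) :=
      fun q => ⟨fun ⟨q', h1, h2⟩ => (hsame q' q h1).1 h2, fun h => ⟨q, rfl, h⟩⟩
    set p' : G.V ⊕ G.E → Prop := Sum.elim (fun v => p (Sum.inl (Sum.inl v)))
      (fun e => ∃ q' : Attachment r, q'.1.1 = e ∧ p (Sum.inr (Sum.inl q'))) with hp'
    have hcl : ∀ i ∈ (Set.univ : Set G.I), p' (Sum.inl (G.vert i)) ↔ p' (Sum.inr (G.edge i)) :=
      fun i _ => (hI i).trans (hedge (attach r i)).symm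
    have hlift : ∀ x : (G.explode r).V ⊕ (G.explode r).E, ∃ y, p x ↔ p' y := by
      rintro ((v | q) | (q | e))
      · exact ⟨Sum.inl v, Iff.rfl⟩
      · exact ⟨Sum.inr q.1.1.1, (hT q).trans (hedge q.1).symm⟩
      · exact ⟨Sum.inr q.1.1, (hedge q).symm⟩
      · obtain ⟨e, he⟩ := e
        have he' := he
        obtain ⟨i, -, rfl, -⟩ := he'
        exact ⟨Sum.inr (G.edge i),
          ((hF ⟨attach r i, he⟩).symm.trans (hT ⟨attach r i, he⟩)).trans (hedge (attach r i)).symm⟩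
    obtain ⟨y, hy⟩ := hlift a
    obtain ⟨z, hz⟩ := hlift b
    exact hz.2 (hG.conn y z p' hcl (hy.1 hpa))
  exact hmain

theorem explode_isFloral (hG : G.IsGood) : (G.explode r).IsFloral := by
  have hmain : ∀ v : G.V ⊕ ThornIndex r, ∃ i j : G.I ⊕ (ThornIndex r × Bool), i ≠ j ∧
      ∀ k, (G.explode r).vert k = v ↔ k = i ∨ k = j := by
    rintro (v | q)
    · obtain ⟨i, j, hij, h⟩ := hG.bivalent v
      refine ⟨Sum.inl i, Sum.inl j, by simpa using hij, ?_⟩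
      rintro (k | k)
      · simpa [explode] using h k
      · simp [explode]
    · refine ⟨Sum.inr (q, false), Sum.inr (q, true), by simp, ?_⟩
      rintro (k | ⟨q', _ | _⟩) <;> simp [explode]
  intro v hv
  have := hv.symm.trans (degree_eq_two_iff.2 (hmain v))
  omega

/-- If no cut edge left the class `B`, connectivity would make `B` the only class. This supplies
each petal with a thorn. -/
theorem exists_cutEdge (hG : G.IsGood) {v₁ v₂ : G.V}
    (hv : Quotient.mk r v₁ ≠ Quotient.mk r v₂) (B : Quotient r) :
    ∃ q : ThornIndex r, q.1.1.2 = B := by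
  by_contra! hB
  have hsame : ∀ v w : G.V, Quotient.mk r v = B → Quotient.mk r w = B := by
    intro v w hv
    refine hG.conn (Sum.inl v) (Sum.inl w) (Sum.elim (fun v => Quotient.mk r v = B)
      (fun e => ∃ i, G.edge i = e ∧ Quotient.mk r (G.vert i) = B))
      (fun i _ => ⟨fun h => ⟨i, rfl, h⟩, ?_⟩) hv
    rintro ⟨j, hj, hjB⟩
    by_contra hi
    exact hB ⟨attach r j, ⟨i, j, hj.symm, rfl, fun h => hi (h.trans hjB)⟩⟩ hjB
  induction B using Quotient.inductionOn with
  | h v => exact hv ((hsame v v₁ rfl).trans (hsame v v₂ rfl).symm)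

/-- Petals are pairwise disjoint, so the conditions on meeting pseudo-flowers are vacuous. Petals
and stars meet only in pendant vertices, and `beyond` witnesses the disconnections. -/
theorem explode_isThornConnection (hG : G.IsGood)
    (hr : ∀ v w, Quotient.mk r v = Quotient.mk r w ↔ ∃ C : G.Circle, v ∈ C.verts ∧ w ∈ C.verts)
    {v₁ v₂ : G.V} (hv : Quotient.mk r v₁ ≠ Quotient.mk r v₂) :
    (G.explode r).IsThornConnection (Set.range (petal r))
      {A | ∃ e, IsCutEdge r e ∧ A = star r e} := by
  have hdisj : ∀ B B' : Quotient r, petal r B ≠ petal r B' →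
      (petal r B).inter (petal r B') = Sub.empty _ := by
    intro B B' hne
    have hBB : B ≠ B' := fun h => hne (h ▸ rfl)
    refine Sub.ext ?_ ?_ ?_ <;> refine Set.eq_empty_of_forall_notMem ?_
    · rintro (v | q) ⟨h1, h2⟩
      · exact hBB (h1.symm.trans h2)
      · exact hBB (h1.symm.trans h2)
    · rintro (q | e) ⟨h1, h2⟩
      · exact hBB (h1.symm.trans h2)
      · exact h1
    · rintro (i | ⟨q, b⟩) ⟨h1, h2⟩
      · exact hBB (h1.symm.trans h2)
      · exact hBB (h1.2.symm.trans h2.2)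
  have hne : ∀ w, Sub.single w ≠ Sub.empty (G.explode r) := by
    intro w h
    have : w ∈ (Sub.single w).verts := rfl
    rw [h] at this
    exact this
  have hmeet : ∀ B e, (petal r B).inter (star r e) ≠ Sub.empty _ → ∃ q : ThornIndex r,
      q.1.1.2 = B ∧ q.1.1.1 = e ∧ (petal r B).inter (star r e) = Sub.single (Sum.inr q) := by
    intro B e h
    have hE : ((petal r B).inter (star r e)).edges = ∅ := by
      refine Set.eq_empty_of_forall_notMem ?_
      rintro (q | e) ⟨h1, h2⟩
      · exact h2
      · exact h1
    have hI : ((petal r B).inter (star r e)).incs = ∅ := by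
      refine Set.eq_empty_of_forall_notMem ?_
      rintro (i | ⟨q, b⟩) ⟨h1, h2⟩
      · exact h2
      · exact absurd (h1.1.symm.trans h2.1) (by simp)
    obtain ⟨w, hw⟩ : ((petal r B).inter (star r e)).verts.Nonempty := by
      rw [Set.nonempty_iff_ne_empty]
      exact fun hV => h (Sub.ext hV hE hI)
    obtain v | q := w
    · exact hw.2.elim
    · refine ⟨q, hw.1, hw.2, Sub.ext ?_ hE hI⟩
      ext x
      obtain v | q' := x
      · exact ⟨fun h => h.2.elim, fun h => absurd h Sum.inl_ne_inr⟩
      · constructor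
        · rintro ⟨h1, h2⟩
          have : q' = q := Subtype.ext (Subtype.ext
            (Prod.ext (Eq.trans h2 (Eq.symm hw.2)) (Eq.trans h1 (Eq.symm hw.1))))
          exact congrArg Sum.inr this
        · intro h
          obtain rfl : q' = q := Sum.inr_injective h
          exact hw
  refine ⟨⟨_, Quotient.mk r v₁, rfl⟩, ?_, ?_, ?_⟩
  · rintro _ ⟨B, rfl⟩
    obtain ⟨q, hq⟩ := exists_cutEdge hG hv B
    exact ⟨⟨_, petal_isThorn hG hr q hq⟩, petal_isFlower hG hr B⟩
  · constructor
    · rintro (v | q)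
      · exact ⟨_, Or.inl ⟨Quotient.mk r v, rfl⟩, rfl⟩
      · exact ⟨_, Or.inl ⟨q.1.1.2, rfl⟩, rfl⟩
    · rintro (q | e)
      · exact ⟨_, Or.inl ⟨q.1.2, rfl⟩, rfl⟩
      · exact ⟨_, Or.inr ⟨e.1, e.2, rfl⟩, rfl⟩
    · rintro (i | ⟨q, _ | _⟩)
      · exact ⟨_, Or.inl ⟨Quotient.mk r (G.vert i), rfl⟩, rfl⟩
      · exact ⟨_, Or.inr ⟨q.1.1.1, q.2, rfl⟩, rfl, rfl⟩
      · exact ⟨_, Or.inl ⟨q.1.1.2, rfl⟩, rfl, rfl⟩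
    · rintro _ ⟨e, he, rfl⟩
      exact star_isArtery r he
    · rintro _ ⟨e, he, rfl⟩ _ ⟨f, hf, rfl⟩ hef
      have hef' : e ≠ f := fun h => hef (h ▸ rfl)
      refine Sub.ext ?_ ?_ ?_ <;> refine Set.eq_empty_of_forall_notMem ?_
      · rintro (v | q) ⟨h1, h2⟩
        · exact h1
        · exact hef' (h1.symm.trans h2)
      · rintro (q | e) ⟨h1, h2⟩
        · exact h1
        · exact hef' (h1.symm.trans h2)
      · rintro (i | ⟨q, b⟩) ⟨h1, h2⟩
        · exact h1
        · exact hef' (h1.2.symm.trans h2.2)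
    · rintro _ ⟨B, rfl⟩ _ ⟨B', rfl⟩ h
      exact Or.inl (hdisj B B' h)
    · exact explode_connected hG
    · rintro _ ⟨B, rfl⟩ _ ⟨e, he, rfl⟩ h
      obtain ⟨q, -, hqe, hq⟩ := hmeet B e h
      refine ⟨⟨Sum.inr q, hqe⟩, hq, ?_⟩
      have h1 : (star r e).toHypergraph.degree ⟨Sum.inr q, hqe⟩ = 1 := by
        refine degree_eq_one_iff.2 ⟨⟨Sum.inr (q, false), rfl, hqe⟩, ?_⟩
        rintro ⟨i | ⟨q', _ | _⟩, hk⟩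
        · exact hk.elim
        · constructor
          · intro h
            obtain rfl : q' = q := Sum.inr_injective (congrArg Subtype.val h)
            rfl
          · intro h
            obtain rfl : q' = q := congrArg Prod.fst (Sum.inr_injective (congrArg Subtype.val h))
            rfl
        · exact absurd hk.1 Bool.false_ne_true.symm
      omega
    · rintro _ ⟨B, rfl⟩ _ ⟨B', rfl⟩ h h'
      exact absurd (hdisj B B' h) h'
    · rintro _ ⟨B, rfl⟩ _ ⟨B', rfl⟩ h w hw
      exact absurd (hw.symm.trans (hdisj B B' h)) (hne w)
    · rintro _ ⟨e, he, rfl⟩ (q | f) hx hconn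
      · exact hx
      · obtain rfl : f.1 = e := hx
        obtain ⟨i, j, hi, hj, hij⟩ := f.2
        -- The two pieces of the deleted centre at `i` and `j` lie in different classes; `beyond q`
        -- holds at the first and fails at the second.
        set q : ThornIndex r := ⟨attach r i, i, j, rfl, hj.trans hi.symm, hij⟩ with hq
        have hf : f = ⟨q.1.1.1, q.2⟩ := Subtype.ext hi.symm
        refine absurd (isConnected_iff.1 hconn (Sum.inr ⟨Sum.inl (attach r i), Sum.inl_ne_inr⟩)
          (Sum.inr ⟨Sum.inl (attach r j), Sum.inl_ne_inr⟩)
          (fun x => beyond q.1 (Sum.map Subtype.val Subtype.val x)) (fun x _ => ?_) (Or.inr rfl)) ?_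
        · refine beyond_iff hr q x.1 fun h => x.2 ?_
          rw [h, hf]
          rfl
        · rintro (h | h)
          · refine h ?_
            have : G.edge j = G.edge i := hj.trans hi.symm
            change Conn _ (Sum.inr (G.edge i)) (Sum.inr (G.edge j))
            rw [this]
            exact Conn.refl _ _
          · exact hij (congrArg (fun q : Attachment r => q.1.2) h).symm
    · rintro _ ⟨e, he, rfl⟩ (v | q) hx hconn
      · exact hx
      · refine not_beyond_center q (isConnected_iff.1 hconn
          (Sum.inr ⟨Sum.inl q.1, trivial⟩) (Sum.inr ⟨Sum.inr ⟨q.1.1.1, q.2⟩, trivial⟩)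
          (fun x => beyond q.1 (Sum.map Subtype.val Subtype.val x)) (fun x _ => ?_) (Or.inr rfl))
        exact beyond_iff hr q x.1 fun h => x.2 (h ▸ rfl)
  · rintro _ ⟨B, rfl⟩ _ ⟨e, he, rfl⟩ h
    obtain ⟨q, hqB, -, hq⟩ := hmeet B e h
    exact ⟨⟨Sum.inr q, hqB⟩, hq, petal_isThorn hG hr q hqB⟩

/-- Contracting the pendant vertices glues every piece of an edge back to its star, so edge classes
correspond to original edges through `gE`. -/
theorem explode_contract_iso (hG : G.IsGood) (v₀ : G.V) {S : Set (G.explode r).V}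
    (hS : ∀ x, x ∈ S ↔ ∃ q, x = Sum.inr q) : Nonempty (Iso ((G.explode r).contractVerts S) G) := by
  have hV : ∀ v : G.V, (Sum.inl v : G.V ⊕ ThornIndex r) ∉ S := by
    intro v h
    obtain ⟨q, hq⟩ := (hS _).1 h
    exact Sum.inl_ne_inr hq
  let fV : G.V → ((G.explode r).contractVerts S).V := fun v => ⟨Sum.inl v, hV v⟩
  let fI : G.I → ((G.explode r).contractVerts S).I := fun i => ⟨Sum.inl i, hV _⟩
  let gE : (G.explode r).E → G.E := Sum.elim (fun q => q.1.1) (fun e => e.1)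
  have hthorn : ∀ x : (G.explode r).I, (G.explode r).vert x ∈ S →
      ∀ q : ThornIndex r, (G.explode r).vert x = Sum.inr q →
        gE ((G.explode r).edge x) = q.1.1.1 := by
    rintro (i | ⟨q, _ | _⟩) hx q' hq'
    · exact absurd hx (hV _)
    · obtain rfl : q = q' := Sum.inr_injective hq'
      rfl
    · obtain rfl : q = q' := Sum.inr_injective hq'
      rfl
  let ψ : ((G.explode r).contractVerts S).E → G.E := Quot.lift gE <| by
    rintro e f ⟨i, j, hi, hij, rfl, rfl⟩
    obtain ⟨q, hq⟩ := (hS _).1 hi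
    rw [hthorn i hi q hq, hthorn j (hij ▸ hi) q (hij ▸ hq)]
  have hfV : Function.Bijective fV := by
    refine ⟨fun v w h => Sum.inl_injective (congrArg
      (fun x : {x // x ∈ Sᶜ} => x.1) h), ?_⟩
    rintro ⟨v | q, hx⟩
    · exact ⟨v, rfl⟩
    · exact absurd ((hS _).2 ⟨q, rfl⟩) hx
  have hfI : Function.Bijective fI := by
    refine ⟨fun v w h => Sum.inl_injective (congrArg
      (fun x : {x // (G.explode r).vert x ∉ S} => x.1) h), ?_⟩
    rintro ⟨i | ⟨q, b⟩, hx⟩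
    · exact ⟨i, rfl⟩
    · exact absurd ((hS _).2 ⟨q, rfl⟩) hx
  have hstep : ∀ q : ThornIndex r,
      (Quot.mk _ (Sum.inl q.1) : ((G.explode r).contractVerts S).E) =
        Quot.mk _ (Sum.inr ⟨q.1.1.1, q.2⟩) :=
    fun q => Quot.sound ⟨Sum.inr (q, true), Sum.inr (q, false), (hS _).2 ⟨q, rfl⟩, rfl, rfl, rfl⟩
  have hψ : Function.Bijective ψ := by
    constructor
    -- Every piece of a cut edge is identified with its centre, while an edge that is not cut has
    -- only one piece.
    · have hcut : ∀ (e : (G.explode r).E) (h : IsCutEdge r (gE e)),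
          (Quot.mk _ e : ((G.explode r).contractVerts S).E) = Quot.mk _ (Sum.inr ⟨gE e, h⟩) := by
        rintro (q | f) h
        · exact hstep ⟨q, h⟩
        · rfl
      intro x y hxy
      obtain ⟨e, rfl⟩ := Quot.exists_rep x
      obtain ⟨f, rfl⟩ := Quot.exists_rep y
      change gE e = gE f at hxy
      by_cases h : IsCutEdge r (gE e)
      · rw [hcut e h, hcut f (hxy ▸ h)]
        congr 3
      · obtain q | e := e
        · obtain q' | f := f
          · refine congrArg (fun q => Quot.mk _ (Sum.inl q)) ?_
            by_contra hne
            obtain ⟨i, hi1, hi2⟩ := q.2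
            obtain ⟨j, hj1, hj2⟩ := q'.2
            refine h ⟨i, j, hi1, hj1.trans hxy.symm, fun hij => hne ?_⟩
            exact Subtype.ext (Prod.ext hxy (hi2.symm.trans (hij.trans hj2)))
          · exact absurd (hxy ▸ f.2) h
        · exact absurd e.2 h
    · intro e
      obtain ⟨i, rfl⟩ := hG.exists_inc_edge v₀ e
      exact ⟨Quot.mk _ (Sum.inl (attach r i)), rfl⟩
  refine ⟨⟨(Equiv.ofBijective fV hfV).symm, Equiv.ofBijective ψ hψ,
    (Equiv.ofBijective fI hfI).symm, fun x => ?_, fun x => ?_⟩⟩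
  · obtain ⟨i, rfl⟩ := hfI.2 x
    rw [Equiv.ofBijective_symm_apply_apply]
    exact ((Equiv.symm_apply_eq _).2 rfl).symm
  · obtain ⟨i, rfl⟩ := hfI.2 x
    rw [Equiv.ofBijective_symm_apply_apply]
    rfl

end Block

/-- A connected hypergraph of degree two all of whose vertices lie in circles is a hypercircle. -/
theorem IsGood.isHypercircle (hG : G.IsGood) (hC : ∀ v, ∃ C : G.Circle, v ∈ C.verts) :
    G.IsHypercircle := by
  rcases isEmpty_or_nonempty G.V with hV | ⟨⟨v₀⟩⟩
  · obtain ⟨e⟩ := hG.nonempty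
    refine Or.inl ⟨hV, e, trivial, fun f _ => ?_⟩
    exact Sum.inr_injective (hG.conn (Sum.inr e) (Sum.inr f) (fun x => x = Sum.inr e)
      (fun i _ => hV.elim (G.vert i)) rfl)
  · have hr : ∀ v w, Quotient.mk (blockSetoid hG hC) v = Quotient.mk (blockSetoid hG hC) w ↔
        ∃ C : G.Circle, v ∈ C.verts ∧ w ∈ C.verts := fun v w => Quotient.eq
    by_cases hone : ∀ v w, Quotient.mk (blockSetoid hG hC) v = Quotient.mk (blockSetoid hG hC) w
    · obtain ⟨C, -⟩ := hC v₀
      refine Or.inr (Or.inl (hG.isFlower (fun i j _ => ?_) C))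
      obtain ⟨D, h1, h2, -⟩ := exists_block_circle hG hr (hone (G.vert i) (G.vert j))
      exact ⟨D, Circle.mem_supp.1 h1, Circle.mem_supp.1 h2⟩
    · push Not at hone
      obtain ⟨v₁, v₂, hv⟩ := hone
      refine Or.inr (Or.inr ⟨_, _, _, explode_isThornConnection hG hr hv, explode_isFloral hG,
        explode_contract_iso hG v₀ ?_⟩)
      rintro (v | q)
      · refine ⟨?_, fun ⟨q, hq⟩ => absurd hq Sum.inl_ne_inr⟩
        rintro ⟨_, ⟨e, -, rfl⟩, h⟩
        exact h.elim
      · exact ⟨fun _ => ⟨q, rfl⟩, fun _ => ⟨_, ⟨q.1.1.1, q.2, rfl⟩, rfl⟩⟩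

end IncHypergraph

namespace OrientedHypergraph

open IncHypergraph

variable {G : OrientedHypergraph.{u}}

/-! ### Contraction of vertices that lie in no circle -/

open Classical in
/-- The map that identifies the edge `b` with the edge `a`. -/
noncomputable def identifyEdge {a b : G.E} (hab : a ≠ b) (e : G.E) : {e : G.E // e ≠ b} :=
  if h : e = b then ⟨a, hab⟩ else ⟨e, h⟩

theorem identifyEdge_self {a b : G.E} (hab : a ≠ b) : identifyEdge hab b = ⟨a, hab⟩ := by
  simp [identifyEdge]

theorem identifyEdge_of_ne {a b e : G.E} (hab : a ≠ b) (h : e ≠ b) :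
    identifyEdge hab e = ⟨e, h⟩ := by
  simp [identifyEdge, h]

/-- Deletion of the vertex `u` and identification of the edges `a` and `b`. -/
noncomputable def contractAt (G : OrientedHypergraph.{u}) (u : G.V) {a b : G.E} (hab : a ≠ b) :
    OrientedHypergraph.{u} where
  V := {v : G.V // v ≠ u}
  E := {e : G.E // e ≠ b}
  I := {k : G.I // G.vert k ≠ u}
  vert k := ⟨G.vert k.1, k.2⟩
  edge k := identifyEdge hab (G.edge k.1)
  σ k := G.σ k.1
  finite_V := inferInstance
  finite_E := inferInstance
  finite_I := inferInstance

section

variable {u : G.V} {i j : G.I}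

/-- The two edges at a vertex that lies in no circle are not joined by a walk avoiding it. -/
theorem not_isJoin_of_bridge (hij : i ≠ j) (hu : ∀ k, G.vert k = u ↔ k = i ∨ k = j)
    (hC : ∀ C : G.toIncHypergraph.Circle, u ∉ C.verts)
    {P : Finset G.I} (hiP : i ∉ P) (hjP : j ∉ P) :
    ¬ IsJoin (G := G.toIncHypergraph) P (Sum.inr (G.edge i)) (Sum.inr (G.edge j)) := by
  intro hP
  have hi : G.vert i = u := (hu i).2 (Or.inl rfl)
  have hj : G.vert j = u := (hu j).2 (Or.inr rfl)
  have heven : IsEven (G := G.toIncHypergraph) (insert i (insert j P)) := by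
    intro h
    have h1 := hP h
    rw [endSum] at h1 ⊢
    rw [Finset.sum_insert (by simp [hij, hiP]), Finset.sum_insert hjP, h1, hi, hj]
    linear_combination CharTwo.add_self_eq_zero (h (Sum.inl u)) +
      CharTwo.add_self_eq_zero (h (Sum.inr (G.edge i))) +
      CharTwo.add_self_eq_zero (h (Sum.inr (G.edge j)))
  obtain ⟨C, hC', -⟩ := heven.exists_circle (Finset.mem_insert_self i _)
  exact hC C (C.mem_verts_iff.2 ⟨i, hC', hi⟩)

theorem contractAt_isGood (hu : ∀ k, G.vert k = u ↔ k = i ∨ k = j)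
    (hG : G.toIncHypergraph.IsGood) (hab : G.edge i ≠ G.edge j) :
    (G.contractAt u hab).toIncHypergraph.IsGood := by
  refine ⟨⟨⟨G.edge i, hab⟩⟩, fun x y p hp hpx => ?_, ?_⟩
  · set q : G.V ⊕ G.E → Prop := Sum.elim
      (fun v => (∃ h : v ≠ u, p (Sum.inl ⟨v, h⟩)) ∨ (v = u ∧ p (Sum.inr ⟨G.edge i, hab⟩)))
      (fun e => p (Sum.inr (identifyEdge hab e))) with hq
    have hclosed : ∀ k ∈ (Set.univ : Set G.I), q (Sum.inl (G.vert k)) ↔ q (Sum.inr (G.edge k)) := by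
      intro k _
      simp only [hq, Sum.elim_inl, Sum.elim_inr]
      by_cases hk : G.vert k = u
      · have : identifyEdge hab (G.edge k) = ⟨G.edge i, hab⟩ := by
          rcases (hu k).1 hk with rfl | rfl
          · exact identifyEdge_of_ne hab hab
          · exact identifyEdge_self hab
        rw [this]
        exact ⟨fun h => h.elim (fun ⟨h, _⟩ => absurd hk h) And.right, fun h => Or.inr ⟨hk, h⟩⟩
      · have := hp ⟨k, hk⟩ trivial
        exact ⟨fun h => this.1 (h.elim (fun ⟨_, h⟩ => h) fun h => absurd h.1 hk),
          fun h => Or.inl ⟨hk, this.2 h⟩⟩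
    have hlift : ∀ x, ∃ y, p x ↔ q y := by
      rintro (⟨v, hv⟩ | ⟨e, he⟩)
      · exact ⟨Sum.inl v, fun h => Or.inl ⟨hv, h⟩,
          fun h => h.elim (fun ⟨_, h⟩ => h) fun h => absurd h.1 hv⟩
      · refine ⟨Sum.inr e, ?_⟩
        simp only [hq, Sum.elim_inr]
        rw [identifyEdge_of_ne hab he]
    obtain ⟨y', hy⟩ := hlift x
    obtain ⟨z', hz⟩ := hlift y
    exact hz.2 (hG.conn y' z' q hclosed (hy.1 hpx))
  · rintro ⟨v, hv⟩
    obtain ⟨k, l, hkl, h⟩ := hG.bivalent v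
    refine ⟨⟨k, fun h' => hv (((h k).2 (Or.inl rfl)).symm.trans h')⟩,
      ⟨l, fun h' => hv (((h l).2 (Or.inr rfl)).symm.trans h')⟩,
      fun h => hkl (congrArg (fun x : {k : G.I // G.vert k ≠ u} => x.1) h), fun m => ?_⟩
    constructor
    · intro hm
      exact ((h m.1).1 (congrArg (fun x : {v : G.V // v ≠ u} => x.1) hm)).imp
        (fun h => Subtype.ext h) (fun h => Subtype.ext h)
    · intro hm
      exact Subtype.ext ((h m.1).2 (hm.imp
        (fun h => congrArg (fun x : {k : G.I // G.vert k ≠ u} => x.1) h)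
        (fun h => congrArg (fun x : {k : G.I // G.vert k ≠ u} => x.1) h)))

/-- An even set of the contraction is even in `G`, except possibly for odd parity at both edges of
`u`. In that case it would join these edges while avoiding `u`, and `u` would lie in a circle. -/
theorem contractAt_isBalanced (hij : i ≠ j) (hu : ∀ k, G.vert k = u ↔ k = i ∨ k = j)
    (hb : G.IsBalanced) (hab : G.edge i ≠ G.edge j)
    (hC : ∀ C : G.toIncHypergraph.Circle, u ∉ C.verts) : (G.contractAt u hab).IsBalanced := by
  classical
  rw [isBalanced_iff] at hb ⊢
  intro S hS
  let f : {k : G.I // G.vert k ≠ u} ↪ G.I := Function.Embedding.subtype _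
  obtain ⟨T, hT⟩ : ∃ T : Finset {k : G.I // G.vert k ≠ u}, T = S := ⟨S, rfl⟩
  -- The parity at the edge that disappears measures the only possible failure of evenness.
  set c : ZMod 2 := ∑ k ∈ T, if G.edge k.1 = G.edge j then 1 else 0 with hc
  have hsum : ∀ h, endSum (G := G.toIncHypergraph) (T.map f) h =
      c * (h (Sum.inr (G.edge i)) + h (Sum.inr (G.edge j))) := by
    intro h
    have h1 : ∑ k ∈ T, (h (Sum.inl (G.vert k.1)) +
        h (Sum.inr (identifyEdge hab (G.edge k.1)).1)) = 0 := by
      rw [hT]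
      exact hS (fun x => h (Sum.map Subtype.val Subtype.val x))
    rw [endSum, Finset.sum_map, ← sub_zero (∑ x ∈ T, _), ← h1, ← Finset.sum_sub_distrib, hc,
      Finset.sum_mul]
    refine Finset.sum_congr rfl fun k _ => ?_
    by_cases hk : G.edge k.1 = G.edge j
    · rw [if_pos hk, hk, identifyEdge_self]
      simp only [f, Function.Embedding.subtype_apply, hk]
      linear_combination -CharTwo.add_self_eq_zero (h (Sum.inr (G.edge i)))
    · rw [if_neg hk, identifyEdge_of_ne hab hk]
      simp [f]
  have hnot : ∀ m, G.vert m = u → m ∉ T.map f := by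
    intro m hm h
    obtain ⟨k, -, rfl⟩ := Finset.mem_map.1 h
    exact k.2 hm
  have hc0 : c = 0 := by
    by_contra hne
    have hc1 : c = 1 := (Fin.eq_one_of_ne_zero c hne)
    refine not_isJoin_of_bridge hij hu hC (hnot i ((hu i).2 (Or.inl rfl)))
      (hnot j ((hu j).2 (Or.inr rfl))) (fun h => ?_)
    rw [hsum, hc1, one_mul]
  have := hb (T.map f) (fun h => by rw [hsum, hc0, zero_mul])
  rw [Finset.sum_map, hT] at this
  exact this

theorem contractAt_parallelAgree (hij : i ≠ j) (hu : ∀ k, G.vert k = u ↔ k = i ∨ k = j)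
    (hp : G.ParallelAgree) (hab : G.edge i ≠ G.edge j)
    (hC : ∀ C : G.toIncHypergraph.Circle, u ∉ C.verts) : (G.contractAt u hab).ParallelAgree := by
  -- Incidences that become parallel only by the contraction would connect the two edges at `u`
  -- around it.
  have key : ∀ k l : G.I, G.vert k ≠ u → G.vert k = G.vert l → G.edge k = G.edge i →
      G.edge l = G.edge j → False := by
    intro k l hk hkl hki hlj
    have hkl' : k ≠ l := fun h => hab (by rw [← hki, ← hlj, h])
    have hnot : ∀ m, G.vert m = u → m ∉ ({k, l} : Finset G.I) := by
      intro m hm h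
      rcases Finset.mem_insert.1 h with rfl | h
      · exact hk hm
      · rw [Finset.mem_singleton.1 h] at hm
        exact hk (hkl.trans hm)
    refine not_isJoin_of_bridge hij hu hC (hnot i ((hu i).2 (Or.inl rfl)))
      (hnot j ((hu j).2 (Or.inr rfl))) (fun h => ?_)
    rw [endSum, Finset.sum_pair hkl', hkl, hki, hlj]
    linear_combination CharTwo.add_self_eq_zero (h (Sum.inl (G.vert l)))
  rintro ⟨k, hk⟩ ⟨l, hl⟩ hv he
  have hv' : G.vert k = G.vert l := congrArg (fun x : {v : G.V // v ≠ u} => x.1) hv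
  change identifyEdge hab (G.edge k) = identifyEdge hab (G.edge l) at he
  change G.σ k = G.σ l
  by_cases hkj : G.edge k = G.edge j <;> by_cases hlj : G.edge l = G.edge j
  · exact hp k l hv' (hkj.trans hlj.symm)
  · rw [hkj, identifyEdge_self, identifyEdge_of_ne hab hlj, Subtype.mk.injEq] at he
    exact (key l k hl hv'.symm he.symm hkj).elim
  · rw [hlj, identifyEdge_self, identifyEdge_of_ne hab hkj, Subtype.mk.injEq] at he
    exact (key k l hk hv' he hlj).elim
  · rw [identifyEdge_of_ne hab hkj, identifyEdge_of_ne hab hlj, Subtype.mk.injEq] at he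
    exact hp k l hv' he

theorem subdivide_edge_of_mem {e : G.E} {B : Set G.I} {s t : ℤˣ} {i : G.I} (he : G.edge i = e)
    (hi : i ∈ B) : (G.subdivide e B s t).edge (Sum.inl i : G.I ⊕ Bool) = (none : Option G.E) :=
  if_pos ⟨he, hi⟩

theorem subdivide_edge_of_notMem {e : G.E} {B : Set G.I} {s t : ℤˣ} {i : G.I} (hi : i ∉ B) :
    (G.subdivide e B s t).edge (Sum.inl i : G.I ⊕ Bool) = some (G.edge i) :=
  if_neg fun h => hi h.2

/-- The incidences that came from the edge of `j` form the part to be split off again; the deleted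
incidences return with their own signs. -/
theorem subdivide_contractAt_iso (hij : i ≠ j) (hu : ∀ k, G.vert k = u ↔ k = i ∨ k = j)
    (hab : G.edge i ≠ G.edge j) :
    ∃ φ : Iso ((G.contractAt u hab).subdivide ⟨G.edge i, hab⟩
      {k : {k : G.I // G.vert k ≠ u} | G.edge k.1 = G.edge j} (G.σ i) (G.σ j)) G,
      φ.onV (none : Option {v : G.V // v ≠ u}) = u := by
  classical
  let fV : Option {v : G.V // v ≠ u} → G.V := fun o => o.elim u Subtype.val
  let fE : Option {e : G.E // e ≠ G.edge j} → G.E := fun o => o.elim (G.edge j) Subtype.val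
  let fI : {k : G.I // G.vert k ≠ u} ⊕ Bool → G.I :=
    Sum.elim Subtype.val (fun b => if b then j else i)
  have hbij : ∀ {α : Type u} (a : α),
      Function.Bijective (fun o : Option {x : α // x ≠ a} => o.elim a Subtype.val) := by
    intro α a
    constructor
    · rintro (_ | x) (_ | y) h
      · rfl
      · exact absurd h.symm y.2
      · exact absurd h x.2
      · exact congrArg some (Subtype.ext h)
    · intro x
      by_cases h : x = a
      · exact ⟨none, h.symm⟩
      · exact ⟨some ⟨x, h⟩, rfl⟩
  have hi := (hu i).2 (Or.inl rfl)
  have hj := (hu j).2 (Or.inr rfl)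
  have hfI : Function.Bijective fI := by
    constructor
    · rintro (x | _ | _) (y | _ | _) h
      · exact congrArg Sum.inl (Subtype.ext h)
      · exact absurd ((congrArg G.vert h).trans hi) x.2
      · exact absurd ((congrArg G.vert h).trans hj) x.2
      · exact absurd ((congrArg G.vert h).symm.trans hi) y.2
      · rfl
      · exact absurd h hij
      · exact absurd ((congrArg G.vert h).symm.trans hj) y.2
      · exact absurd h.symm hij
      · rfl
    · intro k
      by_cases h : G.vert k = u
      · rcases (hu k).1 h with rfl | rfl
        · exact ⟨Sum.inr false, rfl⟩
        · exact ⟨Sum.inr true, rfl⟩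
      · exact ⟨Sum.inl ⟨k, h⟩, rfl⟩
  have hvert : ∀ k : {k : G.I // G.vert k ≠ u} ⊕ Bool, G.vert (fI k) =
      fV (Sum.elim (fun k => some ⟨G.vert k.1, k.2⟩) (fun _ => none) k) := by
    rintro (k | _ | _)
    · rfl
    · exact hi
    · exact hj
  have hedge : ∀ k : {k : G.I // G.vert k ≠ u} ⊕ Bool, G.edge (fI k) =
      fE (((G.contractAt u hab).subdivide ⟨G.edge i, hab⟩
        {k : {k : G.I // G.vert k ≠ u} | G.edge k.1 = G.edge j} (G.σ i) (G.σ j)).edge k) := by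
    rintro (k | _ | _)
    · by_cases hk : G.edge k.1 = G.edge j
      · have he : identifyEdge hab (G.edge k.1) = ⟨G.edge i, hab⟩ := by
          rw [hk, identifyEdge_self]
        exact hk.trans (congrArg fE (subdivide_edge_of_mem (G := G.contractAt u hab) he hk)).symm
      · refine Eq.trans ?_
          (congrArg fE (subdivide_edge_of_notMem (G := G.contractAt u hab) (i := k) hk)).symm
        change _ = (identifyEdge hab (G.edge k.1)).1
        rw [identifyEdge_of_ne hab hk]
        rfl
    · rfl
    · rfl
  have hσ : ∀ k : {k : G.I // G.vert k ≠ u} ⊕ Bool, G.σ (fI k) =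
      Sum.elim (fun k => G.σ k.1) (fun b => if b then G.σ j else G.σ i) k := by
    rintro (k | _ | _) <;> rfl
  exact ⟨{
    onV := Equiv.ofBijective fV (hbij u)
    onE := Equiv.ofBijective fE (hbij (G.edge j))
    onI := Equiv.ofBijective fI hfI
    vert_onI := hvert
    edge_onI := hedge
    σ_onI := hσ }, rfl⟩

end

/-- A balanced connected oriented hypergraph of degree two is a balanced subdivision of a balanced
hypercircle. -/
theorem exists_hypercircle (G : OrientedHypergraph.{u}) (hG : G.toIncHypergraph.IsGood)
    (hb : G.IsBalanced) : ∃ H : OrientedHypergraph.{u}, H.IsBalancedHypercircle ∧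
      H.IsBalancedSubdivision G ∧ (G.ParallelAgree → H.ParallelAgree) := by
  induction hn : Nat.card G.V using Nat.strong_induction_on generalizing G with
  | _ n ih =>
    by_cases hC : ∀ v, ∃ C : G.toIncHypergraph.Circle, v ∈ C.verts
    · exact ⟨G, ⟨hG.isHypercircle hC, hb⟩, Relation.ReflTransGen.refl, id⟩
    · push Not at hC
      obtain ⟨u, hC⟩ := hC
      obtain ⟨i, j, hij, hu⟩ := hG.bivalent u
      -- If the edges coincided, the empty set would join them, and `u` would lie in a circle.
      have hab : G.edge i ≠ G.edge j := fun h =>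
        not_isJoin_of_bridge hij hu hC (P := ∅) (by simp) (by simp) (h ▸ isJoin_empty _)
      obtain ⟨H, hH, hsub, hpar⟩ := ih (Nat.card {v : G.V // v ≠ u})
        (hn ▸ Finite.card_subtype_lt (x := u) (by simp)) (G.contractAt u hab)
        (contractAt_isGood hu hG hab) (contractAt_isBalanced hij hu hb hab hC) rfl
      obtain ⟨φ, hφ⟩ := subdivide_contractAt_iso hij hu hab
      refine ⟨H, hH, hsub.tail ⟨_, _, _, _, ⟨φ⟩, ?_⟩,
        fun hp => hpar (contractAt_parallelAgree hij hu hp hab hC)⟩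
      rcases Int.units_eq_one_or (G.σ i * G.σ j) with hs | hs
      -- Equal signs are allowed here because a circle through the new vertex would be carried by
      -- `φ` to an even set at `u`, and so yield a circle through `u`.
      · refine Or.inr ⟨hs, fun C hmem => ?_⟩
        obtain ⟨k, hk, hkv⟩ := C.mem_verts_iff.1 hmem
        have heven := C.isEven_supp.map φ.onV φ.onE φ.onI φ.onI.injective φ.vert_onI φ.edge_onI
        obtain ⟨D, hD, -⟩ := heven.exists_circle (Finset.mem_map_of_mem _ hk)
        exact hC D (D.mem_verts_iff.2 ⟨_, hD, (φ.vert_onI k).trans (by rw [hkv]; exact hφ)⟩)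
      · exact Or.inl hs

end OrientedHypergraph

/-- The hypercircle obtained from `G` by contraction inherits the agreement of parallel signs, so a
single construction serves both equivalences. -/
theorem theorem7 (G : OrientedHypergraph.{u}) (hG : ∀ v, G.degree v ≠ 0) :
    ((G.IsBalanced ∧ G.IsMinimallyDependent) ↔
      ∃ H : OrientedHypergraph.{u}, H.IsBalancedHypercircle ∧ H.IsBalancedSubdivision G) ∧
    (G.ParallelAgree →
      ((G.IsBalanced ∧ G.IsMinimallyDependent) ↔
        ∃ H : OrientedHypergraph.{u}, H.ParallelAgree ∧ H.IsBalancedHypercircle ∧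
          H.IsBalancedSubdivision G)) := by
  have hmp : G.IsBalanced ∧ G.IsMinimallyDependent → ∃ H : OrientedHypergraph.{u},
      H.IsBalancedHypercircle ∧ H.IsBalancedSubdivision G ∧ (G.ParallelAgree → H.ParallelAgree) :=
    fun h => OrientedHypergraph.exists_hypercircle G (h.2.isGood h.1 hG) h.1
  have hmpr : ∀ H : OrientedHypergraph.{u}, H.IsBalancedHypercircle → H.IsBalancedSubdivision G →
      G.IsBalanced ∧ G.IsMinimallyDependent := by
    intro H hH hsub
    have h := hsub.isGood_and_isBalanced
      (hH.1.isGood (OrientedHypergraph.isBalanced_iff.1 hH.2)) hH.2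
    exact ⟨h.2, h.2.isMinimallyDependent h.1⟩
  refine ⟨⟨fun h => ?_, fun ⟨H, h1, h2⟩ => hmpr H h1 h2⟩,
    fun hp => ⟨fun h => ?_, fun ⟨H, _, h1, h2⟩ => hmpr H h1 h2⟩⟩
  · obtain ⟨H, h1, h2, -⟩ := hmp h
    exact ⟨H, h1, h2⟩
  · obtain ⟨H, h1, h2, h3⟩ := hmp h
    exact ⟨H, h3 hp, h1, h2⟩
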